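/- Let $n\in\mathbb N=\{1,2,\dots\}$, $\langle\xi\rangle=(1+|\xi|^2)^{1/2}$ and $D_x^\beta=(-i)^{|\beta|}\partial_x^\beta$. Throughout $m\in\mathbb R$, $0\le\rho,\delta\le1$, $M\in\mathbb N_0\cup\{\infty\}$, $\tilde m\in\mathbb N_0$, $0<\tau<1$; functions are complex valued. Symbol classes. (a) $C^{\tilde m,\tau}(\mathbb R^n)$ is the Hölder space with norm $\|f\|_{C^{\tilde m,\tau}}=\max_{|\beta|\le\tilde m}\big(\sup_x|\partial^\beta f(x)|+\sup_{x\ne y}\frac{|\partial^\beta f(x)-\partial^\beta f(y)|}{|x-y|^\tau}\big)$. The class $C^{\tilde m,\tau}S^m_{\rho,\delta}(M)$ consists of all $a:\mathbb R^n_x\times\mathbb R^n_\xi\to\mathbb C$ such that for all $|\alpha|\le M$, $|\beta|\le\tilde m$: $\partial_x^\beta a(x,\cdot)\in C^M(\mathbb R^n)$ for every $x$; $\partial_x^\beta\partial_\xi^\alpha a$ exists and is continuous on $\mathbb R^n\times\mathbb R^n$; $|\partial_\xi^\alpha a(x,\xi)|\le C_\alpha\langle\xi\rangle^{m-\rho|\alpha|}$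 for all $x,\xi$; and $\|\partial_\xi^\alpha a(\cdot,\xi)\|_{C^{\tilde m,\tau}}\le C_\alpha\langle\xi\rangle^{m-\rho|\alpha|+\delta(\tilde m+\tau)}$ for all $\xi$. (b) $C^{\tilde m,\tau}\dot S^m_{\rho,\delta}(M)$ consists of all $a\in C^{\tilde m,\tau}S^m_{\rho,\delta}(M)$ such that for all $|\alpha|\le M$, $|\beta|\le\tilde m$ there is a bounded function $C_{\alpha,\beta}$ with $C_{\alpha,\beta}(x)\to0$ as $|x|\to\infty$ and $|\partial_\xi^\alpha D_x^\beta a(x,\xi)|\le C_{\alpha,\beta}(x)\langle\xi\rangle^{m-\rho|\alpha|+\delta|\beta|}$ for all $x,\xi$. (c) $S^m_{\rho,\delta}(M)$ consists of all $M$ times continuously differentiable $a:\mathbb R^n_x\times\mathbb R^n_\xi\to\mathbb C$ which are smooth in $x$ and whose derivatives $\partial_\xi^\alpha\partial_x^\beta a$, $|\alpha|\le M$, $\beta\in\mathbb N_0^n$ arbitrary, exist, are continuous and satisfy $|\partial_\xi^\alpha\partial_x^\beta a(x,\xi)|\le C_{\alpha,\beta}\langle\xi\rangle^{m-\rho|\alpha|+\delta|\beta|}$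 for all $x,\xi$. Such an $a$ is slowly varying, $a\in\tilde S^m_{\rho,\delta}(M)$, if for all $|\alpha|\le M$ and all $\beta\ne0$ one has $|\partial_\xi^\alpha D_x^\beta a(x,\xi)|\le C_{\alpha,\beta}(x)\langle\xi\rangle^{m-\rho|\alpha|+\delta|\beta|}$ with a bounded function $C_{\alpha,\beta}$ satisfying $C_{\alpha,\beta}(x)\to0$ as $|x|\to\infty$. Oscillatory integrals. $\mathrm{Os}\text{-}\iint e^{-iy\cdot\eta}F(y,\eta)\,dy\,\tfrac{d\eta}{(2\pi)^n}:=\lim_{\varepsilon\to0+}\iint\chi(\varepsilon y,\varepsilon\eta)e^{-iy\cdot\eta}F(y,\eta)\,dy\,\tfrac{d\eta}{(2\pi)^n}$, which is said to exist if for every $\chi\in\mathcal S(\mathbb R^n\times\mathbb R^n)$ with $\chi(0,0)=1$ the integrals converge absolutely for $\varepsilon>0$ and the limit exists, with a value that does not depend on $\chi$. Statement. Let $\tilde m_1\in\mathbb N$, $0<\tau_1<1$, $m_1,m_2\in\mathbb R$, $0\le\delta<\rho\le1$ and $M_1,M_2\in\mathbb N_0\cup\{\infty\}$ with $M_1>n+1$;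 put $N:=M_1-(n+1)$. Let $a_1\in C^{\tilde m_1,\tau_1}S^{m_1}_{\rho,\delta}(M_1)$ and $a_2\in S^{m_2}_{\rho,\delta}(M_2)$, and define $$a(x,\xi):=\mathrm{Os}\text{-}\iint e^{-iy\cdot\eta}a_1(x,\xi+\eta)\,a_2(x+y,\xi)\,dy\,\tfrac{d\eta}{(2\pi)^n} .$$ For $k\in\mathbb N$ with $k\le N$, $|\gamma|=k$ and $\theta\in[0,1]$ put $$a_1\sharp_ka_2(x,\xi):=\sum_{|\gamma|<k}\frac1{\gamma!}\,\partial_\xi^\gamma a_1(x,\xi)\,D_x^\gamma a_2(x,\xi),$$ $$r_{\gamma,\theta}(x,\xi):=\mathrm{Os}\text{-}\iint e^{-iy\cdot\eta}(\partial_\xi^\gamma a_1)(x,\xi+\theta\eta)\,(D_x^\gamma a_2)(x+y,\xi)\,dy\,\tfrac{d\eta}{(2\pi)^n},$$ $$R_k(x,\xi):=k\sum_{|\gamma|=k}\int_0^1\frac{(1-\theta)^{k-1}}{\gamma!}\,r_{\gamma,\theta}(x,\xi)\,d\theta,$$ and $\tilde M_k:=\min\{M_1-k+1,M_2\}$, $\tilde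 N_k:=\min\{M_1-k-(n+1),M_2\}$. Then the oscillatory integrals defining $a(x,\xi)$ and $r_{\gamma,\theta}(x,\xi)$ exist, $\theta\mapsto r_{\gamma,\theta}(x,\xi)$ is integrable on $[0,1]$, and for every $k\in\mathbb N$ with $k\le N$: 1. $a(x,\xi)=a_1\sharp_ka_2(x,\xi)+R_k(x,\xi)$ for all $x,\xi\in\mathbb R^n$; 2. $a_1\sharp_ka_2\in C^{\tilde m_1,\tau_1}S^{m_1+m_2}_{\rho,\delta}(\tilde M_k)$; 3. $R_k\in C^{\tilde m_1,\tau_1}S^{m_1+m_2-(\rho-\delta)k}_{\rho,\delta}(\tilde N_k)$; 4. if moreover $a_2\in\tilde S^{m_2}_{\rho,\delta}(M_2)$, then $R_k\in C^{\tilde m_1,\tau_1}\dot S^{m_1+m_2-(\rho-\delta)k}_{\rho,\delta}(\tilde N_k)$. In particular $a\in C^{\tilde m_1,\tau_1}S^{m_1+m_2}_{\rho,\delta}(\tilde N_1)$. -/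

import Mathlib

open MeasureTheory Filter Topology
open scoped NNReal ENNReal ContDiff

noncomputable section

namespace NonsmoothPDO

/-- `ℝⁿ` with the Euclidean norm and Lebesgue measure. -/
abbrev E (n : ℕ) := EuclideanSpace ℝ (Fin n)

/-- The Japanese bracket `⟨ξ⟩ = (1 + |ξ|²)^{1/2}`. -/
def jap {n : ℕ} (ξ : E n) : ℝ := Real.sqrt (1 + ‖ξ‖ ^ 2)

/-- The length `|α| = α₁ + … + αₙ` of a multi-index. -/
def len {n : ℕ} (α : Fin n → ℕ) : ℕ := ∑ i, α i

/-- The factorial `α! = α₁! ⋯ αₙ!` of a multi-index. -/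
def mfact {n : ℕ} (α : Fin n → ℕ) : ℕ := ∏ i, (α i).factorial

/-- The finite set of all multi-indices of length `k`. -/
def multiIdx (n k : ℕ) : Finset (Fin n → ℕ) := Finset.piAntidiag Finset.univ k

theorem mem_multiIdx {n k : ℕ} {γ : Fin n → ℕ} : γ ∈ multiIdx n k ↔ len γ = k := by
  simp [multiIdx, len]

/-- The classical partial derivative `∂ᵢ f`. -/
def pd {n : ℕ} (i : Fin n) (f : E n → ℂ) : E n → ℂ :=
  fun x => lineDeriv ℝ f x (EuclideanSpace.single i 1)

/-- `∂^α f = ∂₁^{α₁} ⋯ ∂ₙ^{αₙ} f`. -/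
def mpd {n : ℕ} (α : Fin n → ℕ) (f : E n → ℂ) : E n → ℂ :=
  (List.finRange n).foldr (fun i g => (pd i)^[α i] g) f

/-- `∂_x^β a` for a function `a = a(x, ξ)`. -/
def dx {n : ℕ} (β : Fin n → ℕ) (a : E n → E n → ℂ) : E n → E n → ℂ :=
  fun x ξ => mpd β (fun x' => a x' ξ) x

/-- `∂_ξ^α a` for a function `a = a(x, ξ)`. -/
def dxi {n : ℕ} (α : Fin n → ℕ) (a : E n → E n → ℂ) : E n → E n → ℂ :=
  fun x ξ => mpd α (fun ξ' => a x ξ') ξ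

/-- `D_x^β a = (-i)^{|β|} ∂_x^β a`. -/
def Dx {n : ℕ} (β : Fin n → ℕ) (a : E n → E n → ℂ) : E n → E n → ℂ :=
  fun x ξ => (-Complex.I) ^ len β * dx β a x ξ

/-- The (extended) norm of `C^{r,τ}(ℝⁿ)`: the maximum over `|β| ≤ r` of the `C^{0,τ}` norms
`sup |∂^β f| + sup_{x ≠ y} |∂^β f(x) - ∂^β f(y)| / |x - y|^τ`. -/
def holderNorm {n : ℕ} (r : ℕ) (τ : ℝ≥0) (f : E n → ℂ) : ℝ≥0∞ :=
  ⨆ (β : Fin n → ℕ) (_ : len β ≤ r), ((⨆ x, ‖mpd β f x‖ₑ) + eHolderNorm τ (mpd β f))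

/-- Non-smooth symbols: `a ∈ C^{r,τ} S^m_{ρ,δ}(ℝⁿ × ℝⁿ; M)`. -/
structure IsHolderSymbol {n : ℕ} (r : ℕ) (τ : ℝ≥0) (m ρ δ : ℝ) (M : ℕ∞)
    (a : E n → E n → ℂ) : Prop where
  contDiff_x : ∀ α : Fin n → ℕ, (len α : ℕ∞) ≤ M →
    ∀ ξ, ContDiff ℝ r (fun x => dxi α a x ξ)
  contDiff_xi : ∀ β : Fin n → ℕ, len β ≤ r → ∀ x, ContDiff ℝ M (fun ξ => dx β a x ξ)
  continuous_deriv : ∀ α β : Fin n → ℕ, (len α : ℕ∞) ≤ M → len β ≤ r →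
    Continuous (fun p : E n × E n => dx β (dxi α a) p.1 p.2)
  bound : ∀ α : Fin n → ℕ, (len α : ℕ∞) ≤ M →
    ∃ C : ℝ, ∀ x ξ, ‖dxi α a x ξ‖ ≤ C * jap ξ ^ (m - ρ * len α)
  holder_bound : ∀ α : Fin n → ℕ, (len α : ℕ∞) ≤ M →
    ∃ C : ℝ, ∀ ξ, holderNorm r τ (fun x => dxi α a x ξ)
      ≤ ENNReal.ofReal (C * jap ξ ^ (m - ρ * len α + δ * (r + τ)))

/-- A bounded function on `ℝⁿ` which converges to zero as `|x| → ∞`. -/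
def BoundedVanishing {n : ℕ} (C : E n → ℝ) : Prop :=
  (∃ B : ℝ, ∀ x, |C x| ≤ B) ∧ Tendsto C (cocompact (E n)) (𝓝 0)

/-- Decaying non-smooth symbols: `a ∈ C^{r,τ} Ṡ^m_{ρ,δ}(ℝⁿ × ℝⁿ; M)`. -/
structure IsDottedHolderSymbol {n : ℕ} (r : ℕ) (τ : ℝ≥0) (m ρ δ : ℝ) (M : ℕ∞)
    (a : E n → E n → ℂ) : Prop extends IsHolderSymbol r τ m ρ δ M a where
  decay : ∀ α β : Fin n → ℕ, (len α : ℕ∞) ≤ M → len β ≤ r →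
    ∃ C : E n → ℝ, BoundedVanishing C ∧
      ∀ x ξ, ‖dxi α (Dx β a) x ξ‖ ≤ C x * jap ξ ^ (m - ρ * len α + δ * len β)

/-- Symbols smooth in `x`: `a ∈ S^m_{ρ,δ}(ℝⁿ × ℝⁿ; M)`. The function is `M` times continuously
differentiable, it is smooth in `x`, and the derivatives `∂_ξ^α ∂_x^β a` with `|α| ≤ M` and
arbitrary `β` exist, are continuous and satisfy the symbol estimates. -/
structure IsSmoothSymbol {n : ℕ} (m ρ δ : ℝ) (M : ℕ∞) (a : E n → E n → ℂ) : Prop where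
  contDiff : ContDiff ℝ M (fun p : E n × E n => a p.1 p.2)
  contDiff_x : ∀ α : Fin n → ℕ, (len α : ℕ∞) ≤ M →
    ∀ ξ, ContDiff ℝ ∞ (fun x => dxi α a x ξ)
  contDiff_xi : ∀ (β : Fin n → ℕ) (x : E n), ContDiff ℝ M (fun ξ => dx β a x ξ)
  continuous_deriv : ∀ α β : Fin n → ℕ, (len α : ℕ∞) ≤ M →
    Continuous (fun p : E n × E n => dxi α (dx β a) p.1 p.2)
  bound : ∀ α β : Fin n → ℕ, (len α : ℕ∞) ≤ M →
    ∃ C : ℝ, ∀ x ξ, ‖dxi α (dx β a) x ξ‖ ≤ C * jap ξ ^ (m - ρ * len α + δ * len β)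

/-- Slowly varying symbols smooth in `x`: `a ∈ S̃^m_{ρ,δ}(ℝⁿ × ℝⁿ; M)`. -/
structure IsSlowlyVaryingSymbol {n : ℕ} (m ρ δ : ℝ) (M : ℕ∞) (a : E n → E n → ℂ) : Prop
    extends IsSmoothSymbol m ρ δ M a where
  decay : ∀ α β : Fin n → ℕ, (len α : ℕ∞) ≤ M → len β ≠ 0 →
    ∃ C : E n → ℝ, BoundedVanishing C ∧
      ∀ x ξ, ‖dxi α (Dx β a) x ξ‖ ≤ C x * jap ξ ^ (m - ρ * len α + δ * len β)

/-- The regularised integrand `χ(εy, εη) e^{-iy·η} F(y, η)` of the oscillatory integral. -/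
def oscIntegrand {n : ℕ} (F : E n → E n → ℂ) (χ : SchwartzMap (E n × E n) ℂ) (ε : ℝ) :
    E n × E n → ℂ :=
  fun p => χ (ε • p) * Complex.exp (-Complex.I * ((inner ℝ p.1 p.2 : ℝ) : ℂ)) * F p.1 p.2

/-- The oscillatory integral `Os-∬ e^{-iy·η} F(y, η) dy đη` exists with value `I`: for every
Schwartz function `χ` with `χ(0, 0) = 1` the regularised integrals (with `đη = (2π)^{-n} dη`)
converge absolutely for `ε > 0` and tend to `I` as `ε → 0`. -/
def HasOscInt {n : ℕ} (F : E n → E n → ℂ) (I : ℂ) : Prop :=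
  ∀ χ : SchwartzMap (E n × E n) ℂ, χ 0 = 1 →
    (∀ ε : ℝ, 0 < ε → Integrable (oscIntegrand F χ ε)) ∧
    Tendsto (fun ε : ℝ => (((2 * Real.pi) ^ n)⁻¹ : ℂ) * ∫ p, oscIntegrand F χ ε p)
      (𝓝[>] 0) (𝓝 I)

open Classical in
/-- The value of the oscillatory integral `Os-∬ e^{-iy·η} F(y, η) dy đη` (zero if it does not
exist). -/
def oscInt {n : ℕ} (F : E n → E n → ℂ) : ℂ :=
  if h : ∃ I, HasOscInt F I then h.choose else 0

/-- The amplitude `(y, η) ↦ a₁(x, ξ + η) a₂(x + y, ξ)` of the composed symbol. -/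
def compAmp {n : ℕ} (a₁ a₂ : E n → E n → ℂ) (x ξ : E n) : E n → E n → ℂ :=
  fun y η => a₁ x (ξ + η) * a₂ (x + y) ξ

/-- The composed symbol `a(x, ξ) = Os-∬ e^{-iy·η} a₁(x, ξ + η) a₂(x + y, ξ) dy đη`. -/
def compSymbol {n : ℕ} (a₁ a₂ : E n → E n → ℂ) : E n → E n → ℂ :=
  fun x ξ => oscInt (compAmp a₁ a₂ x ξ)

/-- `(a₁ ♯_k a₂)(x, ξ) = ∑_{|γ| < k} (1/γ!) ∂_ξ^γ a₁(x, ξ) D_x^γ a₂(x, ξ)`. -/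
def sharp {n : ℕ} (k : ℕ) (a₁ a₂ : E n → E n → ℂ) : E n → E n → ℂ :=
  fun x ξ => ∑ j ∈ Finset.range k, ∑ γ ∈ multiIdx n j,
    (1 / (mfact γ : ℂ)) * dxi γ a₁ x ξ * Dx γ a₂ x ξ

/-- The amplitude `(y, η) ↦ (∂_ξ^γ a₁)(x, ξ + θη) (D_x^γ a₂)(x + y, ξ)`. -/
def remAmp {n : ℕ} (a₁ a₂ : E n → E n → ℂ) (γ : Fin n → ℕ) (θ : ℝ) (x ξ : E n) :
    E n → E n → ℂ :=
  fun y η => dxi γ a₁ x (ξ + θ • η) * Dx γ a₂ (x + y) ξ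

/-- `r_{γ,θ}(x, ξ) = Os-∬ e^{-iy·η} (∂_ξ^γ a₁)(x, ξ + θη) (D_x^γ a₂)(x + y, ξ) dy đη`. -/
def remTerm {n : ℕ} (a₁ a₂ : E n → E n → ℂ) (γ : Fin n → ℕ) (θ : ℝ) : E n → E n → ℂ :=
  fun x ξ => oscInt (remAmp a₁ a₂ γ θ x ξ)

/-- `R_k(x, ξ) = k ∑_{|γ| = k} ∫₀¹ ((1 - θ)^{k-1} / γ!) r_{γ,θ}(x, ξ) dθ`. -/
def remainder {n : ℕ} (k : ℕ) (a₁ a₂ : E n → E n → ℂ) : E n → E n → ℂ :=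
  fun x ξ => (k : ℂ) * ∑ γ ∈ multiIdx n k,
    ∫ θ in (0 : ℝ)..1, (((1 - θ) ^ (k - 1) / (mfact γ : ℝ) : ℝ) : ℂ) * remTerm a₁ a₂ γ θ x ξ

end NonsmoothPDO

end

open NonsmoothPDO

/-! The oscillatory integral is turned into an iterated convergent integral. Integration by parts in
y leaves the regularised integral unchanged when F is replaced by (1 + iη_j)⁻¹(1 + ∂_{y_j})F.
Finitely many such steps beat any polynomial growth in η and cost only y-derivatives, which a₂ has
without limit. The inner η-integral then decays like (1 + |y|)^{-(n+1)} because the amplitude has n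
+ 1 derivatives in η with integrable bounds. This is where n + 1 of the ξ-derivatives of a₁ are
spent (`hasOscInt_bOp`, `bOp_bound`, `tendsto_bOp`).

The symbol estimates come from `osc_estimate`. The substitution (y, η) → (⟨ξ⟩^{-δ}y, ⟨ξ⟩^δη)
preserves y·η and the measure. Afterwards y-derivatives of the second factor cost nothing, and an
η-derivative of the first costs ⟨ξ⟩^δ⟨ξ + θ⟨ξ⟩^δη⟩^{-ρ}, which is polynomially bounded in η by
Peetre's inequality, uniformly in ξ and θ. The value is therefore O(⟨ξ⟩^{m+m'}). Hölder increments
are split between the two factors (`osc_PH`), and decay in x is a splitting of the y-integral into a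
near part and a tail (`osc_PV`).

For the expansion, r_{γ,θ} is studied as a function of θ. Its θ-derivative produces factors η_j,
which integration by parts turns into D_{x_j} on a₂, so that ∂_θ r_{γ,θ} = Σ_j r_{γ+e_j,θ}
(`remTerm_hasDerivAt`). Hence Φ_j = Σ_{|γ|=j} r_{γ,θ}/γ! satisfies Φ_j' = (j+1)Φ_{j+1}, and the
scalar Taylor formula between θ = 0 and θ = 1 is the claim: Φ_0(1) is the composed symbol, and
Fourier inversion evaluates Φ_j(0) as the terms of the expansion (`osc_zero`, `compSymbol_eq`).

Derivatives in x and ξ distribute over the two factors by the product rule (`symD_avgOsc`), so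
classes defined recursively by differentiation (`Sym`) reduce everything to estimates without
derivatives. Translating the given classes into `Sym` needs two further facts: mixed derivatives
commute although only one order of differentiation is given (`MixedReg.comm`), and intermediate
x-derivatives of a₁ have the expected order by Landau-Kolmogorov interpolation
(`IsHolderSymbol.exists_bound`). -/

namespace NonsmoothPDO

/-! ### Coordinatewise partial derivatives and their relation to Fréchet derivatives -/

variable {n : ℕ}

/-- The `i`-th standard basis vector. -/
noncomputable abbrev bv (i : Fin n) : E n := EuclideanSpace.single i (1 : ℝ)

/-- `∂_{x_i}` acting on the first variable. -/
noncomputable def px (i : Fin n) (a : E n → E n → ℂ) : E n → E n → ℂ :=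
  fun x ξ => pd i (fun x' => a x' ξ) x

/-- `∂_{ξ_j}` acting on the second variable. -/
noncomputable def pxi (j : Fin n) (a : E n → E n → ℂ) : E n → E n → ℂ :=
  fun x ξ => pd j (a x) ξ

/-- Existence of the `i`-th partial derivative everywhere. -/
def HasPd (i : Fin n) (f : E n → ℂ) : Prop := ∀ x, LineDifferentiableAt ℝ f x (bv i)

theorem HasPd.has {i : Fin n} {f : E n → ℂ} (h : HasPd i f) (x : E n) :
    HasLineDerivAt ℝ f (pd i f x) x (bv i) := (h x).hasLineDerivAt

theorem HasPd.of_has {i : Fin n} {f f' : E n → ℂ}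
    (h : ∀ x, HasLineDerivAt ℝ f (f' x) x (bv i)) : HasPd i f ∧ pd i f = f' :=
  ⟨fun x => (h x).lineDifferentiableAt, funext fun x => (h x).lineDeriv⟩

theorem _root_.HasLineDerivAt.along {f : E n → ℂ} {f' : ℂ} {x v : E n} {t : ℝ}
    (h : HasLineDerivAt ℝ f f' (x + t • v) v) : HasDerivAt (fun s : ℝ => f (x + s • v)) f' t := by
  have h1 : HasDerivAt (fun s : ℝ => f (x + t • v + s • v)) f' (t - t) := by
    rw [sub_self]; exact h
  have h2 := h1.comp_sub_const t t
  refine h2.congr_of_eventuallyEq (Eventually.of_forall fun s => ?_)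
  simp only
  congr 1
  module

theorem HasPd.hasDerivAt {i : Fin n} {f : E n → ℂ} (h : HasPd i f) (x : E n) (t : ℝ) :
    HasDerivAt (fun s : ℝ => f (x + s • bv i)) (pd i f (x + t • bv i)) t :=
  (h.has _).along

theorem HasPd.add {i : Fin n} {f g : E n → ℂ} (hf : HasPd i f) (hg : HasPd i g) :
    HasPd i (fun x => f x + g x) ∧ pd i (fun x => f x + g x) = fun x => pd i f x + pd i g x :=
  HasPd.of_has fun x => HasDerivAt.add (hf.has x) (hg.has x)

theorem HasPd.sub {i : Fin n} {f g : E n → ℂ} (hf : HasPd i f) (hg : HasPd i g) :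
    HasPd i (fun x => f x - g x) ∧ pd i (fun x => f x - g x) = fun x => pd i f x - pd i g x :=
  HasPd.of_has fun x => HasDerivAt.sub (hf.has x) (hg.has x)

theorem HasPd.mul {i : Fin n} {f g : E n → ℂ} (hf : HasPd i f) (hg : HasPd i g) :
    HasPd i (fun x => f x * g x) ∧
      pd i (fun x => f x * g x) = fun x => pd i f x * g x + f x * pd i g x :=
  HasPd.of_has fun x => by
    have := HasDerivAt.mul (hf.has x) (hg.has x)
    simp only [zero_smul, add_zero] at this
    exact this

theorem HasPd.const_mul {i : Fin n} {f : E n → ℂ} (c : ℂ) (hf : HasPd i f) :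
    HasPd i (fun x => c * f x) ∧ pd i (fun x => c * f x) = fun x => c * pd i f x :=
  HasPd.of_has fun x => HasDerivAt.const_mul c (hf.has x)

theorem HasPd.const (i : Fin n) (c : ℂ) :
    HasPd i (fun _ : E n => c) ∧ pd i (fun _ : E n => c) = fun _ => 0 :=
  HasPd.of_has fun _ => hasDerivAt_const _ c

theorem HasPd.comp_affine {i : Fin n} {f : E n → ℂ} (hf : HasPd i f) (x₀ : E n) (c : ℝ) :
    HasPd i (fun x => f (x₀ + c • x)) ∧
      pd i (fun x => f (x₀ + c • x)) = fun x => (c : ℂ) * pd i f (x₀ + c • x) :=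
  HasPd.of_has fun x => by
    have h1 : HasDerivAt (fun s : ℝ => f (x₀ + c • x + s • bv i)) (pd i f (x₀ + c • x)) (c * 0) := by
      rw [mul_zero]; exact hf.has _
    have h2 := h1.scomp (0 : ℝ) ((hasDerivAt_id (0 : ℝ)).const_mul c)
    have h3 : HasDerivAt (fun s : ℝ => f (x₀ + c • (x + s • bv i)))
        ((c * 1 : ℝ) • pd i f (x₀ + c • x)) 0 := by
      refine h2.congr_of_eventuallyEq (Eventually.of_forall fun s => ?_)
      simp only [Function.comp]
      congr 1
      module
    rw [mul_one] at h3
    exact h3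

theorem HasPd.of_differentiable {f : E n → ℂ} (hf : Differentiable ℝ f) (i : Fin n) :
    HasPd i f := fun x => (hf x).lineDifferentiableAt

theorem pd_eq_fderiv {f : E n → ℂ} (hf : Differentiable ℝ f) (i : Fin n) :
    pd i f = fun x => fderiv ℝ f x (bv i) := funext fun x => (hf x).lineDeriv_eq_fderiv

theorem sum_smul_bv (h : E n) : ∑ i, h i • bv i = h := by
  ext k
  simp [bv, Pi.single_apply]

/-- A function with continuous partial derivatives is Fréchet differentiable. -/
theorem hasFDerivAt_of_continuous_pd {f : E n → ℂ} (hf : ∀ i, HasPd i f)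
    (hc : ∀ i, Continuous (pd i f)) (x : E n) :
    HasFDerivAt f (∑ i, (EuclideanSpace.proj (𝕜 := ℝ) i : E n →L[ℝ] ℝ).smulRight (pd i f x)) x := by
  rw [hasFDerivAt_iff_isLittleO_nhds_zero, Asymptotics.isLittleO_iff]
  intro ε hε
  have hn : (0 : ℝ) < n + 1 := by positivity
  obtain ⟨d, hd, hdx⟩ : ∃ d > 0, ∀ z, ‖z‖ < d → ∀ i, ‖pd i f (x + z) - pd i f x‖ ≤ ε / (n + 1) := by
    have : ∀ i, ∀ᶠ z in 𝓝 (0 : E n), ‖pd i f (x + z) - pd i f x‖ ≤ ε / (n + 1) := by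
      intro i
      have h1 : Tendsto (fun z : E n => ‖pd i f (x + z) - pd i f x‖) (𝓝 0) (𝓝 0) := by
        have := (hc i)
        refine Continuous.tendsto' (by fun_prop) _ _ (by simp)
      exact (h1.eventually (gt_mem_nhds (by positivity))).mono fun z hz => le_of_lt hz
    have h2 := eventually_all.2 this
    obtain ⟨d, hd, h⟩ := Metric.eventually_nhds_iff.1 h2
    exact ⟨d, hd, fun z hz => h (by simpa using hz)⟩
  -- Radius `d / (n + 1)`: a sum of at most `n` coordinate increments plus part of one more has norm
  -- at most `(n + 1) * ‖h‖ < d`.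
  filter_upwards [Metric.ball_mem_nhds (0 : E n) (div_pos hd hn)] with h hh
  have hh : ‖h‖ < d / (n + 1) := by simpa using hh
  have hcoord : ∀ i, |h i| ≤ ‖h‖ := PiLp.norm_apply_le h
  -- The increment is built up one coordinate at a time; each new coordinate costs `ε / (n + 1) *
  -- ‖h‖` by the mean value inequality on a coordinate segment.
  have key : ∀ s : Finset (Fin n),
      ‖f (x + ∑ i ∈ s, h i • bv i) - f x - ∑ i ∈ s, h i • pd i f x‖
        ≤ s.card * (ε / (n + 1) * ‖h‖) := by
    intro s
    induction s using Finset.induction_on with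
    | empty => simp
    | insert j s hj ih =>
      rw [Finset.sum_insert hj, Finset.sum_insert hj, Finset.card_insert_of_notMem hj]
      set w := ∑ i ∈ s, h i • bv i with hw
      have hwn : ∀ t ∈ Set.Icc (0:ℝ) 1, ‖w + (t * h j) • bv j‖ < d := by
        intro t ht
        have h1 : ‖w‖ ≤ s.card * ‖h‖ := by
          refine (norm_sum_le _ _).trans ?_
          rw [← nsmul_eq_mul]
          refine Finset.sum_le_card_nsmul _ _ _ fun i _ => ?_
          rw [norm_smul]; simpa using hcoord i
        have h2 : ‖(t * h j) • bv j‖ ≤ ‖h‖ := by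
          rw [norm_smul, norm_mul]
          simp only [bv, PiLp.norm_single, Real.norm_eq_abs, norm_one, mul_one]
          rw [abs_of_nonneg ht.1]
          nlinarith [hcoord j, ht.2, ht.1, abs_nonneg (h j)]
        have h3 : ((s.card : ℝ) + 1) ≤ n + 1 := by
          have := Finset.card_le_univ s
          simp at this
          exact_mod_cast Nat.succ_le_succ this
        calc ‖w + (t * h j) • bv j‖ ≤ s.card * ‖h‖ + ‖h‖ := (norm_add_le _ _).trans (add_le_add h1 h2)
          _ = (s.card + 1) * ‖h‖ := by ring
          _ ≤ (n + 1) * ‖h‖ := by gcongr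
          _ < d := by rwa [lt_div_iff₀ hn, mul_comm] at hh
      have h4 : ‖(f (x + (w + (1 * h j) • bv j)) - (1 * h j) • pd j f x) -
          (f (x + (w + (0 * h j) • bv j)) - (0 * h j) • pd j f x)‖ ≤ (ε / (n + 1) * |h j|) * (1 - 0) := by
        refine norm_image_sub_le_of_norm_deriv_le_segment'
          (f := fun t : ℝ => f (x + (w + (t * h j) • bv j)) - (t * h j) • pd j f x)
          (f' := fun t => h j • (pd j f (x + (w + (t * h j) • bv j)) - pd j f x))
          (fun t ht => ?_) (fun t ht => ?_) 1 (Set.right_mem_Icc.2 zero_le_one)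
        · have h5 := (hf j).hasDerivAt (x + w) (t * h j)
          have h6 := h5.scomp t ((hasDerivAt_id t).mul_const (h j))
          have h7 : HasDerivAt (fun t : ℝ => f (x + (w + (t * h j) • bv j)))
              (h j • pd j f (x + (w + (t * h j) • bv j))) t := by
            simpa [Function.comp_def, add_assoc] using h6
          have h8 : HasDerivAt (fun t : ℝ => (t * h j) • pd j f x) (h j • pd j f x) t := by
            simpa using ((hasDerivAt_id t).mul_const (h j)).smul_const (pd j f x)
          rw [smul_sub]
          exact (h7.sub h8).hasDerivWithinAt
        · rw [norm_smul, mul_comm]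
          simp only [Real.norm_eq_abs]
          gcongr
          exact hdx _ (hwn t ⟨ht.1, ht.2.le⟩) j
      simp only [one_mul, zero_mul, zero_smul, add_zero, sub_zero, mul_one] at h4
      have h9 : f (x + (h j • bv j + w)) - f x - (h j • pd j f x + ∑ i ∈ s, h i • pd i f x) =
          (f (x + (w + h j • bv j)) - h j • pd j f x - f (x + w)) +
          (f (x + w) - f x - ∑ i ∈ s, h i • pd i f x) := by
        rw [add_comm (h j • bv j) w]; ring
      rw [h9]
      refine (norm_add_le _ _).trans ?_
      push_cast
      have := hcoord j
      have h10 : ε / (n + 1) * |h j| ≤ ε / (n + 1) * ‖h‖ := by gcongr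
      linarith
  have h1 := key Finset.univ
  rw [sum_smul_bv] at h1
  have h2 : (∑ i, (EuclideanSpace.proj (𝕜 := ℝ) i : E n →L[ℝ] ℝ).smulRight (pd i f x)) h
      = ∑ i, h i • pd i f x := by
    simp
  rw [h2]
  refine h1.trans ?_
  simp only [Finset.card_univ, Fintype.card_fin]
  have : (n : ℝ) * (ε / (n + 1) * ‖h‖) = (n / (n + 1)) * (ε * ‖h‖) := by ring
  rw [this]
  have h3 : (n : ℝ) / (n + 1) ≤ 1 := by rw [div_le_one hn]; linarith
  nlinarith [mul_nonneg hε.le (norm_nonneg h)]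

theorem contDiff_succ_of_pd {f : E n → ℂ} {k : ℕ} (hf : ∀ i, HasPd i f)
    (hc : ∀ i, ContDiff ℝ k (pd i f)) : ContDiff ℝ (k + 1) f := by
  have hd := hasFDerivAt_of_continuous_pd hf (fun i => (hc i).continuous)
  rw [contDiff_succ_iff_fderiv]
  refine ⟨fun x => (hd x).differentiableAt, by simp, ?_⟩
  have : fderiv ℝ f = fun x =>
      ∑ i, (EuclideanSpace.proj (𝕜 := ℝ) i : E n →L[ℝ] ℝ).smulRight (pd i f x) :=
    funext fun x => (hd x).fderiv
  rw [this]
  exact ContDiff.sum fun i _ => contDiff_const.smulRight (hc i)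

theorem contDiff_pd {f : E n → ℂ} {k : ℕ} (hf : ContDiff ℝ (k + 1 : ℕ) f) (i : Fin n) :
    ContDiff ℝ k (pd i f) := by
  rw [pd_eq_fderiv (hf.differentiable (by simp))]
  have : ContDiff ℝ k (fderiv ℝ f) := hf.fderiv_right (by simp)
  exact this.clm_apply contDiff_const

theorem pd_comm {f : E n → ℂ} (hf : ContDiff ℝ 2 f) (i j : Fin n) :
    pd i (pd j f) = pd j (pd i f) := by
  have hd : Differentiable ℝ f := hf.differentiable (by simp)
  have hd2 : ContDiff ℝ 1 (fderiv ℝ f) := hf.fderiv_right (by norm_num)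
  have hd3 : Differentiable ℝ (fderiv ℝ f) := hd2.differentiable (by simp)
  have key : ∀ i j, pd i (pd j f) = fun x => fderiv ℝ (fderiv ℝ f) x (bv i) (bv j) := by
    intro i j
    rw [pd_eq_fderiv hd j, pd_eq_fderiv]
    · funext x
      rw [fderiv_clm_apply (hd3 x) (by fun_prop)]
      simp
    · exact hd3.clm_apply (by fun_prop)
  rw [key, key]
  funext x
  exact (hf.contDiffAt.isSymmSndFDerivAt (by simp)) (bv i) (bv j)

end NonsmoothPDO

namespace NonsmoothPDO

variable {n : ℕ}

/-! ### Functions with weighted bounds on iterated partial derivatives -/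

/-- `f` has continuous iterated partial derivatives up to order `A`, those of order `k` being
bounded by `q ^ k * W`. -/
def RegV (q : E n → ℝ) : ℕ → (E n → ℝ) → (E n → ℂ) → Prop
  | 0, W, f => Continuous f ∧ ∀ x, ‖f x‖ ≤ W x
  | A + 1, W, f => (Continuous f ∧ ∀ x, ‖f x‖ ≤ W x) ∧
      ∀ j, HasPd j f ∧ RegV q A (fun x => q x * W x) (pd j f)

namespace RegV

variable {q W V : E n → ℝ} {f g : E n → ℂ} {A : ℕ}

theorem base (h : RegV q A W f) : Continuous f ∧ ∀ x, ‖f x‖ ≤ W x := by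
  cases A with
  | zero => exact h
  | succ A => exact h.1

theorem continuous (h : RegV q A W f) : Continuous f := h.base.1

theorem bound (h : RegV q A W f) (x : E n) : ‖f x‖ ≤ W x := h.base.2 x

theorem nonneg (h : RegV q A W f) (x : E n) : 0 ≤ W x := (norm_nonneg _).trans (h.bound x)

theorem mono {q' : E n → ℝ} (hq : ∀ x, 0 ≤ q x) (hqq : ∀ x, q x ≤ q' x) (h : RegV q A W f)
    (hWV : ∀ x, W x ≤ V x) : RegV q' A V f := by
  induction A generalizing W V f with
  | zero => exact ⟨h.1, fun x => (h.2 x).trans (hWV x)⟩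
  | succ A ih =>
    refine ⟨⟨h.1.1, fun x => (h.1.2 x).trans (hWV x)⟩, fun j => ⟨(h.2 j).1, ih (h.2 j).2 fun x => ?_⟩⟩
    exact mul_le_mul (hqq x) (hWV x) (h.nonneg x) ((hq x).trans (hqq x))

theorem mono_weight (hq : ∀ x, 0 ≤ q x) (h : RegV q A W f)
    (hWV : ∀ x, W x ≤ V x) : RegV q A V f := h.mono hq (fun _ => le_rfl) hWV

theorem pred (h : RegV q (A + 1) W f) : RegV q A W f := by
  induction A generalizing W f with
  | zero => exact h.1
  | succ A ih => exact ⟨h.1, fun j => ⟨(h.2 j).1, ih (h.2 j).2⟩⟩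

theorem of_le {B : ℕ} (h : RegV q A W f) (hB : B ≤ A) : RegV q B W f := by
  induction hB with
  | refl => exact h
  | step _ ih => exact ih h.pred

theorem add (h : RegV q A W f) (h' : RegV q A V g) :
    RegV q A (fun x => W x + V x) (fun x => f x + g x) := by
  induction A generalizing W V f g with
  | zero => exact ⟨h.1.add h'.1, fun x => (norm_add_le _ _).trans (add_le_add (h.2 x) (h'.2 x))⟩
  | succ A ih =>
    refine ⟨⟨h.1.1.add h'.1.1, fun x => (norm_add_le _ _).trans (add_le_add (h.1.2 x) (h'.1.2 x))⟩,
      fun j => ?_⟩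
    have h1 := (h.2 j).1.add (h'.2 j).1
    refine ⟨h1.1, ?_⟩
    rw [h1.2]
    simpa only [mul_add] using ih (h.2 j).2 (h'.2 j).2

/-- Every derivative splits a product into two products of the same shape, so the constant doubles
with each order. -/
theorem mul (hq : ∀ x, 0 ≤ q x) (h : RegV q A W f) (h' : RegV q A V g) :
    RegV q A (fun x => 2 ^ A * (W x * V x)) (fun x => f x * g x) := by
  have hb : ∀ x, ‖f x * g x‖ ≤ W x * V x := fun x => by
    rw [norm_mul]
    exact mul_le_mul (h.bound x) (h'.bound x) (norm_nonneg _) (h.nonneg x)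
  induction A generalizing W V f g with
  | zero => exact ⟨h.1.mul h'.1, fun x => by simpa using hb x⟩
  | succ A ih =>
    refine ⟨⟨h.1.1.mul h'.1.1, fun x => (hb x).trans ?_⟩, fun j => ?_⟩
    · exact le_mul_of_one_le_left (mul_nonneg (h.nonneg x) (h'.nonneg x)) (one_le_pow₀ (by norm_num))
    have h1 := (h.2 j).1.mul (h'.2 j).1
    refine ⟨h1.1, ?_⟩
    rw [h1.2]
    have e1 := ih (h.2 j).2 h'.pred fun x => by
      rw [norm_mul]
      exact mul_le_mul ((h.2 j).2.bound x) (h'.bound x) (norm_nonneg _) ((h.2 j).2.nonneg x)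
    have e2 := ih h.pred (h'.2 j).2 fun x => by
      rw [norm_mul]
      exact mul_le_mul (h.bound x) ((h'.2 j).2.bound x) (norm_nonneg _) (h.nonneg x)
    refine (e1.add e2).mono_weight hq fun x => le_of_eq ?_
    ring

theorem const (hq : ∀ x, 0 ≤ q x) (c : ℂ) (A : ℕ) : RegV q A (fun _ => ‖c‖) (fun _ => c) := by
  induction A generalizing c with
  | zero => exact ⟨continuous_const, fun _ => le_rfl⟩
  | succ A ih =>
    refine ⟨⟨continuous_const, fun _ => le_rfl⟩, fun j => ⟨(HasPd.const j c).1, ?_⟩⟩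
    rw [(HasPd.const j c).2]
    exact (ih 0).mono_weight hq fun x => by simpa using mul_nonneg (hq x) (norm_nonneg c)

theorem const_mul (h : RegV q A W f) (c : ℂ) :
    RegV q A (fun x => ‖c‖ * W x) (fun x => c * f x) := by
  have hb : Continuous (fun x => c * f x) ∧ ∀ x, ‖c * f x‖ ≤ ‖c‖ * W x :=
    ⟨continuous_const.mul h.continuous, fun x => by
      rw [norm_mul]; exact mul_le_mul_of_nonneg_left (h.bound x) (norm_nonneg c)⟩
  induction A generalizing W f with
  | zero => exact hb
  | succ A ih =>
    refine ⟨hb, fun j => ?_⟩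
    have h1 := (h.2 j).1.const_mul c
    refine ⟨h1.1, ?_⟩
    rw [h1.2]
    have := ih (h.2 j).2 ⟨continuous_const.mul (h.2 j).2.continuous, fun x => by
      rw [norm_mul]; exact mul_le_mul_of_nonneg_left ((h.2 j).2.bound x) (norm_nonneg c)⟩
    convert this using 2
    ring

/-- A derivative brings out the factor `c`, so the cost per derivative becomes `|c| * q` at the
image point. The dilations by powers of ⟨ξ⟩ rest on this. -/
theorem comp_affine {q' : E n → ℝ} (x₀ : E n) (c : ℝ) (h : RegV q A W f)
    (hq : ∀ x, 0 ≤ q x) (hc : ∀ x, |c| * q (x₀ + c • x) ≤ q' x)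
    (hV : ∀ x, W (x₀ + c • x) ≤ V x) : RegV q' A V (fun x => f (x₀ + c • x)) := by
  have hb : ∀ {W : E n → ℝ} {f : E n → ℂ} {V : E n → ℝ}, (∀ x, W (x₀ + c • x) ≤ V x) →
      (Continuous f ∧ ∀ x, ‖f x‖ ≤ W x) →
      Continuous (fun x => f (x₀ + c • x)) ∧ ∀ x, ‖f (x₀ + c • x)‖ ≤ V x :=
    fun hV h => ⟨h.1.comp (by fun_prop), fun x => (h.2 _).trans (hV x)⟩
  have hq' : ∀ x, 0 ≤ q' x := fun x => (mul_nonneg (abs_nonneg c) (hq _)).trans (hc x)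
  induction A generalizing W V f with
  | zero => exact hb hV h
  | succ A ih =>
    refine ⟨hb hV h.1, fun j => ?_⟩
    have h1 := (h.2 j).1.comp_affine x₀ c
    refine ⟨h1.1, ?_⟩
    rw [h1.2]
    refine ((ih (h.2 j).2 (V := fun x => q (x₀ + c • x) * W (x₀ + c • x))
      fun x => le_rfl).const_mul (c : ℂ)).mono_weight hq' fun x => ?_
    rw [Complex.norm_real, Real.norm_eq_abs, ← mul_assoc]
    exact mul_le_mul (hc x) (hV x) (h.nonneg _) (hq' x)

end RegV

/-! ### Amplitudes -/

/-- `F` is jointly continuous, it has iterated partial derivatives of order `≤ B` in the first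
variable, and each of those is regular of order `A` in the second variable, with all derivatives
bounded by `W`. -/
def Amp (A : ℕ) : ℕ → (E n → E n → ℝ) → (E n → E n → ℂ) → Prop
  | 0, W, F => Continuous (Function.uncurry F) ∧ ∀ y, RegV (fun _ => 1) A (W y) (F y)
  | B + 1, W, F => (Continuous (Function.uncurry F) ∧ ∀ y, RegV (fun _ => 1) A (W y) (F y)) ∧
      ∀ i, (∀ η, HasPd i (fun y => F y η)) ∧ Amp A B W (px i F)

namespace Amp

variable {W V : E n → E n → ℝ} {F G : E n → E n → ℂ} {A B : ℕ}

theorem base (h : Amp A B W F) :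
    Continuous (Function.uncurry F) ∧ ∀ y, RegV (fun _ => 1) A (W y) (F y) := by
  cases B with
  | zero => exact h
  | succ B => exact h.1

theorem continuous (h : Amp A B W F) : Continuous (Function.uncurry F) := h.base.1

theorem bound (h : Amp A B W F) (y η : E n) : ‖F y η‖ ≤ W y η := (h.base.2 y).bound η

theorem nonneg (h : Amp A B W F) (y η : E n) : 0 ≤ W y η := (norm_nonneg _).trans (h.bound y η)

theorem mono (h : Amp A B W F) (hWV : ∀ y η, W y η ≤ V y η) : Amp A B V F := by
  have hb : ∀ {F : E n → E n → ℂ}, (Continuous (Function.uncurry F) ∧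
      ∀ y, RegV (fun _ => 1) A (W y) (F y)) → (Continuous (Function.uncurry F) ∧
      ∀ y, RegV (fun _ => 1) A (V y) (F y)) :=
    fun h => ⟨h.1, fun y => (h.2 y).mono_weight (fun _ => zero_le_one) (hWV y)⟩
  induction B generalizing F with
  | zero => exact hb h
  | succ B ih => exact ⟨hb h.1, fun i => ⟨(h.2 i).1, ih (h.2 i).2⟩⟩

theorem pred (h : Amp A (B + 1) W F) : Amp A B W F := by
  induction B generalizing F with
  | zero => exact h.1
  | succ B ih => exact ⟨h.1, fun i => ⟨(h.2 i).1, ih (h.2 i).2⟩⟩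

theorem of_le {B' : ℕ} (h : Amp A B W F) (hB : B' ≤ B) : Amp A B' W F := by
  induction hB with
  | refl => exact h
  | step _ ih => exact ih h.pred

theorem of_le_left {A' : ℕ} (h : Amp A B W F) (hA : A' ≤ A) : Amp A' B W F := by
  induction B generalizing F with
  | zero => exact ⟨h.1, fun y => (h.2 y).of_le hA⟩
  | succ B ih =>
    exact ⟨⟨h.1.1, fun y => (h.1.2 y).of_le hA⟩, fun i => ⟨(h.2 i).1, ih (h.2 i).2⟩⟩

theorem px_add {i : Fin n} (hF : ∀ η, HasPd i (fun y => F y η)) (hG : ∀ η, HasPd i (fun y => G y η)) :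
    px i (fun y η => F y η + G y η) = fun y η => px i F y η + px i G y η := by
  funext y η
  exact congrFun ((hF η).add (hG η)).2 y

theorem px_mul {i : Fin n} (hF : ∀ η, HasPd i (fun y => F y η)) (hG : ∀ η, HasPd i (fun y => G y η)) :
    px i (fun y η => F y η * G y η) = fun y η => px i F y η * G y η + F y η * px i G y η := by
  funext y η
  exact congrFun ((hF η).mul (hG η)).2 y

theorem add (h : Amp A B W F) (h' : Amp A B V G) :
    Amp A B (fun y η => W y η + V y η) (fun y η => F y η + G y η) := by
  have hb : ∀ {F G : E n → E n → ℂ}, Amp A 0 W F → Amp A 0 V G →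
      Amp A 0 (fun y η => W y η + V y η) (fun y η => F y η + G y η) :=
    fun h h' => ⟨h.1.add h'.1, fun y => (h.2 y).add (h'.2 y)⟩
  induction B generalizing F G with
  | zero => exact hb h h'
  | succ B ih =>
    refine ⟨hb h.1 h'.1, fun i => ⟨fun η => (((h.2 i).1 η).add ((h'.2 i).1 η)).1, ?_⟩⟩
    rw [px_add (h.2 i).1 (h'.2 i).1]
    exact ih (h.2 i).2 (h'.2 i).2

theorem mul (h : Amp A B W F) (h' : Amp A B V G) :
    Amp A B (fun y η => 2 ^ (A + B) * (W y η * V y η)) (fun y η => F y η * G y η) := by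
  have hb : ∀ {F G : E n → E n → ℂ}, Amp A 0 W F → Amp A 0 V G →
      Amp A 0 (fun y η => 2 ^ A * (W y η * V y η)) (fun y η => F y η * G y η) :=
    fun h h' => ⟨h.1.mul h'.1, fun y => (h.2 y).mul (fun _ => zero_le_one) (h'.2 y)⟩
  induction B generalizing F G with
  | zero => exact hb h h'
  | succ B ih =>
    refine ⟨(hb h.1 h'.1).mono fun y η => ?_, fun i =>
      ⟨fun η => (((h.2 i).1 η).mul ((h'.2 i).1 η)).1, ?_⟩⟩
    · refine mul_le_mul_of_nonneg_right ?_ (mul_nonneg (h.nonneg y η) (h'.nonneg y η))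
      exact pow_le_pow_right₀ (by norm_num) (by omega)
    rw [px_mul (h.2 i).1 (h'.2 i).1]
    refine ((ih (h.2 i).2 h'.pred).add (ih h.pred (h'.2 i).2)).mono fun y η => le_of_eq ?_
    ring

theorem const_mul (h : Amp A B W F) (c : ℂ) :
    Amp A B (fun y η => ‖c‖ * W y η) (fun y η => c * F y η) := by
  have hb : ∀ {F : E n → E n → ℂ}, Amp A 0 W F →
      Amp A 0 (fun y η => ‖c‖ * W y η) (fun y η => c * F y η) :=
    fun h => ⟨continuous_const.mul h.1, fun y => (h.2 y).const_mul c⟩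
  induction B generalizing F with
  | zero => exact hb h
  | succ B ih =>
    refine ⟨hb h.1, fun i => ⟨fun η => (((h.2 i).1 η).const_mul c).1, ?_⟩⟩
    have : px i (fun y η => c * F y η) = fun y η => c * px i F y η := by
      funext y η
      exact congrFun (((h.2 i).1 η).const_mul c).2 y
    rw [this]
    exact ih (h.2 i).2

theorem of_eta {w : E n → ℝ} {f : E n → ℂ} (h : RegV (fun _ => 1) A w f) (B : ℕ) :
    Amp A B (fun _ η => w η) (fun _ η => f η) := by
  have hb : ∀ {f : E n → ℂ}, RegV (fun _ => 1) A w f →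
    Amp A 0 (fun _ η => w η) (fun _ η => f η) := fun h => ⟨h.continuous.comp continuous_snd,
      fun _ => h⟩
  induction B generalizing f with
  | zero => exact hb h
  | succ B ih =>
    refine ⟨hb h, fun i => ⟨fun η => (HasPd.const i (f η)).1, ?_⟩⟩
    have : px i (fun _ η => f η) = fun (_ η : E n) => (0 : ℂ) := by
      funext y η
      exact congrFun (HasPd.const i (f η)).2 y
    rw [this]
    refine ih (f := fun _ => 0) ((RegV.const (fun _ => zero_le_one) 0 A).mono_weight
      (fun _ => zero_le_one) fun x => ?_)
    simpa using h.nonneg x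

theorem of_y {w : E n → ℝ} {f : E n → ℂ} (h : RegV (fun _ => 1) B w f) (A : ℕ) :
    Amp A B (fun y _ => w y) (fun y _ => f y) := by
  have hb : ∀ {f : E n → ℂ}, RegV (fun _ => 1) 0 w f →
      Amp A 0 (fun y _ => w y) (fun y _ => f y) := fun {f} h =>
    ⟨h.continuous.comp continuous_fst, fun y =>
      (RegV.const (fun _ => zero_le_one) (f y) A).mono_weight (fun _ => zero_le_one)
        fun _ => h.bound y⟩
  induction B generalizing f with
  | zero => exact hb h
  | succ B ih =>
    refine ⟨hb h.1, fun i => ⟨fun _ => (h.2 i).1, ih ?_⟩⟩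
    simpa using (h.2 i).2

end Amp

/-- Pointwise convergence of all partial derivatives of order `≤ B` in the first variable. -/
def Conv {ι : Type*} (l : Filter ι) : ℕ → (ι → E n → E n → ℂ) → (E n → E n → ℂ) → Prop
  | 0, Ft, F => ∀ y η, Tendsto (fun t => Ft t y η) l (𝓝 (F y η))
  | B + 1, Ft, F => (∀ y η, Tendsto (fun t => Ft t y η) l (𝓝 (F y η))) ∧
      ∀ i, Conv l B (fun t => px i (Ft t)) (px i F)

namespace Conv

variable {ι : Type*} {l : Filter ι} {Ft Gt : ι → E n → E n → ℂ} {F G : E n → E n → ℂ} {A B : ℕ}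
  {W V : ι → E n → E n → ℝ} {W₀ V₀ : E n → E n → ℝ}

theorem pred (h : Conv l (B + 1) Ft F) : Conv l B Ft F := by
  induction B generalizing Ft F with
  | zero => exact h.1
  | succ B ih => exact ⟨h.1, fun i => ih (h.2 i)⟩

theorem congr' (h : Conv l B Ft F) (he : Ft =ᶠ[l] Gt) : Conv l B Gt F := by
  have hb : ∀ {Ft Gt : ι → E n → E n → ℂ} {F : E n → E n → ℂ}, Conv l 0 Ft F → Ft =ᶠ[l] Gt →
      Conv l 0 Gt F := fun h he y η =>
    (h y η).congr' (he.mono fun t ht => by rw [ht])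
  induction B generalizing Ft Gt F with
  | zero => exact hb h he
  | succ B ih => exact ⟨hb h.1 he, fun i => ih (h.2 i) (he.mono fun t ht => congrArg (px i) ht)⟩

theorem const (F : E n → E n → ℂ) (B : ℕ) : Conv l B (fun _ => F) F := by
  induction B generalizing F with
  | zero => exact fun _ _ => tendsto_const_nhds
  | succ B ih => exact ⟨fun _ _ => tendsto_const_nhds, fun i => ih _⟩

theorem add (h : Conv l B Ft F) (h' : Conv l B Gt G) (hFt : ∀ t, Amp A B (W t) (Ft t))
    (hGt : ∀ t, Amp A B (V t) (Gt t)) (hF : Amp A B W₀ F) (hG : Amp A B V₀ G) :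
    Conv l B (fun t y η => Ft t y η + Gt t y η) (fun y η => F y η + G y η) := by
  induction B generalizing Ft Gt F G with
  | zero => exact fun y η => (h y η).add (h' y η)
  | succ B ih =>
    refine ⟨fun y η => (h.1 y η).add (h'.1 y η), fun i => ?_⟩
    rw [Amp.px_add (hF.2 i).1 (hG.2 i).1]
    have : (fun t => px i (fun y η => Ft t y η + Gt t y η)) =
        fun t y η => px i (Ft t) y η + px i (Gt t) y η :=
      funext fun t => Amp.px_add ((hFt t).2 i).1 ((hGt t).2 i).1
    rw [this]
    exact ih (h.2 i) (h'.2 i) (fun t => ((hFt t).2 i).2) (fun t => ((hGt t).2 i).2)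
      (hF.2 i).2 (hG.2 i).2

theorem mul (h : Conv l B Ft F) (h' : Conv l B Gt G) (hFt : ∀ t, Amp A B (W t) (Ft t))
    (hGt : ∀ t, Amp A B (V t) (Gt t)) (hF : Amp A B W₀ F) (hG : Amp A B V₀ G) :
    Conv l B (fun t y η => Ft t y η * Gt t y η) (fun y η => F y η * G y η) := by
  induction B generalizing Ft Gt F G W V W₀ V₀ with
  | zero => exact fun y η => (h y η).mul (h' y η)
  | succ B ih =>
    refine ⟨fun y η => (h.1 y η).mul (h'.1 y η), fun i => ?_⟩
    rw [Amp.px_mul (hF.2 i).1 (hG.2 i).1]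
    have : (fun t => px i (fun y η => Ft t y η * Gt t y η)) =
        fun t y η => px i (Ft t) y η * Gt t y η + Ft t y η * px i (Gt t) y η :=
      funext fun t => Amp.px_mul ((hFt t).2 i).1 ((hGt t).2 i).1
    rw [this]
    exact (ih (h.2 i) h'.pred (fun t => ((hFt t).2 i).2) (fun t => (hGt t).pred)
      (hF.2 i).2 hG.pred).add (ih h.pred (h'.2 i) (fun t => (hFt t).pred)
      (fun t => ((hGt t).2 i).2) hF.pred (hG.2 i).2)
      (fun t => ((hFt t).2 i).2.mul (hGt t).pred) (fun t => (hFt t).pred.mul ((hGt t).2 i).2)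
      ((hF.2 i).2.mul hG.pred) (hF.pred.mul (hG.2 i).2)

end Conv

end NonsmoothPDO

namespace NonsmoothPDO

variable {n : ℕ}

/-! ### The regularising operators `(1 + iη_j)⁻¹ (1 + ∂_{y_j})` -/

noncomputable def qj (j : Fin n) (η : E n) : ℂ := (1 + Complex.I * (η j : ℂ))⁻¹

theorem one_add_I_mul_ne (j : Fin n) (η : E n) : 1 + Complex.I * (η j : ℂ) ≠ 0 := by
  intro h
  have := congrArg Complex.re h
  simp at this

theorem normSq_one_add_I_mul (t : ℝ) : ‖1 + Complex.I * (t : ℂ)‖ ^ 2 = 1 + t ^ 2 := by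
  rw [← Complex.normSq_eq_norm_sq, Complex.normSq_apply]
  simp
  ring

theorem norm_qj_le_one (j : Fin n) (η : E n) : ‖qj j η‖ ≤ 1 := by
  rw [qj, norm_inv]
  refine inv_le_one_of_one_le₀ ?_
  have := normSq_one_add_I_mul (η j)
  nlinarith [norm_nonneg (1 + Complex.I * (η j : ℂ)), sq_nonneg (η j)]

theorem continuous_qj (j : Fin n) : Continuous (qj (n := n) j) :=
  Continuous.inv₀ (by fun_prop) (one_add_I_mul_ne j)

theorem hasPd_qj (i j : Fin n) : HasPd i (qj (n := n) j) ∧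
    pd i (qj (n := n) j) = fun η => (if i = j then -Complex.I else 0) * (qj j η * qj j η) :=
  HasPd.of_has fun η => by
    have hc : HasDerivAt (fun t : ℝ => ((η + t • bv i) j : ℂ)) (if i = j then 1 else 0) 0 := by
      have h1 : (fun t : ℝ => ((η + t • bv i) j : ℂ)) =
          fun t : ℝ => (η j : ℂ) + (t : ℂ) * (if i = j then 1 else 0) := by
        funext t
        by_cases hij : i = j
        · subst hij; simp [bv]
        · simp [bv, hij, Ne.symm hij]
      rw [h1]
      simpa using! ((Complex.ofRealCLM.hasDerivAt (x := (0:ℝ))).mul_const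
        (if i = j then (1:ℂ) else 0)).const_add (η j : ℂ)
    have h2 := (hc.const_mul Complex.I).const_add (1 : ℂ)
    have h3 := h2.inv (by simpa using one_add_I_mul_ne j η)
    refine HasDerivAt.congr_deriv h3 ?_
    simp only [zero_smul, add_zero, qj]
    split_ifs
    · field_simp
    · simp

/-- Since ∂_j q_j = -i q_j² and |q_j| ≤ 1, all derivatives of q_j are again dominated by |q_j|:
differentiating in η never loses the decay that was gained. -/
theorem regV_qj (A : ℕ) : ∃ C : ℝ, 0 ≤ C ∧ ∀ j : Fin n,
    RegV (fun _ => 1) A (fun η => C * ‖qj j η‖) (qj j) := by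
  induction A with
  | zero => exact ⟨1, zero_le_one, fun j => ⟨continuous_qj j, fun η => by simp⟩⟩
  | succ A ih =>
    obtain ⟨C, hC, h⟩ := ih
    refine ⟨1 + 2 ^ A * (C * C), by positivity, fun j => ⟨⟨continuous_qj j, fun η => ?_⟩,
      fun i => ⟨(hasPd_qj i j).1, ?_⟩⟩⟩
    · exact le_mul_of_one_le_left (norm_nonneg _) (by have : 0 ≤ 2 ^ A * (C * C) := by positivity
                                                      linarith)
    rw [(hasPd_qj i j).2]
    refine (((h j).mul (fun _ => zero_le_one) (h j)).const_mul _).mono_weight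
      (fun _ => zero_le_one) fun η => ?_
    have h1 : ‖(if i = j then -Complex.I else 0)‖ ≤ 1 := by split_ifs <;> simp
    have h2 := norm_qj_le_one j η
    have h3 := norm_nonneg (qj j η)
    calc _ ≤ 1 * (2 ^ A * (C * ‖qj j η‖ * (C * ‖qj j η‖))) := by gcongr
      _ = 2 ^ A * (C * C) * (‖qj j η‖ * ‖qj j η‖) := by ring
      _ ≤ 2 ^ A * (C * C) * (‖qj j η‖ * 1) := by gcongr
      _ ≤ 1 * ((1 + 2 ^ A * (C * C)) * ‖qj j η‖) := by nlinarith

/-- `(1 + iη_j)⁻¹ (1 + ∂_{y_j}) F`. -/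
noncomputable def Top (j : Fin n) (F : E n → E n → ℂ) : E n → E n → ℂ :=
  fun y η => qj j η * (F y η + px j F y η)

/-- The composition of the operators `Top j`, `j ∈ l`. -/
noncomputable def Tl (l : List (Fin n)) (F : E n → E n → ℂ) : E n → E n → ℂ :=
  l.foldl (fun G j => Top j G) F

noncomputable def Dl (l : List (Fin n)) (η : E n) : ℝ := (l.map fun j => ‖qj j η‖).prod

@[simp] theorem Tl_nil (F : E n → E n → ℂ) : Tl [] F = F := rfl

@[simp] theorem Tl_cons (j : Fin n) (l : List (Fin n)) (F : E n → E n → ℂ) :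
    Tl (j :: l) F = Tl l (Top j F) := rfl

@[simp] theorem Dl_cons (j : Fin n) (l : List (Fin n)) (η : E n) :
    Dl (j :: l) η = ‖qj j η‖ * Dl l η := by simp [Dl]

theorem Dl_append (l l' : List (Fin n)) (η : E n) : Dl (l ++ l') η = Dl l η * Dl l' η := by
  simp [Dl]

theorem Dl_nonneg (l : List (Fin n)) (η : E n) : 0 ≤ Dl l η := by
  induction l with
  | nil => simp [Dl]
  | cons j l ih => rw [Dl_cons]; positivity

/-- One y-derivative is spent and a factor |q_j| is gained; the regularity in η is untouched. -/
theorem Amp.top (A B : ℕ) : ∃ C : ℝ, 0 ≤ C ∧ ∀ (j : Fin n) (W : E n → E n → ℝ)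
    (F : E n → E n → ℂ), Amp A (B + 1) W F →
      Amp A B (fun y η => C * (W y η * ‖qj j η‖)) (Top j F) := by
  obtain ⟨C, hC, h⟩ := regV_qj (n := n) A
  refine ⟨2 ^ (A + B) * C * 2, by positivity, fun j W F hF => ?_⟩
  refine ((Amp.of_eta (h j) B).mul (hF.pred.add (hF.2 j).2)).mono fun y η => le_of_eq ?_
  ring

theorem Amp.tl (A B : ℕ) (l : List (Fin n)) : ∃ C : ℝ, 0 ≤ C ∧ ∀ (W : E n → E n → ℝ)
    (F : E n → E n → ℂ), Amp A (l.length + B) W F →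
      Amp A B (fun y η => C * (W y η * Dl l η)) (Tl l F) := by
  induction l with
  | nil => exact ⟨1, zero_le_one, fun W F hF => by simpa [Dl] using hF⟩
  | cons j l ih =>
    obtain ⟨C, hC, h⟩ := ih
    obtain ⟨C', hC', h'⟩ := Amp.top (n := n) A (l.length + B)
    refine ⟨C * C', by positivity, fun W F hF => ?_⟩
    rw [List.length_cons, add_right_comm] at hF
    refine (h _ _ (h' j W F hF)).mono fun y η => le_of_eq ?_
    rw [Dl_cons]; ring

theorem Conv.top {ι : Type*} {f : Filter ι} {Ft : ι → E n → E n → ℂ} {F : E n → E n → ℂ} {B : ℕ}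
    {W : ι → E n → E n → ℝ} {W₀ : E n → E n → ℝ} (j : Fin n) (h : Conv f (B + 1) Ft F)
    (hFt : ∀ t, Amp 0 (B + 1) (W t) (Ft t)) (hF : Amp 0 (B + 1) W₀ F) :
    Conv f B (fun t => Top j (Ft t)) (Top j F) := by
  obtain ⟨C, hC, hq⟩ := regV_qj (n := n) 0
  exact (Conv.const _ B).mul (h.pred.add (h.2 j) (fun t => (hFt t).pred) (fun t => ((hFt t).2 j).2)
    hF.pred (hF.2 j).2) (fun _ => Amp.of_eta (hq j) B)
    (fun t => (hFt t).pred.add ((hFt t).2 j).2) (Amp.of_eta (hq j) B) (hF.pred.add (hF.2 j).2)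

theorem Conv.tl {ι : Type*} {f : Filter ι} {Ft : ι → E n → E n → ℂ} {F : E n → E n → ℂ}
    {W : ι → E n → E n → ℝ} {W₀ : E n → E n → ℝ} (l : List (Fin n)) (h : Conv f l.length Ft F)
    (hFt : ∀ t, Amp 0 l.length (W t) (Ft t)) (hF : Amp 0 l.length W₀ F) (y η : E n) :
    Tendsto (fun t => Tl l (Ft t) y η) f (𝓝 (Tl l F y η)) := by
  induction l generalizing Ft F W W₀ with
  | nil => exact h y η
  | cons j l ih =>
    obtain ⟨C, hC, hT⟩ := Amp.top (n := n) 0 l.length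
    exact ih (h.top j hFt hF) (fun t => hT j _ _ (hFt t)) (hT j _ _ hF)

/-! ### Oscillatory kernels -/

noncomputable def ek (y η : E n) : ℂ := Complex.exp (-Complex.I * ((inner ℝ y η : ℝ) : ℂ))

theorem norm_ek (y η : E n) : ‖ek y η‖ = 1 := by
  rw [ek, ← Complex.norm_exp_ofReal_mul_I (-(inner ℝ y η))]
  congr 2
  push_cast; ring

theorem continuous_ek : Continuous (Function.uncurry (ek (n := n))) := by
  unfold ek Function.uncurry
  fun_prop

theorem ek_comm (y η : E n) : ek y η = ek η y := by rw [ek, ek, real_inner_comm]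

theorem hasPd_ek (y : E n) (j : Fin n) (η : E n) :
    HasLineDerivAt ℝ (ek y) (-Complex.I * (y j : ℂ) * ek y η) η (bv j) := by
  have h1 : (fun t : ℝ => -Complex.I * ((inner ℝ y (η + t • bv j) : ℝ) : ℂ)) =
      fun t : ℝ => -Complex.I * ((inner ℝ y η : ℝ) : ℂ) + (t : ℂ) * (-Complex.I * (y j : ℂ)) := by
    funext t
    rw [inner_add_right, inner_smul_right]
    simp [bv, EuclideanSpace.inner_single_right]
    ring
  have h2 : HasDerivAt (fun t : ℝ => -Complex.I * ((inner ℝ y (η + t • bv j) : ℝ) : ℂ))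
      (-Complex.I * (y j : ℂ)) 0 := by
    rw [h1]
    simpa using! ((Complex.ofRealCLM.hasDerivAt (x := (0:ℝ))).mul_const
      (-Complex.I * (y j : ℂ))).const_add (-Complex.I * ((inner ℝ y η : ℝ) : ℂ))
  have h3 := h2.cexp
  refine HasDerivAt.congr_deriv h3 ?_
  simp only [zero_smul, add_zero, ek]
  ring

theorem integrable_ek_mul {G : E n → ℂ} (hG : Integrable G) (y : E n) :
    Integrable (fun η => ek y η * G η) := by
  refine hG.bdd_mul (c := 1) ?_ (Eventually.of_forall fun η => (norm_ek y η).le)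
  exact (continuous_ek.comp (by fun_prop : Continuous fun η : E n => (y, η))).aestronglyMeasurable

theorem integral_ek_mul_pd {G : E n → ℂ} {j : Fin n} (hG : HasPd j G) (hi : Integrable G)
    (hi' : Integrable (pd j G)) (y : E n) :
    ∫ η, ek y η * pd j G η = Complex.I * y j * ∫ η, ek y η * G η := by
  have h := integral_bilinear_hasLineDerivAt_right_eq_neg_left_of_integrable (μ := volume)
    (f := ek y) (f' := fun η => -Complex.I * (y j : ℂ) * ek y η) (g := G) (g' := pd j G)
    (v := bv j) (B := ContinuousLinearMap.mul ℝ ℂ)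
    (by simpa [mul_assoc] using ((integrable_ek_mul hi y).const_mul (Complex.I * (y j : ℂ))).neg)
    (integrable_ek_mul hi' y) (integrable_ek_mul hi y)
    (fun η _ => hasPd_ek y j η) (fun η _ => hG.has η)
  simp only [ContinuousLinearMap.mul_apply'] at h
  rw [h, ← integral_neg, ← integral_const_mul]
  congr 1
  funext η
  ring

theorem integrable_of_bound {f : E n → ℂ} {W : E n → ℝ} (hf : Continuous f) (hW : Integrable W)
    (h : ∀ x, ‖f x‖ ≤ W x) : Integrable f :=
  hW.mono' hf.aestronglyMeasurable (Eventually.of_forall h)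

/-- Each factor y_j is traded for an η-derivative of `G` by parts. Powers of `1 + ∑ |y_j|`, rather
than of 1 + |y|², make `A` derivatives yield exactly `A` powers for odd `A` as well. -/
theorem RegV.decay {A : ℕ} {W : E n → ℝ} {G : E n → ℂ} (h : RegV (fun _ => 1) A W G)
    (hW : Integrable W) (y : E n) :
    (1 + ∑ j, |y j|) ^ A * ‖∫ η, ek y η * G η‖ ≤ (n + 1) ^ A * ∫ η, W η := by
  have hb : ∀ {G : E n → ℂ}, (∀ x, ‖G x‖ ≤ W x) → ‖∫ η, ek y η * G η‖ ≤ ∫ η, W η := fun hG =>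
    norm_integral_le_of_norm_le hW (Eventually.of_forall fun η => by
      rw [norm_mul, norm_ek, one_mul]; exact hG η)
  induction A generalizing G with
  | zero => simpa using hb h.bound
  | succ A ih =>
    have h0 := ih h.pred
    have h1 : ∀ j, (1 + ∑ j, |y j|) ^ A * (|y j| * ‖∫ η, ek y η * G η‖) ≤ (n + 1) ^ A * ∫ η, W η := by
      intro j
      have h2 : RegV (fun _ => 1) A W (pd j G) := by simpa using (h.2 j).2
      have h3 := ih h2
      rw [integral_ek_mul_pd (h.2 j).1 (integrable_of_bound h.continuous hW h.bound)
        (integrable_of_bound h2.continuous hW h2.bound)] at h3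
      simpa using h3
    calc (1 + ∑ j, |y j|) ^ (A + 1) * ‖∫ η, ek y η * G η‖
        = (1 + ∑ j, |y j|) ^ A * ‖∫ η, ek y η * G η‖
          + ∑ j, (1 + ∑ j, |y j|) ^ A * (|y j| * ‖∫ η, ek y η * G η‖) := by
          rw [← Finset.mul_sum, ← Finset.sum_mul]; ring
      _ ≤ (n + 1) ^ A * (∫ η, W η) + ∑ j : Fin n, (n + 1) ^ A * ∫ η, W η :=
          add_le_add h0 (Finset.sum_le_sum fun j _ => h1 j)
      _ = _ := by simp; ring

theorem norm_le_sum_abs (y : E n) : ‖y‖ ≤ ∑ j, |y j| := by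
  conv_lhs => rw [← sum_smul_bv y]
  refine (norm_sum_le _ _).trans (Finset.sum_le_sum fun i _ => ?_)
  rw [norm_smul]; simp

/-- The integrable weight `(1 + |η|)^{-(n+1)}`. -/
noncomputable def jk (η : E n) : ℝ := ((1 + ‖η‖) ^ (n + 1))⁻¹

theorem jk_pos (η : E n) : 0 < jk η := by unfold jk; positivity

theorem continuous_jk : Continuous (jk (n := n)) := by
  unfold jk
  exact Continuous.inv₀ (by fun_prop) fun η => by positivity

theorem integrable_jk : Integrable (jk (n := n)) := by
  have := integrable_one_add_norm (E := E n) (μ := volume) (r := (n + 1 : ℕ)) (by simp)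
  refine this.congr (Eventually.of_forall fun η => ?_)
  simp only [jk]
  rw [Real.rpow_neg (by positivity), Real.rpow_natCast]

/-- The n + 1 derivatives in η are just enough for the result to be integrable in `y`. -/
theorem RegV.decay_jk {c : ℝ} {G : E n → ℂ}
    (h : RegV (fun _ => 1) (n + 1) (fun η => c * jk η) G) (y : E n) :
    ‖∫ η, ek y η * G η‖ ≤ c * ((n + 1) ^ (n + 1) * ∫ η : E n, jk η) * jk y := by
  have h1 := h.decay (integrable_jk.const_mul c) y
  rw [integral_const_mul] at h1
  have h2 : (1 + ‖y‖) ^ (n + 1) ≤ (1 + ∑ j, |y j|) ^ (n + 1) := by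
    gcongr; exact norm_le_sum_abs y
  rw [jk, ← div_eq_mul_inv, le_div_iff₀ (by positivity)]
  calc _ ≤ ‖∫ η, ek y η * G η‖ * (1 + ∑ j, |y j|) ^ (n + 1) := by gcongr
    _ ≤ _ := by rw [mul_comm]; refine h1.trans (le_of_eq ?_); ring

/-! ### The regularised form of the oscillatory integral -/

/-- The order of integration matters: the integrand need not decay in `y` until the η-integral has
been carried out, so this is an iterated integral and not one over the product. -/
noncomputable def bOp (l : List (Fin n)) (F : E n → E n → ℂ) : ℂ :=
  (((2 * Real.pi) ^ n)⁻¹ : ℂ) * ∫ y, ∫ η, ek y η * Tl l F y η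

/-- The list `l` gains enough decay to compensate growth of order `K`. -/
def Adm (l : List (Fin n)) (K : ℕ) : Prop :=
  ∃ C : ℝ, 0 ≤ C ∧ ∀ η : E n, (1 + ‖η‖) ^ K * Dl l η ≤ C * jk η

theorem Adm.cons {l : List (Fin n)} {K : ℕ} (h : Adm l K) (j : Fin n) : Adm (j :: l) K := by
  obtain ⟨C, hC, h⟩ := h
  refine ⟨C, hC, fun η => le_trans ?_ (h η)⟩
  rw [Dl_cons]
  have := mul_le_mul_of_nonneg_right (norm_qj_le_one j η) (Dl_nonneg l η)
  gcongr
  simpa using this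

theorem one_add_sum_le_prod_one_add {ι : Type*} (s : Finset ι) {f : ι → ℝ} (hf : ∀ i, 0 ≤ f i) :
    1 + ∑ i ∈ s, f i ≤ ∏ i ∈ s, (1 + f i) := by
  classical
  induction s using Finset.induction_on with
  | empty => simp
  | insert j s hj ih =>
    rw [Finset.sum_insert hj, Finset.prod_insert hj]
    have := Finset.sum_nonneg fun i (_ : i ∈ s) => hf i
    nlinarith [hf j]

/-- One pass through all coordinates gains a full power of `1 + ‖η‖`, because ∏(1 + η_j²) ≥ 1 + |η|²
and (1 + |η|)² ≤ 2(1 + |η|²). -/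
theorem Dl_finRange (η : E n) : Dl (List.finRange n) η * (1 + ‖η‖) ≤ 2 := by
  have h1 : Dl (List.finRange n) η = ∏ j, ‖qj j η‖ := by
    rw [Dl, ← List.ofFn_eq_map, List.prod_ofFn]
  have h2 : Dl (List.finRange n) η ^ 2 * (1 + ‖η‖ ^ 2) ≤ 1 := by
    rw [h1, ← Finset.prod_pow]
    have h3 : ∀ j, ‖qj j η‖ ^ 2 = (1 + (η j) ^ 2)⁻¹ := fun j => by
      rw [qj, norm_inv, inv_pow, normSq_one_add_I_mul]
    simp_rw [h3]
    rw [Finset.prod_inv_distrib, inv_mul_le_one₀ (by positivity)]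
    rw [EuclideanSpace.norm_sq_eq]
    simp only [Real.norm_eq_abs, sq_abs]
    exact one_add_sum_le_prod_one_add _ fun i => sq_nonneg (η i)
  have h0 := Dl_nonneg (List.finRange n) η
  have h5 : (Dl (List.finRange n) η * (1 + ‖η‖)) ^ 2 ≤ 2 ^ 2 := by
    have : (1 + ‖η‖) ^ 2 ≤ 2 * (1 + ‖η‖ ^ 2) := by nlinarith [sq_nonneg (1 - ‖η‖)]
    rw [mul_pow]
    nlinarith [sq_nonneg (Dl (List.finRange n) η)]
  exact le_of_sq_le_sq h5 (by norm_num)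

theorem exists_adm (K : ℕ) : ∃ l : List (Fin n), Adm l K := by
  have key : ∀ m : ℕ, ∃ l : List (Fin n), ∀ η : E n, Dl l η * (1 + ‖η‖) ^ m ≤ 2 ^ m := by
    intro m
    induction m with
    | zero => exact ⟨[], fun η => by simp [Dl]⟩
    | succ m ih =>
      obtain ⟨l, h⟩ := ih
      refine ⟨List.finRange n ++ l, fun η => ?_⟩
      rw [Dl_append]
      have h0 := Dl_nonneg l η
      have h1 := Dl_nonneg (List.finRange n) η
      calc _ = (Dl (List.finRange n) η * (1 + ‖η‖)) * (Dl l η * (1 + ‖η‖) ^ m) := by ring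
        _ ≤ 2 * 2 ^ m := mul_le_mul (Dl_finRange η) (h η) (by positivity) (by norm_num)
        _ = _ := by ring
  -- `K` powers cancel the growth, and `n + 1` more leave the weight `jk`.
  obtain ⟨l, h⟩ := key (K + (n + 1))
  refine ⟨l, 2 ^ (K + (n + 1)), by positivity, fun η => ?_⟩
  have := h η
  rw [jk, ← div_eq_mul_inv, le_div_iff₀ (by positivity)]
  refine le_trans (le_of_eq ?_) this
  rw [pow_add]; ring

end NonsmoothPDO

/-! ### Bounds and limits of the regularised integral -/

namespace NonsmoothPDO

variable {n : ℕ}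

theorem Amp.tl_jk (l : List (Fin n)) {K : ℕ} (hl : Adm l K) : ∃ C : ℝ, 0 ≤ C ∧
    ∀ (N : E n → ℝ) (F : E n → E n → ℂ), (∀ y, 0 ≤ N y) →
      Amp (n + 1) l.length (fun y η => N y * (1 + ‖η‖) ^ K) F →
        Amp (n + 1) 0 (fun y η => (C * N y) * jk η) (Tl l F) := by
  obtain ⟨C, hC, h⟩ := hl
  obtain ⟨C', hC', h'⟩ := Amp.tl (n + 1) 0 l
  refine ⟨C' * C, by positivity, fun N F hN hF => (h' _ F hF).mono fun y η => ?_⟩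
  calc C' * (N y * (1 + ‖η‖) ^ K * Dl l η) = C' * N y * ((1 + ‖η‖) ^ K * Dl l η) := by ring
    _ ≤ C' * N y * (C * jk η) := mul_le_mul_of_nonneg_left (h η) (mul_nonneg hC' (hN y))
    _ = _ := by ring

/-- The dependence on `y` is kept in the weight `N`: the decay of the remainder in `x` comes from a
weight that is small except for large `y`. -/
theorem inner_bound (l : List (Fin n)) {K : ℕ} (hl : Adm l K) : ∃ C : ℝ, 0 ≤ C ∧
    ∀ (N : E n → ℝ) (F : E n → E n → ℂ), (∀ y, 0 ≤ N y) →
      Amp (n + 1) l.length (fun y η => N y * (1 + ‖η‖) ^ K) F →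
        ∀ y, ‖∫ η, ek y η * Tl l F y η‖ ≤ C * (N y * jk y) := by
  obtain ⟨C, hC, h⟩ := Amp.tl_jk l hl
  have hI : 0 ≤ ∫ η : E n, jk η := integral_nonneg fun η => (jk_pos η).le
  refine ⟨C * ((n + 1) ^ (n + 1) * ∫ η : E n, jk η), by positivity, fun N F hN hF y => ?_⟩
  refine (((h N F hN hF).base.2 y).decay_jk y).trans (le_of_eq ?_)
  ring

theorem two_pi_pow_norm : ‖(((2 * Real.pi) ^ n)⁻¹ : ℂ)‖ = ((2 * Real.pi) ^ n)⁻¹ := by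
  rw [norm_inv, norm_pow, norm_mul]
  simp [abs_of_pos Real.pi_pos]

theorem bOp_bound (l : List (Fin n)) {K : ℕ} (hl : Adm l K) : ∃ C : ℝ, 0 ≤ C ∧
    ∀ (N : E n → ℝ) (F : E n → E n → ℂ), (∀ y, 0 ≤ N y) → Integrable (fun y => N y * jk y) →
      Amp (n + 1) l.length (fun y η => N y * (1 + ‖η‖) ^ K) F →
        ‖bOp l F‖ ≤ C * ∫ y, N y * jk y := by
  obtain ⟨C, hC, h⟩ := inner_bound l hl
  refine ⟨((2 * Real.pi) ^ n)⁻¹ * C, by positivity, fun N F hN hi hF => ?_⟩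
  rw [bOp, norm_mul, two_pi_pow_norm, mul_assoc, ← integral_const_mul]
  refine mul_le_mul_of_nonneg_left ?_ (by positivity)
  exact norm_integral_le_of_norm_le (hi.const_mul C) (Eventually.of_forall (h N F hN hF))

theorem continuous_Tl {l : List (Fin n)} {W : E n → E n → ℝ} {F : E n → E n → ℂ} {A : ℕ}
    (h : Amp A l.length W F) : Continuous (Function.uncurry (Tl l F)) := by
  obtain ⟨C, _, h'⟩ := Amp.tl (n := n) A 0 l
  exact (h' W F h).continuous

theorem aesm_inner {l : List (Fin n)} {W : E n → E n → ℝ} {F : E n → E n → ℂ} {A : ℕ}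
    (h : Amp A l.length W F) :
    AEStronglyMeasurable (fun y => ∫ η, ek y η * Tl l F y η) := by
  have h1 : Continuous (fun p : E n × E n => ek p.1 p.2 * Tl l F p.1 p.2) :=
    continuous_ek.mul (continuous_Tl h)
  exact (h1.stronglyMeasurable.integral_prod_right'
    (ν := (volume : Measure (E n)))).aestronglyMeasurable

/-- Dominated convergence is used twice, for the η-integral at fixed `y` and then for the
y-integral. The dominating function of the latter comes from `inner_bound`, that is, from
η-regularity and not from the size of the integrand. -/
theorem tendsto_bOp {ι : Type*} {f : Filter ι} [f.IsCountablyGenerated] {l : List (Fin n)} {K : ℕ}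
    (hl : Adm l K) {c : ℝ} {Ft : ι → E n → E n → ℂ} {F : E n → E n → ℂ}
    (hFt : ∀ t, Amp (n + 1) l.length (fun _ η => c * (1 + ‖η‖) ^ K) (Ft t))
    (hF : Amp (n + 1) l.length (fun _ η => c * (1 + ‖η‖) ^ K) F)
    (h : Conv f l.length Ft F) : Tendsto (fun t => bOp l (Ft t)) f (𝓝 (bOp l F)) := by
  have hc : 0 ≤ c := by
    have := hF.nonneg 0 0
    simpa using this
  obtain ⟨C, hC, hb⟩ := inner_bound l hl
  obtain ⟨C', hC', hb'⟩ := Amp.tl_jk l hl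
  refine Tendsto.const_mul _ ?_
  refine tendsto_integral_filter_of_dominated_convergence (fun y => C * (c * jk y))
    (Eventually.of_forall fun t => aesm_inner (hFt t))
    (Eventually.of_forall fun t => Eventually.of_forall fun y =>
      hb (fun _ => c) (Ft t) (fun _ => hc) (hFt t) y)
    ((integrable_jk.const_mul c).const_mul C) (Eventually.of_forall fun y => ?_)
  refine tendsto_integral_filter_of_dominated_convergence (fun η => C' * c * jk η)
    (Eventually.of_forall fun t => ?_) (Eventually.of_forall fun t => Eventually.of_forall fun η => ?_)
    (integrable_jk.const_mul _) (Eventually.of_forall fun η => ?_)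
  · have h1 := continuous_Tl (hFt t)
    have h2 : Continuous (fun η => ek y η * Tl l (Ft t) y η) :=
      (continuous_ek.comp (by fun_prop : Continuous fun η : E n => (y, η))).mul
        (h1.comp (by fun_prop : Continuous fun η : E n => (y, η)))
    exact h2.aestronglyMeasurable
  · rw [norm_mul, norm_ek, one_mul]
    exact (hb' (fun _ => c) (Ft t) (fun _ => hc) (hFt t)).bound y η
  · exact (Conv.tl l h (fun t => (hFt t).of_le_left (Nat.zero_le _))
      (hF.of_le_left (Nat.zero_le _)) y η).const_mul _

theorem tendsto_bOp_of_eventually {ι : Type*} {f : Filter ι} [f.IsCountablyGenerated]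
    {l : List (Fin n)} {K : ℕ}
    (hl : Adm l K) {c : ℝ} {Ft : ι → E n → E n → ℂ} {F : E n → E n → ℂ}
    (hFt : ∀ᶠ t in f, Amp (n + 1) l.length (fun _ η => c * (1 + ‖η‖) ^ K) (Ft t))
    (hF : Amp (n + 1) l.length (fun _ η => c * (1 + ‖η‖) ^ K) F)
    (h : Conv f l.length Ft F) : Tendsto (fun t => bOp l (Ft t)) f (𝓝 (bOp l F)) := by
  classical
  -- Indices violating the uniform bound are given the limit `F`, so that the bound holds for every
  -- index.
  let Gt : ι → E n → E n → ℂ := fun t =>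
    if Amp (n + 1) l.length (fun _ η => c * (1 + ‖η‖) ^ K) (Ft t) then Ft t else F
  have he : Ft =ᶠ[f] Gt := hFt.mono fun t ht => by simp [Gt, ht]
  have hG : ∀ t, Amp (n + 1) l.length (fun _ η => c * (1 + ‖η‖) ^ K) (Gt t) := fun t => by
    by_cases ht : Amp (n + 1) l.length (fun _ η => c * (1 + ‖η‖) ^ K) (Ft t)
    · simp [Gt, ht]
    · simp [Gt, ht, hF]
  exact (tendsto_bOp hl hG hF (h.congr' he)).congr' (he.mono fun t ht => by simp only [ht])

/-! ### Schwartz cut-offs -/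

/-- The dilated cut-off `(y, η) ↦ χ(εy, εη)`. -/
noncomputable def chi (χ : SchwartzMap (E n × E n) ℂ) (ε : ℝ) : E n → E n → ℂ := fun y η => χ (ε • (y, η))

noncomputable def vk (s : ℕ) (y η : E n) : ℝ := ((1 + ‖y‖) ^ s * (1 + ‖η‖) ^ s)⁻¹

theorem schwartz_bound (s : ℕ) (χ : SchwartzMap (E n × E n) ℂ) :
    ∃ C : ℝ, 0 ≤ C ∧ ∀ y η, ‖χ (y, η)‖ ≤ C * vk s y η := by
  have h := fun x => SchwartzMap.one_add_le_sup_seminorm_apply (𝕜 := ℝ) (m := (s + s, 0))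
    (k := s + s) (n := 0) le_rfl le_rfl χ x
  set C := 2 ^ (s + s, 0).1 * ((Finset.Iic (s + s, 0)).sup fun m =>
    SchwartzMap.seminorm ℝ m.1 m.2) χ
  refine ⟨C, by positivity, fun y η => ?_⟩
  have h1 := h (y, η)
  rw [norm_iteratedFDeriv_zero] at h1
  rw [vk, ← div_eq_mul_inv, le_div_iff₀ (by positivity), mul_comm]
  refine le_trans ?_ h1
  rw [pow_add]
  gcongr
  · exact norm_fst_le (y, η)
  · exact norm_snd_le (y, η)

theorem hasPd_chi_snd (χ : SchwartzMap (E n × E n) ℂ) (ε : ℝ) (y : E n) (j : Fin n) :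
    HasPd j (chi χ ε y) ∧ pd j (chi χ ε y) =
      fun η => (ε : ℂ) * chi (LineDeriv.lineDerivOp ((0, bv j) : E n × E n) χ) ε y η :=
  HasPd.of_has fun η => by
    have h1 := χ.hasFDerivAt (ε • (y, η + (0 : ℝ) • bv j))
    have h2 : HasDerivAt (fun t : ℝ => ε • (y, η + t • bv j)) (ε • (0, bv j)) 0 := by
      refine HasDerivAt.const_smul ε (HasDerivAt.prodMk (hasDerivAt_const _ y) ?_)
      simpa using! ((hasDerivAt_id (0 : ℝ)).smul_const (bv j)).const_add η
    have h3 := h1.comp_hasDerivAt (0 : ℝ) h2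
    refine HasDerivAt.congr_deriv h3 ?_
    rw [map_smul]
    simp [chi, SchwartzMap.lineDerivOp_apply_eq_fderiv]

theorem hasPd_chi_fst (χ : SchwartzMap (E n × E n) ℂ) (ε : ℝ) (η : E n) (j : Fin n) :
    HasPd j (fun y => chi χ ε y η) ∧ pd j (fun y => chi χ ε y η) =
      fun y => (ε : ℂ) * chi (LineDeriv.lineDerivOp ((bv j, 0) : E n × E n) χ) ε y η :=
  HasPd.of_has fun y => by
    have h1 := χ.hasFDerivAt (ε • (y + (0 : ℝ) • bv j, η))
    have h2 : HasDerivAt (fun t : ℝ => ε • (y + t • bv j, η)) (ε • (bv j, 0)) 0 := by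
      refine HasDerivAt.const_smul ε (HasDerivAt.prodMk ?_ (hasDerivAt_const _ η))
      simpa using! ((hasDerivAt_id (0 : ℝ)).smul_const (bv j)).const_add y
    have h3 := h1.comp_hasDerivAt (0 : ℝ) h2
    refine HasDerivAt.congr_deriv h3 ?_
    rw [map_smul]
    simp [chi, SchwartzMap.lineDerivOp_apply_eq_fderiv]

theorem px_chi (χ : SchwartzMap (E n × E n) ℂ) (ε : ℝ) (i : Fin n) :
    px i (chi χ ε) = fun y η => (ε : ℂ) * chi (LineDeriv.lineDerivOp ((bv i, 0) : E n × E n) χ) ε y η := by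
  funext y η
  exact congrFun (hasPd_chi_fst χ ε η i).2 y

theorem continuous_chi (χ : SchwartzMap (E n × E n) ℂ) (ε : ℝ) :
    Continuous (Function.uncurry (chi χ ε)) := by
  unfold chi Function.uncurry
  exact χ.continuous.comp (by fun_prop)

/-- Each derivative of a dilated cut-off brings out a factor `ε ≤ 1`, hence the constant does not
depend on `ε`. -/
theorem regV_chi (A s : ℕ) (χ : SchwartzMap (E n × E n) ℂ) : ∃ C : ℝ, 0 ≤ C ∧
    ∀ ε ∈ Set.Icc (0 : ℝ) 1, ∀ y,
      RegV (fun _ => 1) A (fun η => C * vk s (ε • y) (ε • η)) (chi χ ε y) := by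
  have hc : ∀ (χ : SchwartzMap (E n × E n) ℂ) ε y, Continuous (chi χ ε y) := fun χ ε y =>
    (continuous_chi χ ε).comp (by fun_prop : Continuous fun η : E n => (y, η))
  have hv : ∀ y η : E n, 0 ≤ vk s y η := fun y η => by unfold vk; positivity
  induction A generalizing χ with
  | zero =>
    obtain ⟨C, hC, h⟩ := schwartz_bound s χ
    exact ⟨C, hC, fun ε _ y => ⟨hc χ ε y, fun η => h _ _⟩⟩
  | succ A ih =>
    choose C hC h using fun j => ih (LineDeriv.lineDerivOp ((0, bv j) : E n × E n) χ)
    obtain ⟨C₀, hC₀, h₀⟩ := schwartz_bound s χ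
    have hS : 0 ≤ ∑ j, C j := Finset.sum_nonneg fun j _ => hC j
    refine ⟨C₀ + ∑ j, C j, by positivity, fun ε hε y => ⟨⟨hc χ ε y, fun η => (h₀ _ _).trans ?_⟩,
      fun j => ⟨(hasPd_chi_snd χ ε y j).1, ?_⟩⟩⟩
    · exact mul_le_mul_of_nonneg_right (by linarith) (hv _ _)
    rw [(hasPd_chi_snd χ ε y j).2]
    refine ((h j ε hε y).const_mul (ε : ℂ)).mono_weight (fun _ => zero_le_one) fun η => ?_
    have h1 : ‖(ε : ℂ)‖ ≤ 1 := by simpa [abs_of_nonneg hε.1] using hε.2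
    have h2 : C j ≤ C₀ + ∑ j, C j := by
      have := Finset.single_le_sum (fun j _ => hC j) (Finset.mem_univ j)
      linarith
    have := hv (ε • y) (ε • η)
    have := hC j
    calc ‖(ε : ℂ)‖ * (C j * vk s (ε • y) (ε • η)) ≤ 1 * (C j * vk s (ε • y) (ε • η)) := by gcongr
      _ ≤ 1 * ((C₀ + ∑ j, C j) * vk s (ε • y) (ε • η)) := by gcongr

theorem amp_chi (A B s : ℕ) (χ : SchwartzMap (E n × E n) ℂ) : ∃ C : ℝ, 0 ≤ C ∧
    ∀ ε ∈ Set.Icc (0 : ℝ) 1, Amp A B (fun y η => C * vk s (ε • y) (ε • η)) (chi χ ε) := by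
  have hv : ∀ y η : E n, 0 ≤ vk s y η := fun y η => by unfold vk; positivity
  induction B generalizing χ with
  | zero =>
    obtain ⟨C, hC, h⟩ := regV_chi A s χ
    exact ⟨C, hC, fun ε hε => ⟨continuous_chi χ ε, h ε hε⟩⟩
  | succ B ih =>
    choose C hC h using fun j => ih (LineDeriv.lineDerivOp ((bv j, 0) : E n × E n) χ)
    obtain ⟨C₀, hC₀, h₀⟩ := regV_chi A s χ
    have hS : 0 ≤ ∑ j, C j := Finset.sum_nonneg fun j _ => hC j
    refine ⟨C₀ + ∑ j, C j, by positivity, fun ε hε => ⟨⟨continuous_chi χ ε, fun y =>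
      (h₀ ε hε y).mono_weight (fun _ => zero_le_one) fun η => ?_⟩,
      fun j => ⟨fun η => (hasPd_chi_fst χ ε η j).1, ?_⟩⟩⟩
    · exact mul_le_mul_of_nonneg_right (by linarith) (hv _ _)
    rw [px_chi]
    have h1 : ‖(ε : ℂ)‖ ≤ 1 := by simpa [abs_of_nonneg hε.1] using hε.2
    have h4 : Amp A B (fun y η => ‖(ε : ℂ)‖ * (C j * vk s (ε • y) (ε • η)))
        (fun y η => (ε : ℂ) * chi (LineDeriv.lineDerivOp ((bv j, 0) : E n × E n) χ) ε y η) :=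
      (h j ε hε).const_mul (ε : ℂ)
    refine h4.mono fun y η => ?_
    have h2 : C j ≤ C₀ + ∑ j, C j := by
      have := Finset.single_le_sum (fun j _ => hC j) (Finset.mem_univ j)
      linarith
    have := hv (ε • y) (ε • η)
    have := hC j
    calc ‖(ε : ℂ)‖ * (C j * vk s (ε • y) (ε • η)) ≤ 1 * (C j * vk s (ε • y) (ε • η)) := by gcongr
      _ = C j * vk s (ε • y) (ε • η) := one_mul _
      _ ≤ _ := by gcongr

/-- The scalars `c t` make the induction close: a y-derivative multiplies them by `ε t → 0`, in
accordance with the limit being constant. -/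
theorem conv_chi {ι : Type*} {f : Filter ι} {ε : ι → ℝ} (hε : Tendsto ε f (𝓝 0)) {c : ι → ℂ} {c₀ : ℂ}
    (hc : Tendsto c f (𝓝 c₀)) (B : ℕ) (χ : SchwartzMap (E n × E n) ℂ) :
    Conv f B (fun t y η => c t * chi χ (ε t) y η) (fun _ _ => c₀ * χ 0) := by
  have hb : ∀ y η, Tendsto (fun t => c t * chi χ (ε t) y η) f (𝓝 (c₀ * χ 0)) := fun y η => by
    refine hc.mul ?_
    have h1 : Continuous fun e : ℝ => χ (e • (y, η)) := χ.continuous.comp (by fun_prop)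
    have h2 := h1.tendsto 0
    rw [zero_smul] at h2
    exact h2.comp hε
  induction B generalizing c c₀ χ with
  | zero => exact hb
  | succ B ih =>
    refine ⟨hb, fun i => ?_⟩
    have h1 : px i (fun (_ _ : E n) => c₀ * χ 0) =
        fun _ _ => 0 * (LineDeriv.lineDerivOp ((bv i, 0) : E n × E n) χ) 0 := by
      funext y η
      rw [zero_mul]
      exact congrFun (HasPd.const i (c₀ * χ 0)).2 y
    have h2 : (fun t => px i (fun y η => c t * chi χ (ε t) y η)) = fun t y η =>
        (c t * (ε t : ℂ)) * chi (LineDeriv.lineDerivOp ((bv i, 0) : E n × E n) χ) (ε t) y η := by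
      funext t y η
      have := congrFun (((hasPd_chi_fst χ (ε t) η i).1).const_mul (c t)).2 y
      rw [(hasPd_chi_fst χ (ε t) η i).2, ← mul_assoc] at this
      exact this
    rw [h1, h2]
    have h3 : Tendsto (fun t => c t * (ε t : ℂ)) f (𝓝 0) := by
      have := hc.mul ((Complex.continuous_ofReal.tendsto 0).comp hε)
      simpa using! this
    refine ih h3 _ fun y η => ?_
    refine h3.mul ?_
    have h1 : Continuous fun e : ℝ => (LineDeriv.lineDerivOp ((bv i, 0) : E n × E n) χ) (e • (y, η)) :=
      (LineDeriv.lineDerivOp ((bv i, 0) : E n × E n) χ).continuous.comp (by fun_prop)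
    have h2 := h1.tendsto 0
    rw [zero_smul] at h2
    exact h2.comp hε

end NonsmoothPDO

namespace NonsmoothPDO

variable {n : ℕ}

/-! ### Existence of oscillatory integrals -/

theorem integrable_jk_prod : Integrable (fun p : E n × E n => jk p.1 * jk p.2) :=
  integrable_jk.mul_prod integrable_jk

theorem integrable_ek_prod {G : E n → E n → ℂ} {c : ℝ} (hG : Continuous (Function.uncurry G))
    (hb : ∀ y η, ‖G y η‖ ≤ c * (jk y * jk η)) :
    Integrable (fun p : E n × E n => ek p.1 p.2 * G p.1 p.2) := by
  have h1 : Continuous (fun p : E n × E n => ek p.1 p.2 * G p.1 p.2) := continuous_ek.mul hG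
  refine (integrable_jk_prod.const_mul c).mono' h1.aestronglyMeasurable
    (Eventually.of_forall fun p => ?_)
  rw [norm_mul, norm_ek, one_mul]
  exact hb _ _

theorem Amp.top_jk {B : ℕ} {c : ℝ} {G : E n → E n → ℂ} (j : Fin n)
    (hG : Amp 0 (B + 1) (fun y η => c * (jk y * jk η)) G) :
    ∃ c' : ℝ, Amp 0 B (fun y η => c' * (jk y * jk η)) (Top j G) := by
  obtain ⟨C, hC, h⟩ := Amp.top (n := n) 0 B
  refine ⟨C * c, (h j _ _ hG).mono fun y η => ?_⟩
  have h1 := hG.nonneg y η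
  have h2 := norm_qj_le_one j η
  calc C * (c * (jk y * jk η) * ‖qj j η‖) ≤ C * (c * (jk y * jk η) * 1) := by gcongr
    _ = _ := by ring

/-- At fixed η, integration by parts shows that 1 + ∂_{y_j} multiplies the y-integral by 1 + iη_j,
and q_j cancels this factor. -/
theorem integral_ek_top {c : ℝ} {G : E n → E n → ℂ} (j : Fin n)
    (hG : Amp 0 1 (fun y η => c * (jk y * jk η)) G) :
    ∫ p : E n × E n, ek p.1 p.2 * Top j G p.1 p.2 = ∫ p : E n × E n, ek p.1 p.2 * G p.1 p.2 := by
  obtain ⟨c', hT⟩ := hG.top_jk j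
  rw [Measure.volume_eq_prod, integral_prod_symm _ (integrable_ek_prod hT.continuous hT.bound),
    integral_prod_symm _ (integrable_ek_prod hG.continuous hG.bound)]
  congr 1
  funext η
  have hi : ∀ {H : E n → E n → ℂ}, Continuous (Function.uncurry H) →
      (∀ y η, ‖H y η‖ ≤ c * (jk y * jk η)) → Integrable (fun y => H y η) := fun hc hb =>
    integrable_of_bound (hc.comp (by fun_prop : Continuous fun y : E n => (y, η)))
      ((integrable_jk.mul_const (jk η)).const_mul c) fun y => hb y η
  have h1 := hi hG.continuous hG.bound
  have h2 : Integrable (fun y => pd j (fun y' => G y' η) y) :=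
    hi (hG.2 j).2.continuous (hG.2 j).2.bound
  have h3 := integral_ek_mul_pd ((hG.2 j).1 η) h1 h2 η
  have h4 : ∀ y, ek y η * Top j G y η =
      qj j η * (ek η y * G y η + ek η y * pd j (fun y => G y η) y) := fun y => by
    rw [ek_comm y η]
    simp only [Top, px]
    ring
  simp_rw [h4]
  rw [integral_const_mul, integral_add (integrable_ek_mul h1 η) (integrable_ek_mul h2 η), h3]
  have h5 : ∀ y, ek y η * G y η = ek η y * G y η := fun y => by rw [ek_comm]
  simp_rw [h5]
  have := one_add_I_mul_ne j η
  rw [qj]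
  field_simp

theorem integral_ek_prod_eq (l : List (Fin n)) {c : ℝ} {G : E n → E n → ℂ}
    (hG : Amp 0 l.length (fun y η => c * (jk y * jk η)) G) :
    ∫ p : E n × E n, ek p.1 p.2 * G p.1 p.2 = ∫ y, ∫ η, ek y η * Tl l G y η := by
  induction l generalizing c G with
  | nil =>
    rw [Measure.volume_eq_prod, integral_prod _ (integrable_ek_prod hG.continuous hG.bound)]
    rfl
  | cons j l ih =>
    obtain ⟨c', hT⟩ := hG.top_jk j
    rw [← integral_ek_top j (hG.of_le (by simp)), Tl_cons]
    exact ih hT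

theorem exists_chi_one (χ : SchwartzMap (E n × E n) ℂ) {ε : ℝ} (hε : 0 < ε) :
    ∃ χ' : SchwartzMap (E n × E n) ℂ, chi χ' 1 = chi χ ε := by
  let g : (E n × E n) ≃L[ℝ] (E n × E n) := ContinuousLinearEquiv.smulLeft (Units.mk0 ε hε.ne')
  refine ⟨SchwartzMap.compCLMOfContinuousLinearEquiv ℝ g χ, ?_⟩
  funext y η
  simp [chi, g, Units.smul_def]

theorem oscIntegrand_eq (F : E n → E n → ℂ) (χ : SchwartzMap (E n × E n) ℂ) (ε : ℝ) :
    oscIntegrand F χ ε = fun p => ek p.1 p.2 * (chi χ ε p.1 p.2 * F p.1 p.2) := by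
  funext p
  simp only [oscIntegrand, ek, chi, Prod.mk.eta]
  ring

theorem amp_chi_mul {A B K : ℕ} {c : ℝ} {F : E n → E n → ℂ}
    (hF : Amp A B (fun _ η => c * (1 + ‖η‖) ^ K) F) (χ : SchwartzMap (E n × E n) ℂ) {ε : ℝ}
    (hε : 0 < ε) : ∃ c' : ℝ, Amp A B (fun y η => c' * (jk y * jk η))
      (fun y η => chi χ ε y η * F y η) := by
  obtain ⟨χ', hχ'⟩ := exists_chi_one χ hε
  -- `K` orders of the decay of the cut-off absorb the growth in η; the other `n + 1` leave `jk y *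
  -- jk η`.
  obtain ⟨C, hC, h⟩ := amp_chi A B (K + (n + 1)) χ'
  have h1 := h 1 ⟨zero_le_one, le_rfl⟩
  rw [hχ'] at h1
  refine ⟨2 ^ (A + B) * (C * c), (h1.mul hF).mono fun y η => ?_⟩
  have hc : 0 ≤ c := by simpa using hF.nonneg 0 0
  have h2 : vk (K + (n + 1)) y η * (1 + ‖η‖) ^ K ≤ jk y * jk η := by
    rw [vk, jk, jk, mul_inv, pow_add _ K (n + 1), pow_add _ K (n + 1)]
    have e1 : 1 ≤ (1 + ‖y‖) ^ K := one_le_pow₀ (by linarith [norm_nonneg y])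
    have e2 : ((1 + ‖y‖) ^ K)⁻¹ ≤ 1 := inv_le_one_of_one_le₀ e1
    calc _ = ((1 + ‖y‖) ^ K)⁻¹ * (((1 + ‖y‖) ^ (n + 1))⁻¹ * ((1 + ‖η‖) ^ (n + 1))⁻¹) := by
          field_simp
      _ ≤ 1 * (((1 + ‖y‖) ^ (n + 1))⁻¹ * ((1 + ‖η‖) ^ (n + 1))⁻¹) := by gcongr
      _ = _ := one_mul _
  simp only [one_smul]
  calc _ = 2 ^ (A + B) * (C * c) * (vk (K + (n + 1)) y η * (1 + ‖η‖) ^ K) := by ring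
    _ ≤ _ := by gcongr

/-- For ε > 0 everything converges absolutely, so Fubini and integration by parts identify the
regularised integral with `bOp` of the cut-off amplitude. As ε → 0 these amplitudes satisfy one
common bound and converge to `F` together with their y-derivatives. The limit does not involve the
cut-off. -/
theorem hasOscInt_bOp {l : List (Fin n)} {K : ℕ} (hl : Adm l K) {c : ℝ} {F : E n → E n → ℂ}
    (hF : Amp (n + 1) l.length (fun _ η => c * (1 + ‖η‖) ^ K) F) : HasOscInt F (bOp l F) := by
  intro χ hχ
  have hc : 0 ≤ c := by simpa using hF.nonneg 0 0
  refine ⟨fun ε hε => ?_, ?_⟩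
  · obtain ⟨c', h⟩ := amp_chi_mul hF χ hε
    rw [oscIntegrand_eq]
    exact integrable_ek_prod h.continuous h.bound
  have h1 : ∀ᶠ ε in 𝓝[>] (0 : ℝ), (((2 * Real.pi) ^ n)⁻¹ : ℂ) * ∫ p, oscIntegrand F χ ε p =
      bOp l (fun y η => chi χ ε y η * F y η) := by
    filter_upwards [self_mem_nhdsWithin] with ε hε
    obtain ⟨c', h⟩ := amp_chi_mul hF χ hε
    rw [oscIntegrand_eq, bOp, integral_ek_prod_eq l (h.of_le_left (Nat.zero_le _))]
  refine Tendsto.congr' (h1.mono fun _ h => h.symm) ?_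
  obtain ⟨C, hC, h⟩ := amp_chi (n + 1) l.length 0 χ
  have hv : ∀ y η : E n, vk 0 y η = 1 := fun y η => by simp [vk]
  simp only [hv, mul_one] at h
  -- Clamping to `[0, 1]` makes the uniform bounds available for every real `ε`; near `0` from the
  -- right nothing changes.
  let e : ℝ → ℝ := fun ε => max 0 (min ε 1)
  have he : ∀ ε, e ε ∈ Set.Icc (0 : ℝ) 1 := fun ε =>
    ⟨le_max_left _ _, max_le zero_le_one (min_le_right _ _)⟩
  have het : Tendsto e (𝓝[>] 0) (𝓝 0) := by
    have : Continuous e := by fun_prop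
    exact tendsto_nhdsWithin_of_tendsto_nhds (this.tendsto' 0 0 (by simp [e]))
  have hee : ∀ᶠ ε in 𝓝[>] (0 : ℝ), e ε = ε := by
    filter_upwards [Ioc_mem_nhdsGT (zero_lt_one (α := ℝ))] with ε hε
    simp [e, hε.1.le, hε.2]
  have hconv : Conv (𝓝[>] (0 : ℝ)) l.length (fun ε => chi χ (e ε)) (fun _ _ => 1) := by
    have := conv_chi het (tendsto_const_nhds (x := (1 : ℂ))) l.length χ
    simpa [hχ] using this
  have hone : Amp (n + 1) l.length (fun (_ _ : E n) => (1 : ℝ)) (fun _ _ => (1 : ℂ)) := by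
    have := Amp.of_eta (RegV.const (q := fun _ : E n => 1) (fun _ => zero_le_one) (1 : ℂ) (n + 1))
      l.length
    simpa using this
  -- `C + 1` instead of `C` ensures `D ≥ 1`, so the limit `F` obeys the same bound as the
  -- approximants.
  set D : ℝ := 2 ^ (n + 1 + l.length) * (C + 1) with hD
  have hA : ∀ ε, Amp (n + 1) l.length (fun _ η => D * c * (1 + ‖η‖) ^ K)
      (fun y η => chi χ (e ε) y η * F y η) := fun ε =>
    ((h (e ε) (he ε)).mul hF).mono fun y η => by
      calc 2 ^ (n + 1 + l.length) * (C * (c * (1 + ‖η‖) ^ K))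
          ≤ 2 ^ (n + 1 + l.length) * ((C + 1) * (c * (1 + ‖η‖) ^ K)) := by gcongr; linarith
        _ = _ := by rw [hD]; ring
  have hA0 : Amp (n + 1) l.length (fun _ η => D * c * (1 + ‖η‖) ^ K) F := hF.mono fun y η => by
    have h1 : 1 ≤ D := by
      have : (1 : ℝ) ≤ 2 ^ (n + 1 + l.length) := one_le_pow₀ (by norm_num)
      nlinarith
    have h2 : 0 ≤ c * (1 + ‖η‖) ^ K := by positivity
    nlinarith
  have hconv2 : Conv (𝓝[>] (0 : ℝ)) l.length (fun ε y η => chi χ (e ε) y η * F y η) F := by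
    have := hconv.mul (Conv.const F l.length) (fun ε => h (e ε) (he ε)) (fun _ => hF) hone hF
    simpa using this
  refine (tendsto_bOp hl hA hA0 hconv2).congr' (hee.mono fun ε hε => ?_)
  simp only [hε]

theorem HasOscInt.unique {F : E n → E n → ℂ} {I J : ℂ} (hI : HasOscInt F I) (hJ : HasOscInt F J)
    {χ : SchwartzMap (E n × E n) ℂ} (hχ : χ 0 = 1) : I = J :=
  tendsto_nhds_unique (hI χ hχ).2 (hJ χ hχ).2

theorem HasOscInt.add {F G : E n → E n → ℂ} {I J : ℂ} (hI : HasOscInt F I) (hJ : HasOscInt G J) :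
    HasOscInt (fun y η => F y η + G y η) (I + J) := by
  intro χ hχ
  have he : ∀ ε, oscIntegrand (fun y η => F y η + G y η) χ ε =
      fun p => oscIntegrand F χ ε p + oscIntegrand G χ ε p := fun ε => by
    funext p; simp only [oscIntegrand]; ring
  refine ⟨fun ε hε => ?_, ?_⟩
  · rw [he]; exact ((hI χ hχ).1 ε hε).add ((hJ χ hχ).1 ε hε)
  · refine ((hI χ hχ).2.add (hJ χ hχ).2).congr' ?_
    filter_upwards [self_mem_nhdsWithin] with ε hε
    rw [he, integral_add ((hI χ hχ).1 ε hε) ((hJ χ hχ).1 ε hε), mul_add]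

theorem HasOscInt.const_mul {F : E n → E n → ℂ} {I : ℂ} (hI : HasOscInt F I) (c : ℂ) :
    HasOscInt (fun y η => c * F y η) (c * I) := by
  intro χ hχ
  have he : ∀ ε, oscIntegrand (fun y η => c * F y η) χ ε =
      fun p => c * oscIntegrand F χ ε p := fun ε => by
    funext p; simp only [oscIntegrand]; ring
  refine ⟨fun ε hε => ?_, ?_⟩
  · rw [he]; exact ((hI χ hχ).1 ε hε).const_mul c
  · refine ((hI χ hχ).2.const_mul c).congr fun ε => ?_
    rw [he, integral_const_mul]; ring

/-- A Schwartz function which is `1` at the origin, as a product of two cut-offs. -/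
theorem exists_cutoff : ∃ (ψ : SchwartzMap (E n) ℂ) (χ : SchwartzMap (E n × E n) ℂ),
    ψ 0 = 1 ∧ ∀ y η, χ (y, η) = ψ y * ψ η := by
  let b : ContDiffBump (0 : E n) := ⟨1, 2, zero_lt_one, one_lt_two⟩
  have hb : ContDiff ℝ ∞ (fun x => (b x : ℂ)) := Complex.ofRealCLM.contDiff.comp b.contDiff
  have hs : HasCompactSupport (fun x => (b x : ℂ)) :=
    b.hasCompactSupport.comp_left (g := fun t : ℝ => (t : ℂ)) (by simp)
  have hb2 : ContDiff ℝ ∞ (fun p : E n × E n => (b p.1 : ℂ) * (b p.2 : ℂ)) :=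
    (hb.comp contDiff_fst).mul (hb.comp contDiff_snd)
  have hs2 : HasCompactSupport (fun p : E n × E n => (b p.1 : ℂ) * (b p.2 : ℂ)) := by
    refine HasCompactSupport.of_support_subset_isCompact
      ((isCompact_closedBall (0 : E n) 2).prod (isCompact_closedBall (0 : E n) 2)) fun p hp => ?_
    have h : ∀ x, (b x : ℂ) ≠ 0 → x ∈ Metric.closedBall (0 : E n) 2 := fun x hx => by
      by_contra hx'
      refine hx ?_
      rw [b.zero_of_le_dist]
      · simp
      · simpa using (not_le.1 (by simpa using hx')).le
    exact ⟨h _ (left_ne_zero_of_mul hp), h _ (right_ne_zero_of_mul hp)⟩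
  refine ⟨hs.toSchwartzMap hb, hs2.toSchwartzMap hb2, ?_, fun y η => rfl⟩
  change ((b 0 : ℝ) : ℂ) = 1
  rw [b.one_of_mem_closedBall (by simp [b])]
  simp

theorem exists_chi_zero_eq_one : ∃ χ : SchwartzMap (E n × E n) ℂ, χ 0 = 1 := by
  obtain ⟨ψ, χ, h, h'⟩ := exists_cutoff (n := n)
  exact ⟨χ, by rw [← Prod.mk_zero_zero, h', h, one_mul]⟩

theorem HasOscInt.eq {F : E n → E n → ℂ} {I J : ℂ} (hI : HasOscInt F I) (hJ : HasOscInt F J) :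
    I = J := by
  obtain ⟨χ, hχ⟩ := exists_chi_zero_eq_one (n := n)
  exact hI.unique hJ hχ

theorem HasOscInt.oscInt_eq {F : E n → E n → ℂ} {I : ℂ} (hI : HasOscInt F I) : oscInt F = I := by
  have h : ∃ I, HasOscInt F I := ⟨I, hI⟩
  rw [oscInt, dif_pos h]
  exact h.choose_spec.eq hI

theorem HasOscInt.hasOscInt_oscInt {F : E n → E n → ℂ} {I : ℂ} (hI : HasOscInt F I) :
    HasOscInt F (oscInt F) := by rwa [hI.oscInt_eq]

/-- Change of variables `(y, η) ↦ (y / λ, λ η)`. -/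
theorem HasOscInt.of_scale {F : E n → E n → ℂ} {I : ℂ} {c : ℝ} (hc : 0 < c)
    (h : HasOscInt (fun y η => F (c⁻¹ • y) (c • η)) I) : HasOscInt F I := by
  intro χ hχ
  let g : (E n × E n) ≃L[ℝ] (E n × E n) :=
    (ContinuousLinearEquiv.smulLeft (Units.mk0 c⁻¹ (inv_pos.2 hc).ne')).prodCongr
      (ContinuousLinearEquiv.smulLeft (Units.mk0 c hc.ne'))
  have hg : ∀ p, g p = (c⁻¹ • p.1, c • p.2) := fun p => rfl
  have hmp : MeasurePreserving (g : E n × E n → E n × E n) := by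
    refine ⟨g.continuous.measurable, ?_⟩
    have h1 : (g : E n × E n → E n × E n) = Prod.map (fun y => c⁻¹ • y) (fun η => c • η) := by
      funext p; exact hg p
    rw [h1, Measure.volume_eq_prod, ← Measure.map_prod_map _ _ (by fun_prop) (by fun_prop),
      Measure.map_addHaar_smul _ (inv_pos.2 hc).ne', Measure.map_addHaar_smul _ hc.ne',
      Measure.prod_smul_left, Measure.prod_smul_right, smul_smul,
      ← ENNReal.ofReal_mul (by positivity)]
    have : |(c⁻¹ ^ Module.finrank ℝ (E n))⁻¹| * |(c ^ Module.finrank ℝ (E n))⁻¹| = 1 := by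
      rw [← abs_mul, ← mul_inv, ← mul_pow, inv_mul_cancel₀ hc.ne']
      simp
    rw [this]; simp
  have hemb : MeasurableEmbedding (g : E n × E n → E n × E n) :=
    g.toHomeomorph.measurableEmbedding
  have h2 := h (SchwartzMap.compCLMOfContinuousLinearEquiv ℝ g χ) (by simp [hχ])
  have key : ∀ ε, oscIntegrand (fun y η => F (c⁻¹ • y) (c • η))
      (SchwartzMap.compCLMOfContinuousLinearEquiv ℝ g χ) ε = oscIntegrand F χ ε ∘ g := fun ε => by
    funext p
    simp only [oscIntegrand, Function.comp, hg, SchwartzMap.compCLMOfContinuousLinearEquiv_apply,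
      inner_smul_left, inner_smul_right]
    have e1 : (c⁻¹ • (ε • p).1, c • (ε • p).2) = ε • (c⁻¹ • p.1, c • p.2) := by
      rw [← hg, map_smul, hg]
    have e2 : c * (c⁻¹ * inner ℝ p.1 p.2) = inner ℝ p.1 p.2 := by
      rw [← mul_assoc, mul_inv_cancel₀ hc.ne', one_mul]
    simp only [conj_trivial, e1, e2]
  refine ⟨fun ε hε => ?_, h2.2.congr fun ε => ?_⟩
  · have := h2.1 ε hε
    rw [key] at this
    exact (hmp.integrable_comp_emb hemb).1 this
  · rw [key]
    congr 1
    exact hmp.integral_comp hemb _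

end NonsmoothPDO

namespace NonsmoothPDO

variable {n : ℕ}

/-! ### Oscillatory integrals of amplitudes depending on `y` only -/

-- Fourier inversion at the origin, rescaled by 2π to the kernel e^{-iz·η}.
open scoped FourierTransform in
theorem integral_ek_schwartz (ψ : SchwartzMap (E n) ℂ) :
    Integrable (fun z => ∫ η, ek z η * ψ η) ∧
      ∫ z, ∫ η, ek z η * ψ η = ((2 * Real.pi) ^ n : ℂ) * ψ 0 := by
  have hpi : (0 : ℝ) < 2 * Real.pi := by positivity
  have h1 : (fun z : E n => ∫ η, ek z η * ψ η) = fun z => (𝓕 ψ) ((2 * Real.pi)⁻¹ • z) := by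
    funext z
    rw [SchwartzMap.fourier_coe, Real.fourier_eq']
    congr 1
    funext η
    rw [smul_eq_mul, ek, real_inner_comm, inner_smul_right]
    congr 2
    push_cast
    have : (Real.pi : ℂ) ≠ 0 := by exact_mod_cast Real.pi_ne_zero
    field_simp
  have h2 : ∫ z, (𝓕 ψ) z = ψ 0 := by
    have h3 : 𝓕⁻ (𝓕 ψ) = ψ := FourierTransform.fourierInv_fourier_eq ψ
    have h4 := congrArg (fun f : SchwartzMap (E n) ℂ => f 0) h3
    simp only [SchwartzMap.fourierInv_coe] at h4
    rw [Real.fourierInv_eq'] at h4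
    simpa using h4
  rw [h1]
  refine ⟨(𝓕 ψ).integrable.comp_smul (inv_pos.2 hpi).ne', ?_⟩
  have h5 := Measure.integral_comp_smul (volume : Measure (E n)) (fun z : E n => (𝓕 ψ) z)
    (2 * Real.pi)⁻¹
  rw [h5, h2]
  simp only [inv_pow, inv_inv, finrank_euclideanSpace, Fintype.card_fin]
  rw [abs_of_pos (by positivity), Complex.real_smul]
  push_cast
  rfl

/-- Existence is assumed, so a single cut-off ψ ⊗ ψ suffices. With y = εz the regularised integral
becomes ∫ ψ(ε²z) g(εz) (∫ e^{-iz·η}ψ(η) dη) dz, where the inner factor is integrable in z. The limit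
is g(0) times the constant given by Fourier inversion. -/
theorem HasOscInt.eq_of_y {g : E n → ℂ} {I : ℂ} {c : ℝ} (hg : Continuous g) (hb : ∀ y, ‖g y‖ ≤ c)
    (h : HasOscInt (fun y _ => g y) I) : I = g 0 := by
  obtain ⟨ψ, χ, hψ, hχ⟩ := exists_cutoff (n := n)
  have hχ0 : χ 0 = 1 := by rw [← Prod.mk_zero_zero, hχ, hψ, one_mul]
  obtain ⟨hΨi, hΨ⟩ := integral_ek_schwartz ψ
  have h1 := h χ hχ0
  obtain ⟨C, hC⟩ : ∃ C, ∀ x, ‖ψ x‖ ≤ C := by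
    obtain ⟨C, hC⟩ := ψ.decay 0 0
    exact ⟨C, fun x => by simpa using hC.2 x⟩
  have hc : 0 ≤ c := (norm_nonneg _).trans (hb 0)
  have hC0 : 0 ≤ C := (norm_nonneg _).trans (hC 0)
  have key : ∀ ε : ℝ, 0 < ε → ∫ p, oscIntegrand (fun y _ => g y) χ ε p =
      ∫ z, (ψ ((ε * ε) • z) * g (ε • z)) * ∫ η, ek z η * ψ η := by
    intro ε hε
    have hi := h1.1 ε hε
    rw [Measure.volume_eq_prod, integral_prod _ (by rwa [Measure.volume_eq_prod] at hi)]
    have e1 : ∀ y, ∫ η, oscIntegrand (fun y _ => g y) χ ε (y, η) =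
        ψ (ε • y) * g y * ∫ η, ek y η * ψ (ε • η) := by
      intro y
      rw [← integral_const_mul]
      congr 1
      funext η
      simp only [oscIntegrand, Prod.smul_mk, hχ, ek]
      ring
    simp_rw [e1]
    have e2 := Measure.integral_comp_smul_of_nonneg (volume : Measure (E n))
      (fun y => ψ (ε • y) * g y * ∫ η, ek y η * ψ (ε • η)) ε (hR := hε.le)
    have e3 : ∀ z : E n, ∫ η, ek z η * ψ η = (ε ^ n : ℝ) • ∫ η, ek (ε • z) η * ψ (ε • η) := by
      intro z
      have := Measure.integral_comp_smul_of_nonneg (volume : Measure (E n))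
        (fun η => ek z η * ψ η) ε (hR := hε.le)
      simp only [finrank_euclideanSpace, Fintype.card_fin] at this
      have e4 : ∀ η, ek z (ε • η) = ek (ε • z) η := fun η => by
        simp only [ek, inner_smul_left, inner_smul_right, conj_trivial]
      simp_rw [e4] at this
      rw [this, smul_smul, mul_inv_cancel₀ (by positivity), one_smul]
    simp_rw [e3]
    simp only [finrank_euclideanSpace, Fintype.card_fin] at e2
    have e5 : ∀ z, ψ ((ε * ε) • z) * g (ε • z) * (ε ^ n : ℝ) • ∫ η, ek (ε • z) η * ψ (ε • η) =
        (ε ^ n : ℝ) • (ψ (ε • (ε • z)) * g (ε • z) * ∫ η, ek (ε • z) η * ψ (ε • η)) := fun z => by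
      rw [smul_smul, mul_smul_comm]
    simp_rw [e5]
    rw [integral_smul, e2, smul_smul, mul_inv_cancel₀ (by positivity), one_smul]
  have hlim : Tendsto (fun ε : ℝ => ∫ z, (ψ ((ε * ε) • z) * g (ε • z)) * ∫ η, ek z η * ψ η)
      (𝓝[>] 0) (𝓝 (∫ z, (ψ 0 * g 0) * ∫ η, ek z η * ψ η)) := by
    refine tendsto_integral_filter_of_dominated_convergence
      (fun z => (C * c) * ‖∫ η, ek z η * ψ η‖) (Eventually.of_forall fun ε => ?_)
      (Eventually.of_forall fun ε => Eventually.of_forall fun z => ?_)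
      (hΨi.norm.const_mul _) (Eventually.of_forall fun z => ?_)
    · refine AEStronglyMeasurable.mul ?_ hΨi.aestronglyMeasurable
      exact ((ψ.continuous.comp (by fun_prop)).mul (hg.comp (by fun_prop))).aestronglyMeasurable
    · rw [norm_mul, norm_mul]
      gcongr
      · exact hC _
      · exact hb _
    · refine Tendsto.mul_const _ (tendsto_nhdsWithin_of_tendsto_nhds ?_)
      have : Continuous fun ε : ℝ => ψ ((ε * ε) • z) * g (ε • z) :=
        (ψ.continuous.comp (by fun_prop)).mul (hg.comp (by fun_prop))
      exact this.tendsto' 0 _ (by simp)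
  have h2 := hlim.const_mul (((2 * Real.pi) ^ n)⁻¹ : ℂ)
  have h3 := h1.2.congr' (show _ =ᶠ[𝓝[>] (0 : ℝ)] _ from by
    filter_upwards [self_mem_nhdsWithin] with ε hε
    rw [key ε hε])
  rw [tendsto_nhds_unique h3 h2, integral_const_mul, hΨ, hψ]
  have : (2 * Real.pi : ℂ) ≠ 0 := by
    have := Real.pi_ne_zero
    exact_mod_cast (by positivity : (2 * Real.pi) ≠ 0)
  field_simp

/-! ### The Japanese bracket -/

theorem one_le_jap (ξ : E n) : 1 ≤ jap ξ := by
  rw [jap, Real.one_le_sqrt]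
  nlinarith [sq_nonneg ‖ξ‖]

theorem jap_pos (ξ : E n) : 0 < jap ξ := zero_lt_one.trans_le (one_le_jap ξ)

theorem norm_le_jap (ξ : E n) : ‖ξ‖ ≤ jap ξ := Real.le_sqrt_of_sq_le (by linarith)

theorem jap_sq (ξ : E n) : jap ξ ^ 2 = 1 + ‖ξ‖ ^ 2 := Real.sq_sqrt (by positivity)

theorem jap_add_le (ξ ζ : E n) : jap (ξ + ζ) ≤ jap ξ + ‖ζ‖ := by
  have h1 := norm_add_le ξ ζ
  refine le_of_sq_le_sq ?_ (by have := jap_pos ξ; positivity)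
  rw [jap_sq, add_sq, jap_sq]
  nlinarith [norm_nonneg ζ, norm_nonneg ξ, norm_nonneg (ξ + ζ), norm_le_jap ξ]

theorem jap_le_add (ξ ζ : E n) : jap ξ ≤ jap (ξ + ζ) + ‖ζ‖ := by
  have := jap_add_le (ξ + ζ) (-ζ)
  simpa using this

theorem jap_rpow_pos (ξ : E n) (s : ℝ) : 0 < jap ξ ^ s := Real.rpow_pos_of_pos (jap_pos ξ) s

theorem jap_rpow_mono (ξ : E n) {s t : ℝ} (h : s ≤ t) : jap ξ ^ s ≤ jap ξ ^ t :=
  Real.rpow_le_rpow_of_exponent_le (one_le_jap ξ) h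

theorem one_le_jap_rpow (ξ : E n) {s : ℝ} (h : 0 ≤ s) : 1 ≤ jap ξ ^ s :=
  Real.one_le_rpow (one_le_jap ξ) h

/-- Comparability in both directions is assumed so that the bound covers exponents of either sign.
-/
theorem rpow_le_of_comparable {a b T : ℝ} (ha : 0 < a) (hb : 0 < b) (hT : 1 ≤ T) (h1 : a ≤ b * T)
    (h2 : b ≤ a * T) {s : ℝ} {S : ℕ} (hs : |s| ≤ S) : a ^ s ≤ b ^ s * T ^ S := by
  have hT0 : 0 < T := by linarith
  have hTS : T ^ |s| ≤ T ^ S := by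
    rw [← Real.rpow_natCast]
    exact Real.rpow_le_rpow_of_exponent_le hT hs
  rcases le_total 0 s with h | h
  · calc a ^ s ≤ (b * T) ^ s := Real.rpow_le_rpow ha.le h1 h
      _ = b ^ s * T ^ s := Real.mul_rpow hb.le hT0.le
      _ ≤ _ := by
        rw [abs_of_nonneg h] at hTS
        exact mul_le_mul_of_nonneg_left hTS (Real.rpow_nonneg hb.le s)
  · have h3 : b / T ≤ a := by rwa [div_le_iff₀ hT0]
    calc a ^ s ≤ (b / T) ^ s := Real.rpow_le_rpow_of_nonpos (by positivity) h3 h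
      _ = b ^ s * T ^ (-s) := by
        rw [Real.div_rpow hb.le hT0.le, Real.rpow_neg hT0.le, div_eq_mul_inv]
      _ ≤ _ := by
        rw [abs_of_nonpos h] at hTS
        exact mul_le_mul_of_nonneg_left hTS (Real.rpow_nonneg hb.le s)

/-- Peetre's inequality at the scale `⟨ξ⟩^δ`, `δ < 1`. -/
theorem jap_comparable {δ : ℝ} (hδ : δ < 1) : ∃ L : ℕ, 1 ≤ L ∧
    ∀ (ξ η : E n) (θ : ℝ), θ ∈ Set.Icc (0 : ℝ) 1 →
      jap (ξ + (θ * jap ξ ^ δ) • η) ≤ jap ξ * (2 * (1 + ‖η‖)) ^ L ∧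
      jap ξ ≤ jap (ξ + (θ * jap ξ ^ δ) • η) * (2 * (1 + ‖η‖)) ^ L := by
  -- The critical case is a shift with ⟨ξ⟩^δ‖η‖ ≥ ⟨ξ⟩/2. Then ⟨ξ⟩^{1-δ} ≤ 2‖η‖, and the power
  -- 1/(1-δ) is needed to bound ⟨ξ⟩ itself.
  obtain ⟨L, hL⟩ := exists_nat_ge (max 1 (1 / (1 - δ)))
  have hL1 : 1 ≤ L := by exact_mod_cast (le_max_left _ _).trans hL
  have hLδ : 1 / (1 - δ) ≤ L := (le_max_right _ _).trans hL
  refine ⟨L, hL1, fun ξ η θ hθ => ?_⟩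
  set ζ := (θ * jap ξ ^ δ) • η with hζ
  have hlam := jap_rpow_pos ξ δ
  have hζn : ‖ζ‖ ≤ jap ξ ^ δ * ‖η‖ := by
    rw [hζ, norm_smul, Real.norm_eq_abs, abs_of_nonneg (mul_nonneg hθ.1 hlam.le)]
    have : θ * jap ξ ^ δ ≤ jap ξ ^ δ := mul_le_of_le_one_left hlam.le hθ.2
    gcongr
  have hη := norm_nonneg η
  have hT : 2 * (1 + ‖η‖) ≤ (2 * (1 + ‖η‖)) ^ L := le_self_pow₀ (by linarith) (by omega)
  have hj := one_le_jap ξ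
  have hj' := one_le_jap (ξ + ζ)
  have hjδ : jap ξ ^ δ ≤ jap ξ := by
    simpa using jap_rpow_mono ξ hδ.le
  constructor
  · calc jap (ξ + ζ) ≤ jap ξ + ‖ζ‖ := jap_add_le ξ ζ
      _ ≤ jap ξ + jap ξ * ‖η‖ := by
        have : jap ξ ^ δ * ‖η‖ ≤ jap ξ * ‖η‖ := by gcongr
        linarith
      _ ≤ jap ξ * (2 * (1 + ‖η‖)) := by nlinarith
      _ ≤ _ := by gcongr
  · rcases le_total (jap ξ ^ δ * ‖η‖) (jap ξ / 2) with h | h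
    · have h1 := jap_le_add ξ ζ
      have h2 : jap ξ ≤ jap (ξ + ζ) * 2 := by linarith
      refine h2.trans ?_
      have : (2 : ℝ) ≤ (2 * (1 + ‖η‖)) ^ L := le_trans (by linarith) hT
      gcongr
    · have h1 : jap ξ ^ (1 - δ) ≤ 2 * (1 + ‖η‖) := by
        have e : jap ξ ^ (1 - δ) * jap ξ ^ δ = jap ξ := by
          rw [← Real.rpow_add (jap_pos ξ)]; simp
        have : jap ξ ^ (1 - δ) * jap ξ ^ δ ≤ (2 * ‖η‖) * jap ξ ^ δ := by rw [e]; linarith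
        have := le_of_mul_le_mul_right this hlam
        linarith
      have h2 : jap ξ ≤ (2 * (1 + ‖η‖)) ^ L := by
        have h3 : jap ξ = (jap ξ ^ (1 - δ)) ^ (1 / (1 - δ)) := by
          rw [← Real.rpow_mul (jap_pos ξ).le, mul_one_div_cancel (by linarith), Real.rpow_one]
        rw [h3]
        calc _ ≤ (2 * (1 + ‖η‖)) ^ (1 / (1 - δ)) :=
              Real.rpow_le_rpow (jap_rpow_pos _ _).le h1 (by
                have : 0 < 1 - δ := by linarith
                positivity)
          _ ≤ (2 * (1 + ‖η‖)) ^ (L : ℝ) :=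
              Real.rpow_le_rpow_of_exponent_le (by linarith) hLδ
          _ = _ := Real.rpow_natCast _ _
      calc jap ξ ≤ 1 * (2 * (1 + ‖η‖)) ^ L := by rwa [one_mul]
        _ ≤ _ := by gcongr

/-! ### The main estimate -/

theorem RegV.absorb {q W : E n → ℝ} {f : E n → ℂ} {A : ℕ} (hq : ∀ x, 1 ≤ q x)
    (h : RegV q A W f) : RegV (fun _ => 1) A (fun x => q x ^ A * W x) f := by
  induction A generalizing W f with
  | zero => exact ⟨h.1, fun x => by simpa using h.2 x⟩
  | succ A ih =>
    refine ⟨⟨h.1.1, fun x => (h.1.2 x).trans ?_⟩, fun j => ⟨(h.2 j).1, ?_⟩⟩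
    · exact le_mul_of_one_le_left (h.nonneg x) (one_le_pow₀ (hq x))
    · refine (ih (h.2 j).2).mono_weight (fun _ => zero_le_one) fun x => le_of_eq ?_
      ring

/-- After dilation an η-derivative costs at most ⟨ξ⟩^δ⟨ξ + θ⟨ξ⟩^δη⟩^{-ρ}. The first factor is at
most ⟨ξ⟩^ρ, and Peetre's inequality compares the brackets, so only a power of 1 + ‖η‖ remains,
independent of ξ and θ. -/
theorem regV_scaled {ρ δ : ℝ} (m : ℝ) (hδ : 0 ≤ δ) (hδρ : δ < ρ) (hρ : ρ ≤ 1) (A : ℕ) :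
    ∃ (K : ℕ) (C : ℝ), 0 ≤ C ∧ ∀ (f : E n → ℂ) (c θ : ℝ) (ξ : E n), 0 ≤ c → θ ∈ Set.Icc (0 : ℝ) 1 →
      RegV (fun ζ => jap ζ ^ (-ρ)) A (fun ζ => c * jap ζ ^ m) f →
      RegV (fun _ => 1) A (fun η => c * jap ξ ^ m * (C * (1 + ‖η‖) ^ K))
        (fun η => f (ξ + (θ * jap ξ ^ δ) • η)) := by
  obtain ⟨L, hL1, hL⟩ := jap_comparable (n := n) (hδρ.trans_le hρ)
  obtain ⟨S, hS⟩ := exists_nat_ge |m|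
  refine ⟨L * A + L * S, 2 ^ (L * A + L * S), by positivity, fun f c θ ξ hc hθ hf => ?_⟩
  have hT : ∀ η : E n, 1 ≤ (2 * (1 + ‖η‖)) ^ L := fun η =>
    one_le_pow₀ (by linarith [norm_nonneg η])
  have hρ1 : |-ρ| ≤ (1 : ℕ) := by
    rw [abs_neg, abs_of_nonneg (hδ.trans hδρ.le)]; simpa using hρ
  have h1 : RegV (fun η => (2 * (1 + ‖η‖)) ^ L) A
      (fun η => c * (jap ξ ^ m * ((2 * (1 + ‖η‖)) ^ L) ^ S))
      (fun η => f (ξ + (θ * jap ξ ^ δ) • η)) := by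
    refine hf.comp_affine ξ (θ * jap ξ ^ δ) (fun x => (jap_rpow_pos x _).le) (fun η => ?_)
      fun η => ?_
    · have h2 := rpow_le_of_comparable (jap_pos _) (jap_pos _) (hT η) (hL ξ η θ hθ).1
        (hL ξ η θ hθ).2 hρ1
      have h3 : |θ * jap ξ ^ δ| ≤ jap ξ ^ ρ := by
        rw [abs_of_nonneg (mul_nonneg hθ.1 (jap_rpow_pos _ _).le)]
        exact (mul_le_of_le_one_left (jap_rpow_pos _ _).le hθ.2).trans (jap_rpow_mono ξ hδρ.le)
      calc _ ≤ jap ξ ^ ρ * (jap ξ ^ (-ρ) * ((2 * (1 + ‖η‖)) ^ L) ^ 1) :=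
            mul_le_mul h3 h2 (jap_rpow_pos _ _).le (jap_rpow_pos _ _).le
        _ = (jap ξ ^ ρ * jap ξ ^ (-ρ)) * (2 * (1 + ‖η‖)) ^ L := by ring
        _ = _ := by rw [← Real.rpow_add (jap_pos ξ)]; simp
    · exact mul_le_mul_of_nonneg_left (rpow_le_of_comparable (jap_pos _) (jap_pos _) (hT η)
        (hL ξ η θ hθ).1 (hL ξ η θ hθ).2 hS) hc
  refine (h1.absorb hT).mono_weight (fun _ => zero_le_one) fun η => le_of_eq ?_
  rw [← pow_mul, ← pow_mul, ← mul_pow, pow_add]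
  ring

theorem Amp.tensor {A B : ℕ} {w v : E n → ℝ} {f g : E n → ℂ} (hf : RegV (fun _ => 1) A v f)
    (hg : RegV (fun _ => 1) B w g) :
    Amp A B (fun y η => 2 ^ (A + B) * (v η * w y)) (fun y η => f η * g y) :=
  (Amp.of_eta hf B).mul (Amp.of_y hg A)

/-- Existence uses the constant bound `c'` on the weight, the estimate uses `N` at the rescaled
points. The number `B` of derivatives required of `g` and the constant `C` depend only on `n`, `m`,
`ρ` and `δ`, which makes all later bounds uniform in θ, x and ξ. -/
theorem osc_estimate {ρ δ : ℝ} (m : ℝ) (hδ : 0 ≤ δ) (hδρ : δ < ρ) (hρ : ρ ≤ 1) :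
    ∃ (B : ℕ) (C : ℝ), 0 ≤ C ∧ ∀ (f g : E n → ℂ) (c c' θ : ℝ) (x ξ : E n) (w N : E n → ℝ), 0 ≤ c →
      θ ∈ Set.Icc (0 : ℝ) 1 →
      RegV (fun ζ => jap ζ ^ (-ρ)) (n + 1) (fun ζ => c * jap ζ ^ m) f →
      RegV (fun _ => jap ξ ^ δ) B w g → (∀ y, w y ≤ c') →
      (∀ y, w (x + (jap ξ ^ δ)⁻¹ • y) ≤ N y) → Integrable (fun y => N y * jk y) →
      ∃ I, HasOscInt (fun y η => f (ξ + θ • η) * g (x + y)) I ∧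
        ‖I‖ ≤ C * (c * jap ξ ^ m) * ∫ y, N y * jk y := by
  obtain ⟨K, C₀, hC₀, hsc⟩ := regV_scaled (n := n) m hδ hδρ hρ (n + 1)
  obtain ⟨l, hl⟩ := exists_adm (n := n) K
  obtain ⟨C₁, hC₁, hb⟩ := bOp_bound l hl
  refine ⟨l.length, C₁ * (2 ^ (n + 1 + l.length) * C₀), by positivity,
    fun f g c c' θ x ξ w N hc hθ hf hg hw hN hi => ?_⟩
  have hlam := jap_rpow_pos ξ δ
  have h1 := hsc f c θ ξ hc hθ hf
  have h2 : ∀ V : E n → ℝ, (∀ y, w (x + (jap ξ ^ δ)⁻¹ • y) ≤ V y) →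
      RegV (fun _ => 1) l.length V (fun y => g (x + (jap ξ ^ δ)⁻¹ • y)) := fun V hV =>
    hg.comp_affine x (jap ξ ^ δ)⁻¹ (fun _ => hlam.le) (fun y => by
      rw [abs_of_pos (inv_pos.2 hlam), inv_mul_cancel₀ hlam.ne']) hV
  have h3 := Amp.tensor h1 (h2 (fun _ => c') fun y => hw _)
  have h4 := Amp.tensor h1 (h2 N hN)
  set D := 2 ^ (n + 1 + l.length) * C₀ with hD
  have hN0 : ∀ y, 0 ≤ N y := fun y => (hg.nonneg _).trans (hN y)
  have hcm : 0 ≤ c * jap ξ ^ m := mul_nonneg hc (jap_rpow_pos _ _).le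
  refine ⟨bOp l (fun y η => f (ξ + (θ * jap ξ ^ δ) • η) * g (x + (jap ξ ^ δ)⁻¹ • y)),
    HasOscInt.of_scale hlam ?_, ?_⟩
  · simp only [smul_smul]
    refine hasOscInt_bOp hl (c := D * (c * jap ξ ^ m) * c') (h3.mono fun y η => le_of_eq ?_)
    rw [hD]; ring
  · have h5 := hb (fun y => D * (c * jap ξ ^ m) * N y) _
      (fun y => mul_nonneg (mul_nonneg (by positivity) hcm) (hN0 y))
      ((hi.const_mul (D * (c * jap ξ ^ m))).congr (Eventually.of_forall fun y => by
        simp only; ring))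
      (h4.mono fun y η => le_of_eq (by rw [hD]; ring))
    refine h5.trans (le_of_eq ?_)
    simp_rw [mul_assoc (D * (c * jap ξ ^ m))]
    rw [integral_const_mul]
    ring

end NonsmoothPDO

namespace NonsmoothPDO

variable {n : ℕ}

/-! ### Symbol classes by recursion on derivatives -/

/-- All mixed partial derivatives of total order at most the depth `s`, of order `≤ A` in `ξ` and
`≤ r` in `x`, exist and satisfy `P` at the order of the symbol class they belong to. -/
def SymD (ρ δ : ℝ) (P : ℝ → (E n → E n → ℂ) → Prop) :
    ℕ → ℕ∞ → ℕ∞ → ℝ → (E n → E n → ℂ) → Prop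
  | 0, _, _, m, a => P m a
  | s + 1, A, r, m, a => P m a ∧
      (1 ≤ A → ∀ j, (∀ x, HasPd j (a x)) ∧ SymD ρ δ P s (A - 1) r (m - ρ) (pxi j a)) ∧
      (1 ≤ r → ∀ i, (∀ ξ, HasPd i (fun x => a x ξ)) ∧ SymD ρ δ P s A (r - 1) (m + δ) (px i a))

/-- The depth only makes the recursion well founded when `A` or `r` is infinite; a symbol has to
pass at every depth. -/
def Sym (ρ δ : ℝ) (P : ℝ → (E n → E n → ℂ) → Prop) (A r : ℕ∞) (m : ℝ) (a : E n → E n → ℂ) : Prop :=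
  ∀ s, SymD ρ δ P s A r m a

variable {ρ δ : ℝ} {P P' P'' : ℝ → (E n → E n → ℂ) → Prop} {s : ℕ} {A r : ℕ∞} {m m' : ℝ}
  {a b : E n → E n → ℂ}

namespace SymD

theorem base (h : SymD ρ δ P s A r m a) : P m a := by
  cases s with
  | zero => exact h
  | succ s => exact h.1

theorem pred (h : SymD ρ δ P (s + 1) A r m a) : SymD ρ δ P s A r m a := by
  induction s generalizing A r m a with
  | zero => exact h.1
  | succ s ih =>
    exact ⟨h.1, fun hA j => ⟨(h.2.1 hA j).1, ih (h.2.1 hA j).2⟩,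
      fun hr i => ⟨(h.2.2 hr i).1, ih (h.2.2 hr i).2⟩⟩

theorem of_depth_le {s' : ℕ} (h : SymD ρ δ P s A r m a) (hs : s' ≤ s) : SymD ρ δ P s' A r m a := by
  induction hs with
  | refl => exact h
  | step _ ih => exact ih h.pred

theorem weaken (hP : ∀ m a, P m a → P' m a) (h : SymD ρ δ P s A r m a) :
    SymD ρ δ P' s A r m a := by
  induction s generalizing A r m a with
  | zero => exact hP _ _ h
  | succ s ih =>
    exact ⟨hP _ _ h.1, fun hA j => ⟨(h.2.1 hA j).1, ih (h.2.1 hA j).2⟩,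
      fun hr i => ⟨(h.2.2 hr i).1, ih (h.2.2 hr i).2⟩⟩

theorem of_le {A' r' : ℕ∞} (h : SymD ρ δ P s A r m a) (hA : A' ≤ A) (hr : r' ≤ r) :
    SymD ρ δ P s A' r' m a := by
  induction s generalizing A r A' r' m a with
  | zero => exact h
  | succ s ih =>
    exact ⟨h.1, fun hA' j => ⟨(h.2.1 (hA'.trans hA) j).1,
      ih (h.2.1 (hA'.trans hA) j).2 (tsub_le_tsub_right hA 1) hr⟩,
      fun hr' i => ⟨(h.2.2 (hr'.trans hr) i).1,
      ih (h.2.2 (hr'.trans hr) i).2 hA (tsub_le_tsub_right hr 1)⟩⟩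

theorem mono_order (hP : ∀ m m' a, m ≤ m' → P m a → P m' a) (h : SymD ρ δ P s A r m a)
    (hm : m ≤ m') : SymD ρ δ P s A r m' a := by
  induction s generalizing A r m m' a with
  | zero => exact hP _ _ _ hm h
  | succ s ih =>
    exact ⟨hP _ _ _ hm h.1, fun hA j => ⟨(h.2.1 hA j).1, ih (h.2.1 hA j).2 (by linarith)⟩,
      fun hr i => ⟨(h.2.2 hr i).1, ih (h.2.2 hr i).2 (by linarith)⟩⟩

theorem add (hP : ∀ m a b, P m a → P m b → P m (fun x ξ => a x ξ + b x ξ))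
    (h : SymD ρ δ P s A r m a) (h' : SymD ρ δ P s A r m b) :
    SymD ρ δ P s A r m (fun x ξ => a x ξ + b x ξ) := by
  induction s generalizing A r m a b with
  | zero => exact hP _ _ _ h h'
  | succ s ih =>
    refine ⟨hP _ _ _ h.1 h'.1, fun hA j => ⟨fun x =>
      (((h.2.1 hA j).1 x).add ((h'.2.1 hA j).1 x)).1, ?_⟩,
      fun hr i => ⟨fun ξ => (((h.2.2 hr i).1 ξ).add ((h'.2.2 hr i).1 ξ)).1, ?_⟩⟩
    · have : pxi j (fun x ξ => a x ξ + b x ξ) = fun x ξ => pxi j a x ξ + pxi j b x ξ := by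
        funext x ξ
        exact congrFun (((h.2.1 hA j).1 x).add ((h'.2.1 hA j).1 x)).2 ξ
      rw [this]
      exact ih (h.2.1 hA j).2 (h'.2.1 hA j).2
    · rw [Amp.px_add (h.2.2 hr i).1 (h'.2.2 hr i).1]
      exact ih (h.2.2 hr i).2 (h'.2.2 hr i).2

theorem const_mul (c : ℂ) (hP : ∀ m a, P m a → P m (fun x ξ => c * a x ξ))
    (h : SymD ρ δ P s A r m a) : SymD ρ δ P s A r m (fun x ξ => c * a x ξ) := by
  induction s generalizing A r m a with
  | zero => exact hP _ _ h
  | succ s ih =>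
    refine ⟨hP _ _ h.1, fun hA j => ⟨fun x => (((h.2.1 hA j).1 x).const_mul c).1, ?_⟩,
      fun hr i => ⟨fun ξ => (((h.2.2 hr i).1 ξ).const_mul c).1, ?_⟩⟩
    · have : pxi j (fun x ξ => c * a x ξ) = fun x ξ => c * pxi j a x ξ := by
        funext x ξ
        exact congrFun (((h.2.1 hA j).1 x).const_mul c).2 ξ
      rw [this]
      exact ih (h.2.1 hA j).2
    · have : px i (fun x ξ => c * a x ξ) = fun x ξ => c * px i a x ξ := by
        funext x ξ
        exact congrFun (((h.2.2 hr i).1 ξ).const_mul c).2 x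
      rw [this]
      exact ih (h.2.2 hr i).2

theorem mul (hadd : ∀ m a b, P'' m a → P'' m b → P'' m (fun x ξ => a x ξ + b x ξ))
    (hP : ∀ m m' a b, P m a → P' m' b → P'' (m + m') (fun x ξ => a x ξ * b x ξ))
    (h : SymD ρ δ P s A r m a) (h' : SymD ρ δ P' s A r m' b) :
    SymD ρ δ P'' s A r (m + m') (fun x ξ => a x ξ * b x ξ) := by
  induction s generalizing A r m m' a b with
  | zero => exact hP _ _ _ _ h h'
  | succ s ih =>
    refine ⟨hP _ _ _ _ h.1 h'.1, fun hA j => ⟨fun x =>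
      (((h.2.1 hA j).1 x).mul ((h'.2.1 hA j).1 x)).1, ?_⟩,
      fun hr i => ⟨fun ξ => (((h.2.2 hr i).1 ξ).mul ((h'.2.2 hr i).1 ξ)).1, ?_⟩⟩
    · have : pxi j (fun x ξ => a x ξ * b x ξ) =
          fun x ξ => pxi j a x ξ * b x ξ + a x ξ * pxi j b x ξ := by
        funext x ξ
        exact congrFun (((h.2.1 hA j).1 x).mul ((h'.2.1 hA j).1 x)).2 ξ
      rw [this]
      have e1 := ih (h.2.1 hA j).2 (h'.pred.of_le tsub_le_self le_rfl)
      have e2 := ih (h.pred.of_le tsub_le_self le_rfl) (h'.2.1 hA j).2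
      rw [show m - ρ + m' = m + m' - ρ by ring] at e1
      rw [show m + (m' - ρ) = m + m' - ρ by ring] at e2
      exact e1.add hadd e2
    · rw [Amp.px_mul (h.2.2 hr i).1 (h'.2.2 hr i).1]
      have e1 := ih (h.2.2 hr i).2 (h'.pred.of_le le_rfl tsub_le_self)
      have e2 := ih (h.pred.of_le le_rfl tsub_le_self) (h'.2.2 hr i).2
      rw [show m + δ + m' = m + m' + δ by ring] at e1
      rw [show m + (m' + δ) = m + m' + δ by ring] at e2
      exact e1.add hadd e2

/-- At a fixed depth only finitely many derivatives occur, so their constants have a common upper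
bound in a directed index set. The index may be a number or a function of `x` vanishing at infinity.
-/
theorem uniform {κ : Type*} [Preorder κ] [IsDirectedOrder κ] [Nonempty κ]
    {P : κ → ℝ → (E n → E n → ℂ) → Prop}
    (hmono : ∀ c c' m a, c ≤ c' → P c m a → P c' m a)
    (h : SymD ρ δ (fun m a => ∃ c, P c m a) s A r m a) : ∃ c, SymD ρ δ (P c) s A r m a := by
  induction s generalizing A r m a with
  | zero => exact h
  | succ s ih =>
    obtain ⟨c₀, h₀⟩ := h.1
    have h1 : ∃ c, 1 ≤ A → ∀ j, SymD ρ δ (P c) s (A - 1) r (m - ρ) (pxi j a) := by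
      by_cases hA : 1 ≤ A
      · choose c hc using fun j => ih (h.2.1 hA j).2
        obtain ⟨M, hM⟩ := Finite.exists_le c
        exact ⟨M, fun _ j => (hc j).weaken fun m a => hmono _ _ m a (hM j)⟩
      · exact ⟨c₀, fun h => absurd h hA⟩
    have h2 : ∃ c, 1 ≤ r → ∀ i, SymD ρ δ (P c) s A (r - 1) (m + δ) (px i a) := by
      by_cases hr : 1 ≤ r
      · choose c hc using fun i => ih (h.2.2 hr i).2
        obtain ⟨M, hM⟩ := Finite.exists_le c
        exact ⟨M, fun _ i => (hc i).weaken fun m a => hmono _ _ m a (hM i)⟩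
      · exact ⟨c₀, fun h => absurd h hr⟩
    obtain ⟨c₁, h1⟩ := h1
    obtain ⟨c₂, h2⟩ := h2
    obtain ⟨c₃, h03, h13⟩ := exists_ge_ge c₀ c₁
    obtain ⟨c₄, h34, h24⟩ := exists_ge_ge c₃ c₂
    refine ⟨c₄, hmono _ _ _ _ (h03.trans h34) h₀, fun hA j => ⟨(h.2.1 hA j).1, ?_⟩,
      fun hr i => ⟨(h.2.2 hr i).1, ?_⟩⟩
    · exact (h1 hA j).weaken fun m a => hmono _ _ m a (h13.trans h34)
    · exact (h2 hr i).weaken fun m a => hmono _ _ m a h24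

end SymD

namespace Sym

theorem base (h : Sym ρ δ P A r m a) : P m a := (h 0).base

theorem hasPd_xi (h : Sym ρ δ P A r m a) (hA : 1 ≤ A) (j : Fin n) (x : E n) : HasPd j (a x) :=
  ((h 1).2.1 hA j).1 x

theorem hasPd_x (h : Sym ρ δ P A r m a) (hr : 1 ≤ r) (i : Fin n) (ξ : E n) :
    HasPd i (fun x => a x ξ) := ((h 1).2.2 hr i).1 ξ

theorem pxi (h : Sym ρ δ P A r m a) (hA : 1 ≤ A) (j : Fin n) :
    Sym ρ δ P (A - 1) r (m - ρ) (pxi j a) := fun s => ((h (s + 1)).2.1 hA j).2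

theorem px (h : Sym ρ δ P A r m a) (hr : 1 ≤ r) (i : Fin n) :
    Sym ρ δ P A (r - 1) (m + δ) (px i a) := fun s => ((h (s + 1)).2.2 hr i).2

theorem weaken (hP : ∀ m a, P m a → P' m a) (h : Sym ρ δ P A r m a) : Sym ρ δ P' A r m a :=
  fun s => (h s).weaken hP

theorem of_le {A' r' : ℕ∞} (h : Sym ρ δ P A r m a) (hA : A' ≤ A) (hr : r' ≤ r) :
    Sym ρ δ P A' r' m a := fun s => (h s).of_le hA hr

end Sym

/-! ### Multi-index derivatives as iterated operators -/

/-- Passes from single derivatives to multi-index derivatives; `Q k` is to be read as "k further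
derivatives are available". -/
theorem foldr_op {X : Type*} (D : Fin n → X → X) (Q : ℕ → X → Prop)
    (hQ : ∀ k x i, Q (k + 1) x → Q k (D i x)) (α : Fin n → ℕ) (l : List (Fin n)) (k : ℕ) (x : X)
    (h : Q (k + (l.map α).sum) x) : Q k (l.foldr (fun i g => (D i)^[α i] g) x) := by
  have hit : ∀ (i : Fin n) (p k : ℕ) (x : X), Q (k + p) x → Q k ((D i)^[p] x) := by
    intro i p
    induction p with
    | zero => exact fun k x h => h
    | succ p ih =>
        intro k x h
        rw [Function.iterate_succ_apply]
        exact ih k _ (hQ _ _ _ h)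
  induction l generalizing k with
  | nil => simpa using h
  | cons i l ih =>
    rw [List.foldr_cons]
    refine hit i _ _ _ (ih _ ?_)
    simpa [add_assoc] using h

theorem sum_map_finRange (α : Fin n → ℕ) : ((List.finRange n).map α).sum = len α :=
  (Fin.sum_univ_def α).symm

theorem dxi_eq_foldr (α : Fin n → ℕ) (a : E n → E n → ℂ) :
    dxi α a = (List.finRange n).foldr (fun i g => (pxi i)^[α i] g) a := by
  have hit : ∀ (i : Fin n) (p : ℕ) (a : E n → E n → ℂ),
      (pxi i)^[p] a = fun x => (pd i)^[p] (a x) := by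
    intro i p
    induction p with
    | zero => exact fun a => rfl
    | succ p ih =>
        intro a
        rw [Function.iterate_succ_apply, ih]
        rfl
  have : ∀ l : List (Fin n), l.foldr (fun i g => (pxi i)^[α i] g) a =
      fun x => l.foldr (fun i g => (pd i)^[α i] g) (a x) := by
    intro l
    induction l with
    | nil => rfl
    | cons i l ih => rw [List.foldr_cons, ih, hit]; rfl
  rw [this]
  rfl

theorem dx_eq_flip (β : Fin n → ℕ) (a : E n → E n → ℂ) :
    dx β a = flip (dxi β (flip a)) := rfl

theorem dx_eq_foldr (β : Fin n → ℕ) (a : E n → E n → ℂ) :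
    dx β a = (List.finRange n).foldr (fun i g => (px i)^[β i] g) a := by
  rw [dx_eq_flip, dxi_eq_foldr]
  have hit : ∀ (i : Fin n) (p : ℕ) (a : E n → E n → ℂ),
      flip ((pxi i)^[p] a) = (px i)^[p] (flip a) := by
    intro i p
    induction p with
    | zero => exact fun a => rfl
    | succ p ih =>
        intro a
        rw [Function.iterate_succ_apply, ih, Function.iterate_succ_apply]
        rfl
  have : ∀ l : List (Fin n), flip (l.foldr (fun i g => (pxi i)^[β i] g) (flip a)) =
      l.foldr (fun i g => (px i)^[β i] g) a := by
    intro l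
    induction l with
    | nil => rfl
    | cons i l ih => rw [List.foldr_cons, hit, ih]; rfl
  rw [this]

theorem Sym.dxi {α : Fin n → ℕ} (h : Sym ρ δ P A r m a) (hα : (len α : ℕ∞) ≤ A) :
    Sym ρ δ P (A - len α) r (m - ρ * len α) (dxi α a) := by
  rw [dxi_eq_foldr]
  -- Invariant: with `k` derivatives still to come, `len α - k` have been taken. The condition `k ≤
  -- len α` prevents truncation in this subtraction.
  have := foldr_op (NonsmoothPDO.pxi (n := n)) (fun k b => k ≤ len α ∧
    Sym ρ δ P (A - (len α - k : ℕ)) r (m - ρ * (len α - k : ℕ)) b) (fun k b i hb => by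
      obtain ⟨hk, hb⟩ := hb
      have e1 : len α - k = (len α - (k + 1)) + 1 := by omega
      refine ⟨by omega, ?_⟩
      have h1 := hb.pxi (j := i) (by
        refine ENat.le_sub_of_add_le_left (ENat.natCast_ne_top _) (le_trans ?_ hα)
        exact_mod_cast (by omega : (len α - (k + 1)) + 1 ≤ len α))
      rw [e1]
      convert h1 using 1
      · push_cast; rw [tsub_tsub]
      · push_cast; ring) α (List.finRange n) 0 a (by
      rw [sum_map_finRange]
      simpa using h)
  simpa using this.2

theorem Sym.dx {β : Fin n → ℕ} (h : Sym ρ δ P A r m a) (hβ : (len β : ℕ∞) ≤ r) :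
    Sym ρ δ P A (r - len β) (m + δ * len β) (dx β a) := by
  rw [dx_eq_foldr]
  have := foldr_op (NonsmoothPDO.px (n := n)) (fun k b => k ≤ len β ∧
    Sym ρ δ P A (r - (len β - k : ℕ)) (m + δ * (len β - k : ℕ)) b) (fun k b i hb => by
      obtain ⟨hk, hb⟩ := hb
      have e1 : len β - k = (len β - (k + 1)) + 1 := by omega
      refine ⟨by omega, ?_⟩
      have h1 := hb.px (i := i) (by
        refine ENat.le_sub_of_add_le_left (ENat.natCast_ne_top _) (le_trans ?_ hβ)
        exact_mod_cast (by omega : (len β - (k + 1)) + 1 ≤ len β))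
      rw [e1]
      convert h1 using 1
      · push_cast; rw [tsub_tsub]
      · push_cast; ring) β (List.finRange n) 0 a (by
      rw [sum_map_finRange]
      simpa using h)
  simpa using this.2

end NonsmoothPDO

namespace NonsmoothPDO

variable {n : ℕ}

/-! ### The basic seminorm conditions -/

def PWc (c : E n → ℝ) (m : ℝ) (a : E n → E n → ℂ) : Prop :=
  Continuous (Function.uncurry a) ∧ ∀ x ξ, ‖a x ξ‖ ≤ c x * jap ξ ^ m

/-- Continuity and the symbol bound `O(⟨ξ⟩^m)`. -/
def PS (m : ℝ) (a : E n → E n → ℂ) : Prop := ∃ c : ℝ≥0, PWc (fun _ => c) m a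

/-- Continuity and a symbol bound which vanishes as `|x| → ∞`. -/
def PV (m : ℝ) (a : E n → E n → ℂ) : Prop := ∃ c : {c : E n → ℝ // BoundedVanishing c}, PWc c.1 m a

def PHc (δ τ : ℝ) (c : ℝ≥0) (m : ℝ) (a : E n → E n → ℂ) : Prop :=
  PWc (fun _ => c) m a ∧
    ∀ x x' ξ, ‖a x ξ - a x' ξ‖ ≤ c * (jap ξ ^ (m + δ * τ) * ‖x - x'‖ ^ τ)

/-- Continuity, the symbol bound, and the Hölder bound in `x`. -/
def PH (δ τ : ℝ) (m : ℝ) (a : E n → E n → ℂ) : Prop := ∃ c : ℝ≥0, PHc δ τ c m a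

variable {ρ δ τ : ℝ} {s : ℕ} {A r : ℕ∞} {m m' : ℝ} {a b : E n → E n → ℂ}

theorem PWc.mono {c c' : E n → ℝ} (h : PWc c m a) (hc : ∀ x, c x ≤ c' x) : PWc c' m a :=
  ⟨h.1, fun x ξ => (h.2 x ξ).trans (mul_le_mul_of_nonneg_right (hc x) (jap_rpow_pos ξ m).le)⟩

theorem PWc.nonneg {c : E n → ℝ} (h : PWc c m a) (x : E n) : 0 ≤ c x := by
  have := (norm_nonneg _).trans (h.2 x 0)
  exact nonneg_of_mul_nonneg_left this (jap_rpow_pos _ _)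

theorem PWc.mono_order {c : E n → ℝ} (hm : m ≤ m') (h : PWc c m a) : PWc c m' a :=
  ⟨h.1, fun x ξ => (h.2 x ξ).trans (mul_le_mul_of_nonneg_left (jap_rpow_mono ξ hm) (h.nonneg x))⟩

theorem PWc.add {c c' : E n → ℝ} (h : PWc c m a) (h' : PWc c' m b) :
    PWc (fun x => c x + c' x) m (fun x ξ => a x ξ + b x ξ) :=
  ⟨h.1.add h'.1, fun x ξ => (norm_add_le _ _).trans (by rw [add_mul]; exact add_le_add (h.2 x ξ) (h'.2 x ξ))⟩

theorem PWc.mul {c c' : E n → ℝ} (h : PWc c m a) (h' : PWc c' m' b) :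
    PWc (fun x => c x * c' x) (m + m') (fun x ξ => a x ξ * b x ξ) :=
  ⟨h.1.mul h'.1, fun x ξ => by
    rw [norm_mul, Real.rpow_add (jap_pos ξ), mul_mul_mul_comm]
    exact mul_le_mul (h.2 x ξ) (h'.2 x ξ) (norm_nonneg _) ((norm_nonneg _).trans (h.2 x ξ))⟩

theorem PWc.const_mul {c : E n → ℝ} (h : PWc c m a) (k : ℂ) :
    PWc (fun x => ‖k‖ * c x) m (fun x ξ => k * a x ξ) :=
  ⟨continuous_const.mul h.1, fun x ξ => by
    rw [norm_mul, mul_assoc]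
    exact mul_le_mul_of_nonneg_left (h.2 x ξ) (norm_nonneg k)⟩

theorem PHc.mono {c c' : ℝ≥0} (hc : c ≤ c') (h : PHc δ τ c m a) : PHc δ τ c' m a :=
  ⟨h.1.mono fun _ => by exact_mod_cast hc, fun x x' ξ => (h.2 x x' ξ).trans
    (mul_le_mul_of_nonneg_right (by exact_mod_cast hc)
      (mul_nonneg (jap_rpow_pos _ _).le (Real.rpow_nonneg (norm_nonneg _) _)))⟩

theorem PH.mono_order (m m' : ℝ) (a : E n → E n → ℂ) (hm : m ≤ m') (h : PH δ τ m a) :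
    PH δ τ m' a := by
  obtain ⟨c, h⟩ := h
  refine ⟨c, h.1.mono_order hm, fun x x' ξ => (h.2 x x' ξ).trans ?_⟩
  have : jap ξ ^ (m + δ * τ) ≤ jap ξ ^ (m' + δ * τ) := jap_rpow_mono ξ (by linarith)
  gcongr

theorem PH.add (m : ℝ) (a b : E n → E n → ℂ) (h : PH δ τ m a) (h' : PH δ τ m b) :
    PH δ τ m (fun x ξ => a x ξ + b x ξ) := by
  obtain ⟨c, h⟩ := h
  obtain ⟨c', h'⟩ := h'
  refine ⟨c + c', by simpa using! h.1.add h'.1, fun x x' ξ => ?_⟩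
  rw [add_sub_add_comm, NNReal.coe_add, add_mul]
  exact (norm_add_le _ _).trans (add_le_add (h.2 x x' ξ) (h'.2 x x' ξ))

theorem PH.const_mul (k : ℂ) (m : ℝ) (a : E n → E n → ℂ) (h : PH δ τ m a) :
    PH δ τ m (fun x ξ => k * a x ξ) := by
  obtain ⟨c, h⟩ := h
  refine ⟨‖k‖₊ * c, by simpa using! h.1.const_mul k, fun x x' ξ => ?_⟩
  rw [← mul_sub, norm_mul, NNReal.coe_mul, mul_assoc]
  exact mul_le_mul_of_nonneg_left (h.2 x x' ξ) (norm_nonneg k)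

theorem PH.mul (m m' : ℝ) (a b : E n → E n → ℂ) (h : PH δ τ m a) (h' : PH δ τ m' b) :
    PH δ τ (m + m') (fun x ξ => a x ξ * b x ξ) := by
  obtain ⟨c, h⟩ := h
  obtain ⟨c', h'⟩ := h'
  refine ⟨c * c' + c * c', (h.1.mul h'.1).mono fun x => by simpa using by positivity,
    fun x x' ξ => ?_⟩
  have e : a x ξ * b x ξ - a x' ξ * b x' ξ =
      (a x ξ - a x' ξ) * b x ξ + a x' ξ * (b x ξ - b x' ξ) := by ring
  rw [e]
  refine (norm_add_le _ _).trans ?_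
  rw [norm_mul, norm_mul]
  have h1 := mul_le_mul (h.2 x x' ξ) (h'.1.2 x ξ) (norm_nonneg _) ((norm_nonneg _).trans (h.2 x x' ξ))
  have h2 := mul_le_mul (h.1.2 x' ξ) (h'.2 x x' ξ) (norm_nonneg _)
    ((norm_nonneg _).trans (h.1.2 x' ξ))
  refine (add_le_add h1 h2).trans (le_of_eq ?_)
  rw [show m + m' + δ * τ = m + δ * τ + m' by ring, Real.rpow_add (jap_pos ξ) (m + δ * τ) m',
    Real.rpow_add (jap_pos ξ) m', Real.rpow_add (jap_pos ξ) m]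
  push_cast
  ring

theorem BoundedVanishing.const_mul {c : E n → ℝ} (h : BoundedVanishing c) (k : ℝ) :
    BoundedVanishing fun x => k * c x := by
  obtain ⟨⟨B, hB⟩, h⟩ := h
  refine ⟨⟨|k| * B, fun x => ?_⟩, by simpa using h.const_mul k⟩
  rw [abs_mul]
  exact mul_le_mul_of_nonneg_left (hB x) (abs_nonneg k)

theorem BoundedVanishing.add {c c' : E n → ℝ} (h : BoundedVanishing c) (h' : BoundedVanishing c') :
    BoundedVanishing fun x => c x + c' x := by
  obtain ⟨⟨B, hB⟩, h⟩ := h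
  obtain ⟨⟨B', hB'⟩, h'⟩ := h'
  exact ⟨⟨B + B', fun x => (abs_add_le _ _).trans (add_le_add (hB x) (hB' x))⟩,
    by simpa using h.add h'⟩

theorem PV.add (m : ℝ) (a b : E n → E n → ℂ) (h : PV m a) (h' : PV m b) :
    PV m (fun x ξ => a x ξ + b x ξ) := by
  obtain ⟨c, h⟩ := h
  obtain ⟨c', h'⟩ := h'
  exact ⟨⟨_, c.2.add c'.2⟩, h.add h'⟩

theorem PV.const_mul (k : ℂ) (m : ℝ) (a : E n → E n → ℂ) (h : PV m a) :
    PV m (fun x ξ => k * a x ξ) := by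
  obtain ⟨c, h⟩ := h
  exact ⟨⟨_, c.2.const_mul ‖k‖⟩, h.const_mul k⟩

theorem PH.toPS {m : ℝ} {a : E n → E n → ℂ} (h : PH δ τ m a) : PS m a := h.imp fun _ h => h.1

theorem PV.toPS {m : ℝ} {a : E n → E n → ℂ} (h : PV m a) : PS m a := by
  obtain ⟨c, h⟩ := h
  obtain ⟨B, hB⟩ := c.2.1
  have hB0 : 0 ≤ B := (abs_nonneg _).trans (hB 0)
  exact ⟨⟨B, hB0⟩, h.mono fun x => (le_abs_self _).trans (hB x)⟩

instance : Nonempty {c : E n → ℝ // BoundedVanishing c} :=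
  ⟨⟨fun _ => 0, ⟨0, fun _ => by simp⟩, tendsto_const_nhds⟩⟩

instance : IsDirectedOrder {c : E n → ℝ // BoundedVanishing c} where
  directed c c' := by
    refine ⟨⟨fun x => max (c.1 x) (c'.1 x), ?_, ?_⟩, fun x => le_max_left _ _,
      fun x => le_max_right _ _⟩
    · obtain ⟨B, hB⟩ := c.2.1
      obtain ⟨B', hB'⟩ := c'.2.1
      exact ⟨max B B', fun x => abs_max_le_max_abs_abs.trans (max_le_max (hB x) (hB' x))⟩
    · simpa using c.2.2.max c'.2.2

theorem SymD.uniform_PS (h : SymD ρ δ PS s A r m a) :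
    ∃ c : ℝ≥0, SymD ρ δ (PWc fun _ => (c : ℝ)) s A r m a :=
  SymD.uniform (P := fun c : ℝ≥0 => PWc fun _ => (c : ℝ))
    (fun _ _ _ _ hc h => h.mono fun _ => by exact_mod_cast hc) h

theorem SymD.uniform_PH (h : SymD ρ δ (PH δ τ) s A r m a) :
    ∃ c : ℝ≥0, SymD ρ δ (PHc δ τ c) s A r m a :=
  SymD.uniform (P := PHc δ τ) (fun _ _ _ _ hc h => h.mono hc) h

theorem SymD.uniform_PV (h : SymD ρ δ PV s A r m a) :
    ∃ c : E n → ℝ, BoundedVanishing c ∧ SymD ρ δ (PWc c) s A r m a := by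
  obtain ⟨c, h⟩ := SymD.uniform (P := fun c : {c : E n → ℝ // BoundedVanishing c} => PWc c.1)
    (fun _ _ _ _ hc h => h.mono hc) h
  exact ⟨c.1, c.2, h⟩

/-! ### Regularity in one variable -/

theorem PWc.continuous_xi {c : E n → ℝ} (h : PWc c m a) (x : E n) : Continuous (a x) :=
  h.1.comp (by fun_prop : Continuous fun ξ : E n => (x, ξ))

theorem PWc.continuous_x {c : E n → ℝ} (h : PWc c m a) (ξ : E n) : Continuous (fun x => a x ξ) :=
  h.1.comp (by fun_prop : Continuous fun x : E n => (x, ξ))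

theorem pred_le_pred {N : ℕ} {A : ℕ∞} (h : ((N + 1 : ℕ) : ℕ∞) ≤ A) : (N : ℕ∞) ≤ A - 1 :=
  ENat.le_sub_of_add_le_left (by simp) (by rw [add_comm]; exact_mod_cast h)

theorem one_le_of_succ_le {N : ℕ} {A : ℕ∞} (h : ((N + 1 : ℕ) : ℕ∞) ≤ A) : 1 ≤ A :=
  le_trans (by exact_mod_cast Nat.le_add_left 1 N) h

theorem SymD.regV_xi {c : E n → ℝ} {N : ℕ} (h : SymD ρ δ (PWc c) N A r m a) (hN : (N : ℕ∞) ≤ A)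
    (x : E n) : RegV (fun ζ => jap ζ ^ (-ρ)) N (fun ζ => c x * jap ζ ^ m) (a x) := by
  induction N generalizing A m a with
  | zero => exact ⟨PWc.continuous_xi h x, h.2 x⟩
  | succ N ih =>
    refine ⟨⟨h.1.continuous_xi x, h.1.2 x⟩, fun j => ?_⟩
    have h1 := h.2.1 (one_le_of_succ_le hN) j
    refine ⟨h1.1 x, (ih h1.2 (pred_le_pred hN)).mono_weight (fun ζ => (jap_rpow_pos ζ _).le)
      fun ζ => le_of_eq ?_⟩
    rw [sub_eq_neg_add, Real.rpow_add (jap_pos ζ)]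
    ring

theorem SymD.regV_x {c : E n → ℝ} {N : ℕ} (h : SymD ρ δ (PWc c) N A r m a) (hN : (N : ℕ∞) ≤ r)
    (ξ : E n) : RegV (fun _ => jap ξ ^ δ) N (fun x => c x * jap ξ ^ m) (fun x => a x ξ) := by
  induction N generalizing r m a with
  | zero => exact ⟨PWc.continuous_x h ξ, fun x => h.2 x ξ⟩
  | succ N ih =>
    refine ⟨⟨h.1.continuous_x ξ, fun x => h.1.2 x ξ⟩, fun j => ?_⟩
    have h1 := h.2.2 (one_le_of_succ_le hN) j
    refine ⟨h1.1 ξ, (ih h1.2 (pred_le_pred hN)).mono_weight (fun ζ => (jap_rpow_pos ξ _).le)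
      fun ζ => le_of_eq ?_⟩
    rw [Real.rpow_add (jap_pos ξ)]
    ring

/-- Prepares the Hölder estimate: with its constant carrying `‖x - x'‖ ^ τ`, the increment is an
admissible first factor in `osc_estimate`, of order `m + δ * τ`. -/
theorem SymD.regV_sub_xi {c : ℝ≥0} {N : ℕ} (h : SymD ρ δ (PHc δ τ c) N A r m a)
    (hN : (N : ℕ∞) ≤ A) (x x' : E n) : RegV (fun ζ => jap ζ ^ (-ρ)) N
      (fun ζ => (c * ‖x - x'‖ ^ τ) * jap ζ ^ (m + δ * τ)) (fun ξ => a x ξ - a x' ξ) := by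
  have hb : ∀ {m a}, PHc δ τ c m a → Continuous (fun ξ => a x ξ - a x' ξ) ∧
      ∀ ζ, ‖a x ζ - a x' ζ‖ ≤ (c * ‖x - x'‖ ^ τ) * jap ζ ^ (m + δ * τ) := fun h =>
    ⟨(h.1.continuous_xi x).sub (h.1.continuous_xi x'), fun ζ => (h.2 x x' ζ).trans
      (le_of_eq (by ring))⟩
  induction N generalizing A m a with
  | zero => exact hb h
  | succ N ih =>
    refine ⟨hb h.1, fun j => ?_⟩
    have h1 := h.2.1 (one_le_of_succ_le hN) j
    have h2 := (h1.1 x).sub (h1.1 x')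
    refine ⟨h2.1, ?_⟩
    rw [h2.2]
    refine (ih h1.2 (pred_le_pred hN)).mono_weight (fun ζ => (jap_rpow_pos ζ _).le)
      fun ζ => le_of_eq ?_
    rw [show m - ρ + δ * τ = -ρ + (m + δ * τ) by ring, Real.rpow_add (jap_pos ζ)]
    ring

theorem SymD.regV_sub_x {c : ℝ≥0} {N : ℕ} (h : SymD ρ δ (PHc δ τ c) N A r m a)
    (hN : (N : ℕ∞) ≤ r) (x x' ξ : E n) : RegV (fun _ => jap ξ ^ δ) N
      (fun _ => c * (jap ξ ^ (m + δ * τ) * ‖x - x'‖ ^ τ))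
      (fun z => a (x + z) ξ - a (x' + z) ξ) := by
  have hb : ∀ {m a}, PHc δ τ c m a → Continuous (fun z => a (x + z) ξ - a (x' + z) ξ) ∧
      ∀ z, ‖a (x + z) ξ - a (x' + z) ξ‖ ≤ c * (jap ξ ^ (m + δ * τ) * ‖x - x'‖ ^ τ) := fun h =>
    ⟨((h.1.continuous_x ξ).comp (by fun_prop)).sub ((h.1.continuous_x ξ).comp (by fun_prop)),
      fun z => by simpa using h.2 (x + z) (x' + z) ξ⟩
  induction N generalizing r m a with
  | zero => exact hb h
  | succ N ih =>
    refine ⟨hb h.1, fun j => ?_⟩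
    have h1 := h.2.2 (one_le_of_succ_le hN) j
    have e := fun x => (h1.1 ξ).comp_affine x 1
    simp only [one_smul, Complex.ofReal_one, one_mul] at e
    have h2 := (e x).1.sub (e x').1
    refine ⟨h2.1, ?_⟩
    rw [h2.2, (e x).2, (e x').2]
    refine (ih h1.2 (pred_le_pred hN)).mono_weight (fun ζ => (jap_rpow_pos ξ _).le)
      fun ζ => le_of_eq ?_
    rw [show m + δ + δ * τ = δ + (m + δ * τ) by ring, Real.rpow_add (jap_pos ξ)]
    ring

theorem lipschitz_of_pd {f : E n → ℂ} {b : ℝ} (hf : ∀ i, HasPd i f) (hc : ∀ i, Continuous (pd i f))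
    (hb : ∀ i x, ‖pd i f x‖ ≤ b) (x x' : E n) : ‖f x - f x'‖ ≤ n * b * ‖x - x'‖ := by
  refine Convex.norm_image_sub_le_of_norm_hasFDerivWithin_le (s := Set.univ) (𝕜 := ℝ)
    (fun z _ => (hasFDerivAt_of_continuous_pd hf hc z).hasFDerivWithinAt) (fun z _ => ?_)
    convex_univ (Set.mem_univ _) (Set.mem_univ _)
  refine (norm_sum_le _ _).trans ?_
  have h1 : ∀ i : Fin n, ‖(EuclideanSpace.proj (𝕜 := ℝ) i : E n →L[ℝ] ℝ).smulRight (pd i f z)‖ ≤ b := by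
    intro i
    rw [ContinuousLinearMap.norm_smulRight_apply]
    have h2 : ‖(EuclideanSpace.proj (𝕜 := ℝ) i : E n →L[ℝ] ℝ)‖ ≤ 1 :=
      ContinuousLinearMap.opNorm_le_bound _ zero_le_one fun v => by
        simpa using PiLp.norm_apply_le v i
    calc _ ≤ 1 * b := mul_le_mul h2 (hb i z) (norm_nonneg _) zero_le_one
      _ = b := one_mul b
  simpa using Finset.sum_le_card_nsmul Finset.univ _ b fun i _ => h1 i

theorem min_le_rpow {t τ : ℝ} (ht : 0 ≤ t) (hτ0 : 0 ≤ τ) (hτ : τ ≤ 1) : min 1 t ≤ t ^ τ := by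
  rcases le_total 1 t with h | h
  · rw [min_eq_left h]; exact Real.one_le_rpow h hτ0
  · rw [min_eq_right h]
    rcases ht.eq_or_lt with h0 | h0
    · rw [← h0]; exact Real.rpow_nonneg le_rfl _
    · simpa using Real.rpow_le_rpow_of_exponent_ge h0 h hτ

theorem holder_of_lipschitz {u v : ℂ} {C M t τ : ℝ} (hτ0 : 0 ≤ τ) (hτ : τ ≤ 1)
    (hM : 0 ≤ C * M) (ht : 0 ≤ t)
    (hu : ‖u‖ ≤ C * M) (hv : ‖v‖ ≤ C * M) (h : ‖u - v‖ ≤ C * M * t) :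
    ‖u - v‖ ≤ 2 * C * M * t ^ τ := by
  have h1 : ‖u - v‖ ≤ 2 * (C * M) * min 1 t := by
    rcases min_choice 1 t with h2 | h2 <;> rw [h2]
    · linarith [norm_sub_le u v]
    · nlinarith [mul_nonneg hM ht]
  calc _ ≤ 2 * (C * M) * min 1 t := h1
    _ ≤ 2 * (C * M) * t ^ τ := mul_le_mul_of_nonneg_left (min_le_rpow ht hτ0 hτ) (by positivity)
    _ = _ := by ring

/-- At the length scale ⟨ξ⟩^{-δ} the increment is bounded both by a constant and by t = ⟨ξ⟩^δ‖x -
x'‖, and min(1, t) ≤ t^τ. -/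
theorem PS.toPH (hτ0 : 0 ≤ τ) (hτ : τ ≤ 1) (h : PS m a)
    (h' : ∀ i, (∀ ξ, HasPd i (fun x => a x ξ)) ∧ PS (m + δ) (px i a)) : PH δ τ m a := by
  obtain ⟨c, h⟩ := h
  choose hp c' h' using h'
  obtain ⟨M, hM⟩ := Finite.exists_le c'
  set C : ℝ≥0 := c + n * M with hC
  have hC1 : (c : ℝ) ≤ C := by rw [hC]; push_cast; linarith [mul_nonneg (Nat.cast_nonneg n : (0:ℝ) ≤ n) M.coe_nonneg]
  have hC2 : (n : ℝ) * M ≤ C := by rw [hC]; push_cast; linarith [c.coe_nonneg]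
  refine ⟨2 * C, h.mono fun _ => ?_, fun x x' ξ => ?_⟩
  · push_cast; linarith [C.coe_nonneg]
  have hj := jap_rpow_pos ξ m
  have hlam := jap_rpow_pos ξ δ
  have hb : ∀ x, ‖a x ξ‖ ≤ C * jap ξ ^ m := fun x => (h.2 x ξ).trans (by gcongr)
  have hl := lipschitz_of_pd (f := fun x => a x ξ) (b := M * jap ξ ^ (m + δ)) (fun i => hp i ξ)
    (fun i => (h' i).continuous_x ξ) (fun i x => ((h' i).2 x ξ).trans (by
      have := hM i
      have : (c' i : ℝ) ≤ M := by exact_mod_cast this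
      have := (jap_rpow_pos ξ (m + δ)).le
      gcongr)) x x'
  have h1 := holder_of_lipschitz (u := a x ξ) (v := a x' ξ) (t := jap ξ ^ δ * ‖x - x'‖) hτ0 hτ
    (by positivity) (by positivity) (hb x) (hb x') (hl.trans (by
      rw [Real.rpow_add (jap_pos ξ)]
      calc _ = (n * M) * (jap ξ ^ m * (jap ξ ^ δ * ‖x - x'‖)) := by ring
        _ ≤ C * (jap ξ ^ m * (jap ξ ^ δ * ‖x - x'‖)) := by gcongr
        _ = _ := by ring))
  refine h1.trans (le_of_eq ?_)
  rw [Real.mul_rpow hlam.le (norm_nonneg _), ← Real.rpow_mul (jap_pos ξ).le,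
    Real.rpow_add (jap_pos ξ)]
  push_cast
  ring

theorem Sym.toPH (hτ0 : 0 ≤ τ) (hτ : τ ≤ 1) (h : Sym ρ δ PS A ⊤ m a) :
    Sym ρ δ (PH δ τ) A ⊤ m a := by
  have hb : ∀ {A : ℕ∞} {m : ℝ} {a : E n → E n → ℂ}, Sym ρ δ PS A ⊤ m a → PH δ τ m a := fun h =>
    h.base.toPH hτ0 hτ fun i => ⟨fun ξ => h.hasPd_x le_top i ξ, (h.px le_top i).base⟩
  intro s
  induction s generalizing A m a with
  | zero => exact hb h
  | succ s ih =>
    exact ⟨hb h, fun hA j => ⟨fun x => h.hasPd_xi hA j x, ih (h.pxi hA j)⟩,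
      fun hr i => ⟨fun ξ => h.hasPd_x hr i ξ, ih (h.px hr i)⟩⟩

end NonsmoothPDO

namespace NonsmoothPDO

variable {n : ℕ}

/-! ### Oscillatory integrals of symbols: estimates -/

/-- The amplitude `(y, η) ↦ h(x, ξ + θη) g(x + y, ξ)`. -/
def tens (θ : ℝ) (h g : E n → E n → ℂ) (x ξ : E n) : E n → E n → ℂ :=
  fun y η => h x (ξ + θ • η) * g (x + y) ξ

noncomputable def osc (θ : ℝ) (h g : E n → E n → ℂ) : E n → E n → ℂ :=
  fun x ξ => oscInt (tens θ h g x ξ)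

variable {ρ δ τ : ℝ} {A r A' r' : ℕ∞} {m m' : ℝ} {h g : E n → E n → ℂ}

noncomputable def jkInt (n : ℕ) : ℝ := ∫ η : E n, jk η

theorem jkInt_nonneg : 0 ≤ jkInt n := integral_nonneg fun η => (jk_pos η).le

theorem osc_PS (hδ : 0 ≤ δ) (hδρ : δ < ρ) (hρ : ρ ≤ 1) (hA : ((n + 1 : ℕ) : ℕ∞) ≤ A)
    (hh : Sym ρ δ PS A r m h) (hg : Sym ρ δ PS A' ⊤ m' g) :
    ∃ C : ℝ, 0 ≤ C ∧ ∀ θ ∈ Set.Icc (0 : ℝ) 1, ∀ x ξ,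
      HasOscInt (tens θ h g x ξ) (osc θ h g x ξ) ∧ ‖osc θ h g x ξ‖ ≤ C * jap ξ ^ (m + m') := by
  obtain ⟨B, C, hC, hest⟩ := osc_estimate (n := n) m hδ hδρ hρ
  obtain ⟨c, hc⟩ := (hh (n + 1)).uniform_PS
  obtain ⟨c', hc'⟩ := (hg B).uniform_PS
  have := jkInt_nonneg (n := n)
  refine ⟨C * (c * c' * jkInt n), by positivity, fun θ hθ x ξ => ?_⟩
  obtain ⟨I, hI, hb⟩ := hest (h x) (fun x => g x ξ) c (c' * jap ξ ^ m') θ x ξ _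
    (fun _ => c' * jap ξ ^ m') c.coe_nonneg hθ (hc.regV_xi hA x) (hc'.regV_x le_top ξ)
    (fun _ => le_rfl) (fun _ => le_rfl) (integrable_jk.const_mul _)
  have e : osc θ h g x ξ = I := hI.oscInt_eq
  rw [e]
  refine ⟨hI, hb.trans (le_of_eq ?_)⟩
  rw [integral_const_mul, Real.rpow_add (jap_pos ξ), jkInt]
  ring

/-- The increment is the sum of the oscillatory integrals with factors h(x,·) - h(x',·), g(x + ·)
and h(x',·), g(x + ·) - g(x' + ·). In the first the extra order δτ sits on `h`, in the second on
`g`, and `osc_estimate` applies to both. -/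
theorem osc_PH (hδ : 0 ≤ δ) (hδρ : δ < ρ) (hρ : ρ ≤ 1) (hτ0 : 0 ≤ τ) (hτ : τ ≤ 1)
    (hA : ((n + 1 : ℕ) : ℕ∞) ≤ A)
    (hh : Sym ρ δ (PH δ τ) A r m h) (hg : Sym ρ δ PS A' ⊤ m' g) :
    ∃ C : ℝ, 0 ≤ C ∧ ∀ θ ∈ Set.Icc (0 : ℝ) 1, ∀ x x' ξ,
      ‖osc θ h g x ξ - osc θ h g x' ξ‖ ≤ C * (jap ξ ^ (m + m' + δ * τ) * ‖x - x'‖ ^ τ) := by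
  obtain ⟨B, C, hC, hest⟩ := osc_estimate (n := n) m hδ hδρ hρ
  obtain ⟨B₂, C₂, hC₂, hest₂⟩ := osc_estimate (n := n) (m + δ * τ) hδ hδρ hρ
  obtain ⟨c, hc⟩ := (hh (n + 1)).uniform_PH
  obtain ⟨c', hc'⟩ := (hg.toPH hτ0 hτ (max B B₂)).uniform_PH
  obtain ⟨_, _, hex⟩ := osc_PS hδ hδρ hρ hA (hh.weaken fun _ _ => PH.toPS) hg
  have := jkInt_nonneg (n := n)
  refine ⟨(C + C₂) * (c * c' * jkInt n), by positivity, fun θ hθ x x' ξ => ?_⟩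
  have hcw := hc.weaken (P' := PWc fun _ => (c : ℝ)) fun _ _ h => h.1
  have hcw' := hc'.weaken (P' := PWc fun _ => (c' : ℝ)) fun _ _ h => h.1
  have hd : 0 ≤ ‖x - x'‖ ^ τ := Real.rpow_nonneg (norm_nonneg _) _
  obtain ⟨I₁, hI₁, hb₁⟩ := hest₂ (fun ζ => h x ζ - h x' ζ) (fun z => g (x + z) ξ)
    (c * ‖x - x'‖ ^ τ) (c' * jap ξ ^ m') θ 0 ξ (fun _ => c' * jap ξ ^ m')
    (fun _ => c' * jap ξ ^ m') (by positivity) hθ (hc.regV_sub_xi hA x x')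
    (by
      have := ((hcw'.of_depth_le (le_max_right B B₂)).regV_x le_top ξ).comp_affine
        (q' := fun _ => jap ξ ^ δ) (V := fun _ => c' * jap ξ ^ m') x 1
        (fun _ => (jap_rpow_pos ξ δ).le) (by simp) (fun _ => le_rfl)
      simpa using this)
    (fun _ => le_rfl) (fun _ => le_rfl) (integrable_jk.const_mul _)
  obtain ⟨I₂, hI₂, hb₂⟩ := hest (h x') (fun z => g (x + z) ξ - g (x' + z) ξ)
    c (c' * (jap ξ ^ (m' + δ * τ) * ‖x - x'‖ ^ τ)) θ 0 ξ _
    (fun _ => c' * (jap ξ ^ (m' + δ * τ) * ‖x - x'‖ ^ τ)) c.coe_nonneg hθ (hcw.regV_xi hA x')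
    ((hc'.of_depth_le (le_max_left B B₂)).regV_sub_x le_top x x' ξ)
    (fun _ => le_rfl) (fun _ => le_rfl) (integrable_jk.const_mul _)
  have e : osc θ h g x ξ - osc θ h g x' ξ = I₁ + I₂ := by
    have h1 := (hex θ hθ x ξ).1.add ((hex θ hθ x' ξ).1.const_mul (-1))
    have h2 := hI₁.add hI₂
    have h3 : (fun y η => tens θ h g x ξ y η + -1 * tens θ h g x' ξ y η) =
        fun y η => (h x (ξ + θ • η) - h x' (ξ + θ • η)) * g (x + (0 + y)) ξ +
          h x' (ξ + θ • η) * (g (x + (0 + y)) ξ - g (x' + (0 + y)) ξ) := by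
      funext y η
      simp only [tens, zero_add]
      ring
    rw [h3] at h1
    rw [← h1.eq h2]
    ring
  rw [e]
  refine (norm_add_le _ _).trans ((add_le_add hb₁ hb₂).trans (le_of_eq ?_))
  rw [integral_const_mul, integral_const_mul, ← jkInt,
    show m + m' + δ * τ = m + δ * τ + m' by ring, Real.rpow_add (jap_pos ξ) (m + δ * τ) m',
    Real.rpow_add (jap_pos ξ) m', Real.rpow_add (jap_pos ξ) m]
  ring

theorem cocompact_eq_comap_norm : cocompact (E n) = comap norm atTop := by
  rw [← Metric.cobounded_eq_cocompact, ← comap_norm_atTop]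

/-- The tail of the kernel weight. -/
theorem tendsto_tail (R₀ : ℝ) : Tendsto (fun x : E n =>
    ∫ y, Set.indicator {y : E n | ‖x‖ - R₀ ≤ ‖y‖} (fun _ => (1 : ℝ)) y * jk y)
    (cocompact (E n)) (𝓝 0) := by
  have h0 : (0 : ℝ) = ∫ _ : E n, (0 : ℝ) := by simp
  rw [h0]
  have : (cocompact (E n)).IsCountablyGenerated := by
    rw [cocompact_eq_comap_norm]
    infer_instance
  refine tendsto_integral_filter_of_dominated_convergence jk (Eventually.of_forall fun x => ?_)
    (Eventually.of_forall fun x => Eventually.of_forall fun y => ?_) integrable_jk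
    (Eventually.of_forall fun y => ?_)
  · refine AEStronglyMeasurable.mul ?_ continuous_jk.aestronglyMeasurable
    exact (aestronglyMeasurable_const.indicator
      (measurableSet_le measurable_const measurable_norm))
  · rw [Real.norm_eq_abs, abs_mul, abs_of_pos (jk_pos y)]
    refine mul_le_of_le_one_left (jk_pos y).le ?_
    rw [Set.indicator_apply]
    split_ifs <;> simp
  · have h1 : ∀ᶠ x : E n in cocompact (E n), ‖y‖ + R₀ < ‖x‖ :=
      (tendsto_norm_cocompact_atTop (E := E n)).eventually_gt_atTop _
    refine tendsto_const_nhds.congr' (h1.mono fun x hx => ?_)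
    dsimp only
    rw [Set.indicator_of_notMem, zero_mul]
    simp only [Set.mem_ofPred_eq, not_le]
    linarith

/-- After dilation `g` is evaluated at x + ⟨ξ⟩^{-δ}y, whose norm is at least ‖x‖ - ‖y‖ because δ ≥
0. For ‖y‖ < ‖x‖ - R₀ the decay function of `g` is at most ε; for other `y` it is merely bounded,
but there the tail of `jk` is small. All of this is uniform in ξ and θ. -/
theorem osc_PV (hδ : 0 ≤ δ) (hδρ : δ < ρ) (hρ : ρ ≤ 1) (hA : ((n + 1 : ℕ) : ℕ∞) ≤ A)
    (hh : Sym ρ δ PS A r m h) (hg : Sym ρ δ PV A' ⊤ m' g) :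
    ∃ c : E n → ℝ, BoundedVanishing c ∧ ∀ θ ∈ Set.Icc (0 : ℝ) 1, ∀ x ξ,
      ‖osc θ h g x ξ‖ ≤ c x * jap ξ ^ (m + m') := by
  obtain ⟨B, C, hC, hest⟩ := osc_estimate (n := n) m hδ hδρ hρ
  obtain ⟨c, hc⟩ := (hh (n + 1)).uniform_PS
  obtain ⟨v, hv, hc'⟩ := (hg B).uniform_PV
  obtain ⟨C₁, hC₁, hex⟩ := osc_PS hδ hδρ hρ hA hh (hg.weaken fun _ _ => PV.toPS)
  obtain ⟨D, hD⟩ := hv.1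
  have hD0 : 0 ≤ D := (abs_nonneg _).trans (hD 0)
  have hJ := jkInt_nonneg (n := n)
  -- The decay function is the optimal one: the supremum of the normalised values over all θ and ξ.
  let S : E n → Set ℝ := fun x =>
    Set.range fun p : Set.Icc (0 : ℝ) 1 × E n => ‖osc p.1 h g x p.2‖ / jap p.2 ^ (m + m')
  have hle : ∀ {x ε}, (∀ θ ∈ Set.Icc (0 : ℝ) 1, ∀ ξ, ‖osc θ h g x ξ‖ ≤ ε * jap ξ ^ (m + m')) →
      ∀ z ∈ S x, z ≤ ε := by
    rintro x ε hx z ⟨p, rfl⟩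
    exact (div_le_iff₀ (jap_rpow_pos _ _)).2 (hx _ p.1.2 _)
  have hne : ∀ x, (S x).Nonempty := fun x => ⟨_, ⟨⟨⟨0, by simp⟩, 0⟩, rfl⟩⟩
  have hnn : ∀ x, 0 ≤ sSup (S x) := fun x => Real.sSup_nonneg (by
    rintro z ⟨p, rfl⟩
    have := jap_rpow_pos p.2 (m + m')
    positivity)
  have hbdd : ∀ x, BddAbove (S x) := fun x => ⟨C₁, hle fun θ hθ ξ => (hex θ hθ x ξ).2⟩
  refine ⟨fun x => sSup (S x), ⟨⟨C₁, fun x => ?_⟩, ?_⟩, fun θ hθ x ξ => ?_⟩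
  · rw [abs_of_nonneg (hnn x)]
    exact csSup_le (hne x) (hle fun θ hθ ξ => (hex θ hθ x ξ).2)
  · have key : ∀ ε > 0, ∀ᶠ x in cocompact (E n), ∀ θ ∈ Set.Icc (0 : ℝ) 1, ∀ ξ,
        ‖osc θ h g x ξ‖ ≤ (C * c * (ε * jkInt n + D * ε)) * jap ξ ^ (m + m') := by
      intro ε hε
      obtain ⟨R₀, hR₀⟩ : ∃ R₀ : ℝ, ∀ z : E n, R₀ < ‖z‖ → v z ≤ ε := by
        have h1 : ∀ᶠ z in cocompact (E n), v z < ε := hv.2.eventually (gt_mem_nhds hε)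
        rw [cocompact_eq_comap_norm, eventually_comap, eventually_atTop] at h1
        obtain ⟨R₀, h2⟩ := h1
        exact ⟨R₀, fun z hz => (h2 _ hz.le z rfl).le⟩
      filter_upwards [(tendsto_tail (n := n) R₀).eventually (ge_mem_nhds hε)] with x hx θ hθ ξ
      set T : E n → ℝ := Set.indicator {y : E n | ‖x‖ - R₀ ≤ ‖y‖} (fun _ => (1 : ℝ)) with hT
      have hT01 : ∀ y, 0 ≤ T y ∧ T y ≤ 1 := fun y => by
        rw [hT, Set.indicator_apply]
        split_ifs <;> simp
      have hTi : Integrable (fun y => T y * jk y) := by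
        refine integrable_jk.mono' (AEStronglyMeasurable.mul ?_ continuous_jk.aestronglyMeasurable)
          (Eventually.of_forall fun y => ?_)
        · exact (aestronglyMeasurable_const.indicator
            (measurableSet_le measurable_const measurable_norm))
        · rw [Real.norm_eq_abs, abs_mul, abs_of_pos (jk_pos y), abs_of_nonneg (hT01 y).1]
          exact mul_le_of_le_one_left (jk_pos y).le (hT01 y).2
      have hj := jap_rpow_pos ξ m'
      have e1 : ∀ y, (jap ξ ^ m' * (ε + D * T y)) * jk y =
          jap ξ ^ m' * (ε * jk y + D * (T y * jk y)) := fun y => by ring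
      have hi : Integrable fun y => ε * jk y + D * (T y * jk y) :=
        (integrable_jk.const_mul ε).add (hTi.const_mul D)
      obtain ⟨I, hI, hb⟩ := hest (h x) (fun x => g x ξ) c (D * jap ξ ^ m') θ x ξ _
        (fun y => jap ξ ^ m' * (ε + D * T y)) c.coe_nonneg hθ (hc.regV_xi hA x)
        (hc'.regV_x le_top ξ)
        (fun y => mul_le_mul_of_nonneg_right ((le_abs_self _).trans (hD y)) hj.le) (fun y => by
          rw [mul_comm]
          refine mul_le_mul_of_nonneg_left ?_ hj.le
          by_cases hy : ‖x‖ - R₀ ≤ ‖y‖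
          · have : T y = 1 := by rw [hT, Set.indicator_of_mem]; exact hy
            rw [this, mul_one]
            linarith [(le_abs_self _).trans (hD (x + (jap ξ ^ δ)⁻¹ • y))]
          · have h3 := hR₀ (x + (jap ξ ^ δ)⁻¹ • y) (by
              have h4 : ‖(jap ξ ^ δ)⁻¹ • y‖ ≤ ‖y‖ := by
                rw [norm_smul, norm_inv, Real.norm_eq_abs, abs_of_pos (jap_rpow_pos ξ δ)]
                exact mul_le_of_le_one_left (norm_nonneg y)
                  (inv_le_one_of_one_le₀ (one_le_jap_rpow ξ hδ))
              have h5 := norm_sub_le (x + (jap ξ ^ δ)⁻¹ • y) ((jap ξ ^ δ)⁻¹ • y)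
              rw [add_sub_cancel_right] at h5
              linarith)
            have := mul_nonneg hD0 (hT01 y).1
            linarith)
        (by
          simp_rw [e1]
          exact hi.const_mul _)
      have e : osc θ h g x ξ = I := hI.oscInt_eq
      rw [e]
      refine hb.trans ?_
      simp_rw [e1]
      rw [integral_const_mul, integral_add (integrable_jk.const_mul ε) (hTi.const_mul D),
        integral_const_mul, integral_const_mul, ← jkInt, Real.rpow_add (jap_pos ξ)]
      have := jap_rpow_pos ξ m
      calc _ = (C * c * (jap ξ ^ m * jap ξ ^ m')) * (ε * jkInt n + D * ∫ y, T y * jk y) := by ring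
        _ ≤ (C * c * (jap ξ ^ m * jap ξ ^ m')) * (ε * jkInt n + D * ε) := by gcongr
        _ = _ := by ring
    rw [Metric.tendsto_nhds]
    intro ε hε
    set Q := C * c * (jkInt n + D) with hQ
    have hQ0 : 0 ≤ Q := by positivity
    -- This choice turns the bound into `ε * (Q / (2 * (Q + 1)))`, which is below `ε` also when `Q =
    -- 0`.
    filter_upwards [key (ε / (2 * (Q + 1))) (by positivity)] with x hx
    rw [Real.dist_eq, sub_zero, abs_of_nonneg (hnn x)]
    refine (csSup_le (hne x) (hle hx)).trans_lt ?_
    have : C * c * (ε / (2 * (Q + 1)) * jkInt n + D * (ε / (2 * (Q + 1)))) =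
        ε * (Q / (2 * (Q + 1))) := by rw [hQ]; ring
    rw [this]
    refine mul_lt_of_lt_one_right hε ?_
    rw [div_lt_one (by positivity)]
    linarith
  · have := le_csSup (hbdd x) ⟨⟨⟨θ, hθ⟩, ξ⟩, rfl⟩
    exact (div_le_iff₀ (jap_rpow_pos _ _)).1 this

end NonsmoothPDO

namespace NonsmoothPDO

variable {n : ℕ}

/-! ### Differentiation under an oscillatory integral -/

/-- The bound is uniform in ε and linear in the amplitude constant; it supplies the dominating
constant when ε → 0 under an integral over a parameter. -/
theorem norm_regularised_le {l : List (Fin n)} {K : ℕ} (hl : Adm l K)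
    (χ : SchwartzMap (E n × E n) ℂ) : ∃ C : ℝ, ∀ (c : ℝ) (F : E n → E n → ℂ),
      Amp (n + 1) l.length (fun _ η => c * (1 + ‖η‖) ^ K) F → ∀ ε ∈ Set.Ioc (0 : ℝ) 1,
        ‖(((2 * Real.pi) ^ n)⁻¹ : ℂ) * ∫ p, oscIntegrand F χ ε p‖ ≤ C * c := by
  obtain ⟨C, hC, h⟩ := amp_chi (n + 1) l.length 0 χ
  have hv : ∀ y η : E n, vk 0 y η = 1 := fun y η => by simp [vk]
  simp only [hv, mul_one] at h
  obtain ⟨C', hC', h'⟩ := bOp_bound l hl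
  refine ⟨C' * (2 ^ (n + 1 + l.length) * C * ∫ η : E n, jk η), fun c F hF ε hε => ?_⟩
  have hc : 0 ≤ c := by simpa using hF.nonneg 0 0
  obtain ⟨c', hi⟩ := amp_chi_mul hF χ hε.1
  have e : (((2 * Real.pi) ^ n)⁻¹ : ℂ) * ∫ p, oscIntegrand F χ ε p =
      bOp l (fun y η => chi χ ε y η * F y η) := by
    rw [oscIntegrand_eq, bOp, integral_ek_prod_eq l (hi.of_le_left (Nat.zero_le _))]
  rw [e]
  refine (h' (fun _ => 2 ^ (n + 1 + l.length) * (C * c)) _ (fun _ => by positivity)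
    (integrable_jk.const_mul _) (((h ε (Set.Ioc_subset_Icc_self hε)).mul hF).mono
      fun y η => le_of_eq (by ring))).trans (le_of_eq ?_)
  rw [integral_const_mul]
  ring

/-- For fixed ε the regularised integral may be differentiated under the integral sign, and its
increment is the integral of its derivative. Passing to the limit in this identity needs only
bounded convergence on an interval, not uniform convergence of derivatives. Continuity of `J` then
gives the derivative of `I`. -/
theorem hasDerivAt_of_hasOscInt {l : List (Fin n)} {K : ℕ} (hl : Adm l K)
    {F G : ℝ → E n → E n → ℂ} {I J : ℝ → ℂ} (hF : ∀ t, HasOscInt (F t) (I t))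
    (hG : ∀ t, HasOscInt (G t) (J t)) (hJ : Continuous J)
    (hd : ∀ y η t, HasDerivAt (fun t => F t y η) (G t y η) t)
    (hGc : Continuous fun p : ℝ × E n × E n => G p.1 p.2.1 p.2.2)
    (hb : ∀ R : ℝ, ∃ c : ℝ, ∀ t, |t| ≤ R →
      Amp (n + 1) l.length (fun _ η => c * (1 + ‖η‖) ^ K) (G t)) (t : ℝ) :
    HasDerivAt I (J t) t := by
  obtain ⟨χ, hχ⟩ := exists_chi_zero_eq_one (n := n)
  set κ : ℂ := ((2 * Real.pi) ^ n)⁻¹ with hκ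
  have hint : ∀ ε t, 0 < ε → Integrable (oscIntegrand (F t) χ ε) := fun ε t hε => (hF t χ hχ).1 ε hε
  have hcG : ∀ ε, Continuous fun p : ℝ × (E n × E n) => oscIntegrand (G p.1) χ ε p.2 := fun ε => by
    simp only [oscIntegrand]
    exact ((χ.continuous.comp (by fun_prop)).mul (by fun_prop)).mul hGc
  -- the regularised integrands are dominated
  have hdom : ∀ ε R, 0 < ε → ∃ c : ℝ, ∀ t, |t| ≤ R → ∀ p : E n × E n,
      ‖oscIntegrand (G t) χ ε p‖ ≤ c * (jk p.1 * jk p.2) := by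
    intro ε R hε
    obtain ⟨c, hc⟩ := hb R
    -- The cut-off bound is applied to a majorant independent of `t`, so that one constant serves
    -- all `|t| ≤ R`.
    have h1 : Amp 0 0 (fun _ η => |c| * (1 + ‖η‖) ^ K)
        (fun (_ η : E n) => ((|c| * (1 + ‖η‖) ^ K : ℝ) : ℂ)) := by
      refine ⟨by unfold Function.uncurry; fun_prop, fun y => ⟨by fun_prop, fun η => ?_⟩⟩
      rw [Complex.norm_real, Real.norm_of_nonneg (by positivity)]
    obtain ⟨c', hc'⟩ := amp_chi_mul h1 χ hε
    refine ⟨c', fun t ht p => (hc'.bound p.1 p.2).trans' ?_⟩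
    rw [oscIntegrand_eq]
    simp only [norm_mul, norm_ek, one_mul]
    refine mul_le_mul_of_nonneg_left (((hc t ht).bound p.1 p.2).trans ?_) (norm_nonneg _)
    rw [Complex.norm_real, Real.norm_of_nonneg (by positivity)]
    gcongr
    exact le_abs_self c
  have habs : ∀ t s : ℝ, s ∈ Metric.ball t 1 → |s| ≤ |t| + 1 := fun t s hs => by
    have h1 := abs_add_le t (s - t)
    have h2 : |s - t| < 1 := by simpa [Real.dist_eq] using hs
    rw [add_sub_cancel] at h1
    linarith
  have hder : ∀ ε t, 0 < ε → HasDerivAt (fun t => κ * ∫ p, oscIntegrand (F t) χ ε p)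
      (κ * ∫ p, oscIntegrand (G t) χ ε p) t := by
    intro ε t hε
    obtain ⟨c, hc⟩ := hdom ε (|t| + 1) hε
    have hpt : ∀ (p : E n × E n) (s : ℝ),
        HasDerivAt (fun s => oscIntegrand (F s) χ ε p) (oscIntegrand (G s) χ ε p) s :=
      fun p s => (hd p.1 p.2 s).const_mul _
    have h := hasDerivAt_integral_of_dominated_loc_of_deriv_le (μ := volume)
      (bound := fun p : E n × E n => c * (jk p.1 * jk p.2))
      (F := fun t => oscIntegrand (F t) χ ε) (F' := fun t => oscIntegrand (G t) χ ε)
      (Metric.ball_mem_nhds t zero_lt_one)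
      (Eventually.of_forall fun s => (hint ε s hε).aestronglyMeasurable) (hint ε t hε)
      ((hcG ε).comp (by fun_prop : Continuous fun p : E n × E n => (t, p))).aestronglyMeasurable
      (Eventually.of_forall fun p s hs => hc s (habs t s hs) p) (integrable_jk_prod.const_mul c)
      (Eventually.of_forall fun p s _ => hpt p s)
    exact h.2.const_mul κ
  have hcont : ∀ ε, 0 < ε → Continuous fun t => κ * ∫ p, oscIntegrand (G t) χ ε p := by
    intro ε hε
    refine continuous_const.mul (continuous_iff_continuousAt.2 fun t => ?_)
    obtain ⟨c, hc⟩ := hdom ε (|t| + 1) hε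
    refine continuousAt_of_dominated (bound := fun p => c * (jk p.1 * jk p.2))
      (Eventually.of_forall fun s =>
        ((hcG ε).comp (by fun_prop : Continuous fun p : E n × E n => (s, p))).aestronglyMeasurable)
      ?_ (integrable_jk_prod.const_mul c) (Eventually.of_forall fun p =>
        ((hcG ε).comp (by fun_prop : Continuous fun s : ℝ => (s, p))).continuousAt)
    filter_upwards [Metric.ball_mem_nhds t zero_lt_one] with s hs
    exact Eventually.of_forall fun p => hc s (habs t s hs) p
  have hftc : ∀ t, I t - I 0 = ∫ s in (0 : ℝ)..t, J s := by
    intro t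
    have h1 : ∀ᶠ ε in 𝓝[>] (0 : ℝ), (∫ s in (0 : ℝ)..t, κ * ∫ p, oscIntegrand (G s) χ ε p) =
        κ * (∫ p, oscIntegrand (F t) χ ε p) - κ * ∫ p, oscIntegrand (F 0) χ ε p := by
      filter_upwards [self_mem_nhdsWithin] with ε hε
      exact intervalIntegral.integral_eq_sub_of_hasDerivAt (fun s _ => hder ε s hε)
        ((hcont ε hε).intervalIntegrable _ _)
    have h2 := ((hF t χ hχ).2.sub (hF 0 χ hχ).2).congr' (h1.mono fun _ h => h.symm)
    refine tendsto_nhds_unique h2 ?_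
    obtain ⟨C, hC⟩ := norm_regularised_le hl χ
    obtain ⟨c, hc⟩ := hb |t|
    refine intervalIntegral.tendsto_integral_filter_of_dominated_convergence (fun _ => C * c)
      ?_ ?_ intervalIntegrable_const (Eventually.of_forall fun s _ => (hG s χ hχ).2)
    · filter_upwards [self_mem_nhdsWithin] with ε hε
      exact (hcont ε hε).aestronglyMeasurable
    · filter_upwards [Ioc_mem_nhdsGT (zero_lt_one (α := ℝ))] with ε hε
      refine Eventually.of_forall fun s hs => hC c _ (hc s ?_) ε hε
      rcases Set.mem_uIoc.1 hs with h | h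
      · rw [abs_of_pos h.1]; exact h.2.trans (le_abs_self t)
      · rw [abs_of_nonpos h.2]; exact (neg_le_neg h.1.le).trans (neg_le_abs t)
  have h3 : I = fun t => I 0 + ∫ s in (0 : ℝ)..t, J s := funext fun t => by rw [← hftc]; ring
  rw [h3]
  exact (intervalIntegral.integral_hasDerivAt_right (hJ.intervalIntegrable _ _)
    (hJ.stronglyMeasurableAtFilter _ _) hJ.continuousAt).const_add _

end NonsmoothPDO

namespace NonsmoothPDO

variable {n : ℕ}

/-! ### Dependence of the oscillatory integral on the parameters -/

variable {ρ δ : ℝ} {A r A' r' : ℕ∞} {m m' : ℝ} {h g : E n → E n → ℂ}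

theorem jap_le_one_add (ξ : E n) : jap ξ ≤ 1 + ‖ξ‖ := by
  have h1 := jap_add_le (0 : E n) ξ
  have h2 : jap (0 : E n) = 1 := by simp [jap]
  rwa [zero_add, h2] at h1

theorem hasPd_tens {i : Fin n} (hg : ∀ ξ, HasPd i (fun x => g x ξ)) (θ : ℝ) (x ξ η : E n) :
    HasPd i (fun y => tens θ h g x ξ y η) ∧
      pd i (fun y => tens θ h g x ξ y η) = fun y => tens θ h (px i g) x ξ y η := by
  have e := (hg ξ).comp_affine x 1
  simp only [one_smul, Complex.ofReal_one, one_mul] at e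
  have h2 := e.1.const_mul (h x (ξ + θ • η))
  rw [e.2] at h2
  exact h2

theorem px_tens {i : Fin n} (hg : ∀ ξ, HasPd i (fun x => g x ξ)) (θ : ℝ) (x ξ : E n) :
    px i (tens θ h g x ξ) = tens θ h (px i g) x ξ := by
  funext y η
  exact congrFun (hasPd_tens hg θ x ξ η).2 y

theorem Continuous.tens {X : Type*} [TopologicalSpace X] {θ : X → ℝ} {x ξ y η : X → E n}
    (hθ : Continuous θ) (hx : Continuous x) (hξ : Continuous ξ) (hy : Continuous y)
    (hη : Continuous η) (hh : PS m h) (hg : PS m' g) :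
    Continuous fun t => tens (θ t) h g (x t) (ξ t) (y t) (η t) := by
  obtain ⟨_, hh, _⟩ := hh
  obtain ⟨_, hg, _⟩ := hg
  exact (hh.comp (hx.prodMk (hξ.add (hθ.smul hη)))).mul (hg.comp ((hx.add hy).prodMk hξ))

theorem conv_tens (hh : PS m h) (hg : Sym ρ δ PS A' ⊤ m' g) (B : ℕ) (p₀ : E n × E n × ℝ) :
    Conv (𝓝 p₀) B (fun p => tens p.2.2 h g p.1 p.2.1) (tens p₀.2.2 h g p₀.1 p₀.2.1) := by
  have hb : ∀ {m' g}, PS m' g → Conv (𝓝 p₀) 0 (fun p : E n × E n × ℝ => tens p.2.2 h g p.1 p.2.1)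
      (tens p₀.2.2 h g p₀.1 p₀.2.1) := fun hg y η =>
    (Continuous.tens (by fun_prop) (by fun_prop) (by fun_prop) continuous_const continuous_const
      hh hg).tendsto p₀
  induction B generalizing g m' with
  | zero => exact hb hg.base
  | succ B ih =>
    refine ⟨hb hg.base, fun i => ?_⟩
    simp_rw [px_tens (hg.hasPd_x le_top i)]
    exact ih (hg.px le_top i)

/-- A cruder bound without dilation: it is uniform in `x` but only locally uniform in ξ and θ, with
θ not confined to `[0, 1]`. This suffices for existence, continuity and differentiation. -/
theorem amp_tens (hρ : 0 ≤ ρ) {K : ℕ} (hm : m ≤ K) (hA : ((n + 1 : ℕ) : ℕ∞) ≤ A)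
    (hh : Sym ρ δ PS A r m h) (hg : Sym ρ δ PS A' ⊤ m' g) (B : ℕ) (R : ℝ) : ∃ c : ℝ,
      ∀ (x ξ : E n) (θ : ℝ), ‖ξ‖ ≤ R → |θ| ≤ R →
        Amp (n + 1) B (fun _ η => c * (1 + ‖η‖) ^ K) (tens θ h g x ξ) := by
  obtain ⟨c, hc⟩ := (hh (n + 1)).uniform_PS
  obtain ⟨c', hc'⟩ := (hg B).uniform_PS
  set Q : ℝ := 1 + |R| with hQ
  have hQ1 : 1 ≤ Q := by rw [hQ]; linarith [abs_nonneg R]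
  set D : ℝ := Q ^ max |δ| |m'| with hD
  have hjap : ∀ ξ : E n, ‖ξ‖ ≤ R → ∀ s, |s| ≤ max |δ| |m'| → jap ξ ^ s ≤ D := fun ξ hξ s hs =>
    (jap_rpow_mono ξ ((le_abs_self s).trans hs)).trans (Real.rpow_le_rpow (jap_pos ξ).le
      ((jap_le_one_add ξ).trans (by rw [hQ]; linarith [le_abs_self R])) ((abs_nonneg s).trans hs))
  have hD1 : 1 ≤ D := Real.one_le_rpow hQ1 (le_max_of_le_left (abs_nonneg δ))
  refine ⟨2 ^ (n + 1 + B) * (Q ^ (n + 1) * (c * Q ^ K) * (D ^ B * (c' * D))),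
    fun x ξ θ hξ hθ => ?_⟩
  have h1 : RegV (fun _ => 1) (n + 1) (fun η => Q ^ (n + 1) * (c * (Q * (1 + ‖η‖)) ^ K))
      (fun η => h x (ξ + θ • η)) := by
    refine RegV.absorb (q := fun _ => Q) (fun _ => hQ1)
      ((hc.regV_xi hA x).comp_affine ξ θ (fun ζ => (jap_rpow_pos ζ _).le) (fun η => ?_)
        fun η => ?_)
    · have h2 : jap (ξ + θ • η) ^ (-ρ) ≤ 1 := by
        simpa using jap_rpow_mono (ξ + θ • η) (show -ρ ≤ 0 by linarith)
      calc |θ| * jap (ξ + θ • η) ^ (-ρ) ≤ |θ| * 1 := by gcongr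
        _ ≤ Q := by rw [hQ]; linarith [le_abs_self R]
    · have h2 : jap (ξ + θ • η) ≤ Q * (1 + ‖η‖) := by
        refine (jap_le_one_add _).trans ?_
        have h3 := norm_add_le ξ (θ • η)
        rw [norm_smul, Real.norm_eq_abs] at h3
        have h4 : |θ| * ‖η‖ ≤ |R| * ‖η‖ := by 
          exact mul_le_mul_of_nonneg_right (hθ.trans (le_abs_self R)) (norm_nonneg η)
        rw [hQ]
        nlinarith [norm_nonneg η, le_abs_self R]
      gcongr
      calc jap (ξ + θ • η) ^ m ≤ jap (ξ + θ • η) ^ (K : ℝ) := jap_rpow_mono _ hm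
        _ = jap (ξ + θ • η) ^ K := Real.rpow_natCast _ _
        _ ≤ _ := pow_le_pow_left₀ (jap_pos _).le h2 K
  have h2 : RegV (fun _ => 1) B (fun _ => D ^ B * (c' * D)) (fun y => g (x + y) ξ) := by
    have := RegV.absorb (q := fun _ => D) (fun _ => hD1)
      ((hc'.regV_x le_top ξ).comp_affine (V := fun _ => c' * D) x 1
        (fun _ => (jap_rpow_pos ξ _).le) (fun y => by
          simpa using hjap ξ hξ δ (le_max_left _ _))
        fun y => mul_le_mul_of_nonneg_left (hjap ξ hξ m' (le_max_right _ _)) c'.coe_nonneg)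
    simpa using this
  refine (Amp.tensor h1 h2).mono fun y η => le_of_eq ?_
  rw [mul_pow]
  ring

theorem hasOscInt_osc (hρ : 0 ≤ ρ) (hA : ((n + 1 : ℕ) : ℕ∞) ≤ A)
    (hh : Sym ρ δ PS A r m h) (hg : Sym ρ δ PS A' ⊤ m' g) (θ : ℝ) (x ξ : E n) :
    HasOscInt (tens θ h g x ξ) (osc θ h g x ξ) := by
  obtain ⟨K, hK⟩ := exists_nat_ge m
  obtain ⟨l, hl⟩ := exists_adm (n := n) K
  obtain ⟨c, hc⟩ := amp_tens hρ hK hA hh hg l.length (max ‖ξ‖ |θ|)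
  exact (hasOscInt_bOp hl (hc x ξ θ (le_max_left _ _) (le_max_right _ _))).hasOscInt_oscInt

theorem continuous_osc (hρ : 0 ≤ ρ) (hA : ((n + 1 : ℕ) : ℕ∞) ≤ A)
    (hh : Sym ρ δ PS A r m h) (hg : Sym ρ δ PS A' ⊤ m' g) :
    Continuous fun p : E n × E n × ℝ => osc p.2.2 h g p.1 p.2.1 := by
  obtain ⟨K, hK⟩ := exists_nat_ge m
  obtain ⟨l, hl⟩ := exists_adm (n := n) K
  refine continuous_iff_continuousAt.2 fun p₀ => ?_
  obtain ⟨c, hc⟩ := amp_tens hρ hK hA hh hg l.length (‖p₀‖ + 1)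
  have hp : ∀ p : E n × E n × ℝ, ‖p‖ ≤ ‖p₀‖ + 1 →
      Amp (n + 1) l.length (fun _ η => c * (1 + ‖η‖) ^ K) (tens p.2.2 h g p.1 p.2.1) := fun p hp =>
    hc _ _ _ (((norm_fst_le p.2).trans (norm_snd_le p)).trans hp)
      (((norm_snd_le p.2).trans (norm_snd_le p)).trans hp)
  have h1 : ∀ᶠ p in 𝓝 p₀, ‖p‖ ≤ ‖p₀‖ + 1 :=
    (continuous_norm.tendsto p₀).eventually (ge_mem_nhds (by linarith))
  have h2 := tendsto_bOp_of_eventually hl (h1.mono hp) (hp p₀ (by linarith))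
    (conv_tens hh.base hg l.length p₀)
  have e : ∀ p : E n × E n × ℝ, ‖p‖ ≤ ‖p₀‖ + 1 →
      bOp l (tens p.2.2 h g p.1 p.2.1) = osc p.2.2 h g p.1 p.2.1 := fun p hpp =>
    (hasOscInt_bOp hl (hp p hpp)).oscInt_eq.symm
  rw [e p₀ (by linarith)] at h2
  exact h2.congr' (h1.mono e)

theorem Continuous.osc {X : Type*} [TopologicalSpace X] {θ : X → ℝ} {x ξ : X → E n}
    (hθ : Continuous θ) (hx : Continuous x) (hξ : Continuous ξ) (hρ : 0 ≤ ρ)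
    (hA : ((n + 1 : ℕ) : ℕ∞) ≤ A) (hh : Sym ρ δ PS A r m h) (hg : Sym ρ δ PS A' ⊤ m' g) :
    Continuous fun t => osc (θ t) h g (x t) (ξ t) :=
  Continuous.comp (g := fun p : E n × E n × ℝ => NonsmoothPDO.osc p.2.2 h g p.1 p.2.1)
    (f := fun t => (x t, ξ t, θ t)) (continuous_osc hρ hA hh hg) (hx.prodMk (hξ.prodMk hθ))

theorem exists_nat_ge_two (a b : ℝ) : ∃ K : ℕ, a ≤ K ∧ b ≤ K := by
  obtain ⟨K, hK⟩ := exists_nat_ge (max a b)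
  exact ⟨K, (le_max_left _ _).trans hK, (le_max_right _ _).trans hK⟩

/-- One derivative beyond n + 1 is required of `h`, since ∂_{ξ_j} may fall on `h` and n + 1 must
remain for convergence. -/
theorem osc_hasPd_xi (hρ : 0 ≤ ρ) (hA : ((n + 1 + 1 : ℕ) : ℕ∞) ≤ A) (hA' : 1 ≤ A')
    (hh : Sym ρ δ PS A r m h) (hg : Sym ρ δ PS A' ⊤ m' g) (θ : ℝ) (j : Fin n) (x : E n) :
    HasPd j (osc θ h g x) ∧ pd j (osc θ h g x) =
      fun ξ => osc θ (pxi j h) g x ξ + osc θ h (pxi j g) x ξ := by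
  have hA1 : ((n + 1 : ℕ) : ℕ∞) ≤ A := le_trans (by exact_mod_cast Nat.le_succ _) hA
  have hA2 := pred_le_pred hA
  have hh' := hh.pxi (one_le_of_succ_le hA) j
  have hg' := hg.pxi hA' j
  obtain ⟨K, hK, hK'⟩ := exists_nat_ge_two m (m - ρ)
  obtain ⟨l, hl⟩ := exists_adm (n := n) K
  refine HasPd.of_has fun ξ => ?_
  have hcont : ∀ {A A' : ℕ∞} {m m' : ℝ} {h g : E n → E n → ℂ}, ((n + 1 : ℕ) : ℕ∞) ≤ A →
      Sym ρ δ PS A r m h → Sym ρ δ PS A' ⊤ m' g →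
      Continuous fun t : ℝ => osc θ h g x (ξ + t • bv j) := fun hA hh hg =>
    Continuous.osc continuous_const continuous_const (by fun_prop) hρ hA hh hg
  have hct : ∀ {m m' : ℝ} {h g : E n → E n → ℂ}, PS m h → PS m' g →
      Continuous fun p : ℝ × E n × E n => tens θ h g x (ξ + p.1 • bv j) p.2.1 p.2.2 := fun hh hg =>
    Continuous.tens continuous_const continuous_const (by fun_prop) (by fun_prop) (by fun_prop) hh hg
  set F : ℝ → E n → E n → ℂ := fun t => tens θ h g x (ξ + t • bv j) with hF
  set G : ℝ → E n → E n → ℂ := fun t y η => tens θ (pxi j h) g x (ξ + t • bv j) y η +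
    tens θ h (pxi j g) x (ξ + t • bv j) y η with hG
  have hd : ∀ y η t, HasDerivAt (fun t => F t y η) (G t y η) t := fun y η t => by
    have e : ∀ s : ℝ, ξ + s • bv j + θ • η = (ξ + θ • η) + s • bv j := fun s => by abel
    have h1 : HasDerivAt (fun s : ℝ => h x (ξ + s • bv j + θ • η))
        (pxi j h x (ξ + t • bv j + θ • η)) t := by
      simp_rw [e]
      exact (hh.hasPd_xi (one_le_of_succ_le hA) j x).hasDerivAt (ξ + θ • η) t
    exact h1.mul ((hg.hasPd_xi hA' j (x + y)).hasDerivAt ξ t)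
  have hb : ∀ R : ℝ, ∃ c : ℝ, ∀ t, |t| ≤ R →
      Amp (n + 1) l.length (fun _ η => c * (1 + ‖η‖) ^ K) (G t) := fun R => by
    obtain ⟨c₁, hc₁⟩ := amp_tens hρ hK' hA2 hh' hg l.length (‖ξ‖ + |R| + |θ|)
    obtain ⟨c₂, hc₂⟩ := amp_tens hρ hK hA1 hh hg' l.length (‖ξ‖ + |R| + |θ|)
    refine ⟨c₁ + c₂, fun t ht => ?_⟩
    have h1 : ‖ξ + t • bv j‖ ≤ ‖ξ‖ + |R| + |θ| := by
      have h2 := norm_add_le ξ (t • bv j)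
      rw [norm_smul] at h2
      have h3 : ‖(bv j : E n)‖ = 1 := by simp [bv]
      rw [h3, mul_one, Real.norm_eq_abs] at h2
      linarith [le_abs_self R, abs_nonneg θ]
    have h2 : |θ| ≤ ‖ξ‖ + |R| + |θ| := by linarith [norm_nonneg ξ, abs_nonneg R]
    exact ((hc₁ x _ θ h1 h2).add (hc₂ x _ θ h1 h2)).mono fun y η => le_of_eq (by ring)
  have hJ : Continuous fun t : ℝ => osc θ (pxi j h) g x (ξ + t • bv j) +
      osc θ h (pxi j g) x (ξ + t • bv j) := (hcont hA2 hh' hg).add (hcont hA1 hh hg')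
  have hGc : Continuous fun p : ℝ × E n × E n => G p.1 p.2.1 p.2.2 :=
    (hct hh'.base hg.base).add (hct hh.base hg'.base)
  have key := hasDerivAt_of_hasOscInt hl (F := F) (G := G)
    (I := fun t => osc θ h g x (ξ + t • bv j)) (fun t => hasOscInt_osc hρ hA1 hh hg θ x _)
    (fun t => (hasOscInt_osc hρ hA2 hh' hg θ x _).add (hasOscInt_osc hρ hA1 hh hg' θ x _))
    hJ hd hGc hb 0
  rw [zero_smul, add_zero] at key
  exact key

theorem osc_hasPd_x (hρ : 0 ≤ ρ) (hA : ((n + 1 : ℕ) : ℕ∞) ≤ A) (hr : 1 ≤ r)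
    (hh : Sym ρ δ PS A r m h) (hg : Sym ρ δ PS A' ⊤ m' g) (θ : ℝ) (i : Fin n) (ξ : E n) :
    HasPd i (fun x => osc θ h g x ξ) ∧ pd i (fun x => osc θ h g x ξ) =
      fun x => osc θ (px i h) g x ξ + osc θ h (px i g) x ξ := by
  have hh' := hh.px hr i
  have hg' : Sym ρ δ PS A' ⊤ (m' + δ) (px i g) := hg.px le_top i
  obtain ⟨K, hK, hK'⟩ := exists_nat_ge_two m (m + δ)
  obtain ⟨l, hl⟩ := exists_adm (n := n) K
  refine HasPd.of_has fun x => ?_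
  have hcont : ∀ {r A' : ℕ∞} {m m' : ℝ} {h g : E n → E n → ℂ},
      Sym ρ δ PS A r m h → Sym ρ δ PS A' ⊤ m' g →
      Continuous fun t : ℝ => osc θ h g (x + t • bv i) ξ := fun hh hg =>
    Continuous.osc continuous_const (by fun_prop) continuous_const hρ hA hh hg
  have hct : ∀ {m m' : ℝ} {h g : E n → E n → ℂ}, PS m h → PS m' g →
      Continuous fun p : ℝ × E n × E n => tens θ h g (x + p.1 • bv i) ξ p.2.1 p.2.2 := fun hh hg =>
    Continuous.tens continuous_const (by fun_prop) continuous_const (by fun_prop) (by fun_prop) hh hg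
  set F : ℝ → E n → E n → ℂ := fun t => tens θ h g (x + t • bv i) ξ with hF
  set G : ℝ → E n → E n → ℂ := fun t y η => tens θ (px i h) g (x + t • bv i) ξ y η +
    tens θ h (px i g) (x + t • bv i) ξ y η with hG
  have hd : ∀ y η t, HasDerivAt (fun t => F t y η) (G t y η) t := fun y η t => by
    have e : ∀ s : ℝ, x + s • bv i + y = (x + y) + s • bv i := fun s => by abel
    have h1 : HasDerivAt (fun s : ℝ => g (x + s • bv i + y) ξ)
        (px i g (x + t • bv i + y) ξ) t := by
      simp_rw [e]
      exact (hg.hasPd_x le_top i ξ).hasDerivAt (x + y) t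
    exact ((hh.hasPd_x hr i (ξ + θ • η)).hasDerivAt x t).mul h1
  have hb : ∀ R : ℝ, ∃ c : ℝ, ∀ t, |t| ≤ R →
      Amp (n + 1) l.length (fun _ η => c * (1 + ‖η‖) ^ K) (G t) := fun R => by
    obtain ⟨c₁, hc₁⟩ := amp_tens hρ hK' hA hh' hg l.length (max ‖ξ‖ |θ|)
    obtain ⟨c₂, hc₂⟩ := amp_tens hρ hK hA hh hg' l.length (max ‖ξ‖ |θ|)
    exact ⟨c₁ + c₂, fun t _ => ((hc₁ _ ξ θ (le_max_left _ _) (le_max_right _ _)).add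
      (hc₂ _ ξ θ (le_max_left _ _) (le_max_right _ _))).mono fun y η => le_of_eq (by ring)⟩
  have hJ : Continuous fun t : ℝ => osc θ (px i h) g (x + t • bv i) ξ +
      osc θ h (px i g) (x + t • bv i) ξ := (hcont hh' hg).add (hcont hh hg')
  have hGc : Continuous fun p : ℝ × E n × E n => G p.1 p.2.1 p.2.2 :=
    (hct hh'.base hg.base).add (hct hh.base hg'.base)
  have key := hasDerivAt_of_hasOscInt hl (F := F) (G := G)
    (I := fun t => osc θ h g (x + t • bv i) ξ) (fun t => hasOscInt_osc hρ hA hh hg θ _ ξ)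
    (fun t => (hasOscInt_osc hρ hA hh' hg θ _ ξ).add (hasOscInt_osc hρ hA hh hg' θ _ ξ))
    hJ hd hGc hb 0
  rw [zero_smul, add_zero] at key
  exact key

/-! ### Differentiation in the homotopy parameter -/

theorem regV_coord (j : Fin n) (A : ℕ) :
    RegV (fun _ => 1) A (fun η : E n => 1 + ‖η‖) (fun η => (η j : ℂ)) := by
  have hb : Continuous (fun η : E n => (η j : ℂ)) ∧ ∀ η : E n, ‖(η j : ℂ)‖ ≤ 1 + ‖η‖ :=
    ⟨by fun_prop, fun η => by
      rw [Complex.norm_real]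
      linarith [PiLp.norm_apply_le η j]⟩
  cases A with
  | zero => exact hb
  | succ A =>
    refine ⟨hb, fun i => ?_⟩
    have h1 := HasPd.of_has (i := i) (f := fun η : E n => (η j : ℂ))
      (f' := fun _ => if i = j then 1 else 0) fun η => by
        have h1 : (fun t : ℝ => ((η + t • bv i) j : ℂ)) =
            fun t : ℝ => (η j : ℂ) + (t : ℂ) * (if i = j then 1 else 0) := by
          funext t
          by_cases hij : i = j
          · subst hij; simp [bv]
          · simp [bv, hij, Ne.symm hij]
        unfold HasLineDerivAt
        rw [h1]
        simpa using! ((Complex.ofRealCLM.hasDerivAt (x := (0:ℝ))).mul_const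
          (if i = j then (1:ℂ) else 0)).const_add (η j : ℂ)
    refine ⟨h1.1, ?_⟩
    rw [h1.2]
    refine (RegV.const (fun _ => zero_le_one) _ A).mono_weight (fun _ => zero_le_one) fun η => ?_
    have : ‖(if i = j then 1 else 0 : ℂ)‖ ≤ 1 := by split_ifs <;> simp
    linarith [norm_nonneg η]

theorem Amp.coord_mul {A B K : ℕ} {c : ℝ} {F : E n → E n → ℂ} (j : Fin n)
    (hF : Amp A B (fun _ η => c * (1 + ‖η‖) ^ K) F) :
    Amp A B (fun _ η => 2 ^ (A + B) * c * (1 + ‖η‖) ^ (K + 1)) (fun y η => (η j : ℂ) * F y η) :=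
  ((Amp.of_eta (regV_coord j A) B).mul hF).mono fun y η => le_of_eq (by ring)

/-- The auxiliary amplitude F₁ = (1 + iη_j)F is chosen so that `Top j` removes its factor exactly
and leaves F + ∂_{y_j}F. Hence F₁ regularised along `j :: l` equals F + ∂_{y_j}F regularised along
`l`; subtracting `F` and multiplying by -i gives the claim. -/
theorem hasOscInt_coord_mul {K : ℕ} {F : E n → E n → ℂ} (j : Fin n) {I : ℂ}
    (hF : ∀ B, ∃ c : ℝ, Amp (n + 1) B (fun _ η => c * (1 + ‖η‖) ^ K) F)
    (hI : HasOscInt (px j F) I) : HasOscInt (fun y η => (η j : ℂ) * F y η) (-Complex.I * I) := by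
  obtain ⟨l, hl⟩ := exists_adm (n := n) (K + 1)
  obtain ⟨c, hc⟩ := hF (l.length + 1)
  have hmul := hc.coord_mul j
  set F₁ : E n → E n → ℂ := fun y η => F y η + Complex.I * ((η j : ℂ) * F y η) with hF₁
  have hc0 : 0 ≤ c := by simpa using hc.nonneg 0 0
  have hle : ∀ η : E n, c * (1 + ‖η‖) ^ K ≤ c * (1 + ‖η‖) ^ (K + 1) := fun η => by
    gcongr
    · linarith [norm_nonneg η]
    · omega
  have hA₁ : Amp (n + 1) (l.length + 1)
      (fun _ η => (c + 2 ^ (n + 1 + (l.length + 1)) * c) * (1 + ‖η‖) ^ (K + 1)) F₁ := by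
    refine (hc.add (hmul.const_mul Complex.I)).mono fun y η => ?_
    have := hle η
    rw [Complex.norm_I, one_mul, add_mul]
    linarith
  have hT : Top j F₁ = fun y η => F y η + px j F y η := by
    funext y η
    have h1 : px j F₁ y η = (1 + Complex.I * (η j : ℂ)) * px j F y η := by
      have h2 := ((hc.2 j).1 η).const_mul (1 + Complex.I * (η j : ℂ))
      have h3 : (fun y => F₁ y η) = fun y => (1 + Complex.I * (η j : ℂ)) * F y η := by
        funext y; rw [hF₁]; ring
      have h4 := congrFun h2.2 y
      rw [← h3] at h4
      exact h4
    have h5 := one_add_I_mul_ne j η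
    rw [Top, h1, qj, hF₁]
    field_simp
  have hl' : Adm (j :: l) (K + 1) := hl.cons j
  have h1 : HasOscInt F₁ (bOp (j :: l) F₁) := hasOscInt_bOp hl' (by simpa using hA₁)
  have h2 : HasOscInt (fun y η => F y η + px j F y η) (bOp l (fun y η => F y η + px j F y η)) := by
    refine hasOscInt_bOp hl (c := 2 * c) ?_
    refine (hc.pred.add (hc.2 j).2).mono fun y η => ?_
    have := hle η
    linarith
  have h3 : bOp (j :: l) F₁ = bOp l (fun y η => F y η + px j F y η) := by
    rw [← hT]; rfl
  rw [h3] at h1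
  have h4 : HasOscInt F (bOp l F) := hasOscInt_bOp hl (hc.pred.mono fun y η => hle η)
  rw [h2.eq (h4.add hI)] at h1
  have h5 := (h1.add (h4.const_mul (-1))).const_mul (-Complex.I)
  have e1 : (fun y η => -Complex.I * (F₁ y η + -1 * F y η)) = fun y η => (η j : ℂ) * F y η := by
    funext y η
    rw [hF₁]
    linear_combination (-(η j : ℂ) * F y η) * Complex.I_mul_I
  rw [e1] at h5
  convert h5 using 1
  ring

theorem HasOscInt.sum {ι : Type*} (s : Finset ι) {F : ι → E n → E n → ℂ} {I : ι → ℂ}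
    (hF : ∀ i, HasOscInt (F i) (I i)) :
    HasOscInt (fun y η => ∑ i ∈ s, F i y η) (∑ i ∈ s, I i) := by
  classical
  induction s using Finset.induction_on with
  | empty =>
    intro χ _
    have e : ∀ ε, oscIntegrand (n := n) (fun _ _ => 0) χ ε = fun _ => 0 := fun ε => by
      funext p; simp [oscIntegrand]
    simp [e]
  | insert i s hi ih =>
    simp only [Finset.sum_insert hi]
    exact (hF i).add ih

theorem Amp.sum {A B : ℕ} {ι : Type*} (s : Finset ι) {W : E n → E n → ℝ} {F : ι → E n → E n → ℂ}
    (hF : ∀ i, Amp A B W (F i)) :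
    Amp A B (fun y η => s.card * W y η) (fun y η => ∑ i ∈ s, F i y η) := by
  classical
  induction s using Finset.induction_on with
  | empty =>
    have := Amp.of_eta (RegV.const (q := fun _ : E n => 1) (fun _ => zero_le_one) (0 : ℂ) A) B
    simpa using this
  | insert i s hi ih =>
    simp only [Finset.sum_insert hi]
    refine ((hF i).add ih).mono fun y η => le_of_eq ?_
    rw [Finset.card_insert_of_notMem hi]
    push_cast
    ring

/-- The chain rule produces Σ_j η_j ∂_{ξ_j}h, and each η_j becomes -i∂_{y_j} acting on `g`. The
additional power of η is why the list is admissible for `K + 1`. -/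
theorem osc_hasDerivAt_theta (hρ : 0 ≤ ρ) (hA : ((n + 1 + 1 : ℕ) : ℕ∞) ≤ A)
    (hh : Sym ρ δ PS A r m h) (hg : Sym ρ δ PS A' ⊤ m' g) (x ξ : E n) (θ : ℝ) :
    HasDerivAt (fun θ => osc θ h g x ξ)
      (∑ j, -Complex.I * osc θ (pxi j h) (px j g) x ξ) θ := by
  have hA1 : ((n + 1 : ℕ) : ℕ∞) ≤ A := le_trans (by exact_mod_cast Nat.le_succ _) hA
  have hA2 := pred_le_pred hA
  have hA0 := one_le_of_succ_le hA
  obtain ⟨K, hK⟩ := exists_nat_ge (m - ρ)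
  obtain ⟨l, hl⟩ := exists_adm (n := n) (K + 1)
  have hamp : ∀ (B : ℕ) (R : ℝ), ∃ c : ℝ, ∀ (j : Fin n) (θ : ℝ), |θ| ≤ R →
      Amp (n + 1) B (fun _ η => c * (1 + ‖η‖) ^ K) (tens θ (pxi j h) g x ξ) := by
    intro B R
    choose c hc using fun j => amp_tens hρ hK hA2 (hh.pxi hA0 j) hg B (max ‖ξ‖ R)
    obtain ⟨M, hM⟩ := Finite.exists_le c
    exact ⟨M, fun j θ hθ => (hc j x ξ θ (le_max_left _ _) (hθ.trans (le_max_right _ _))).mono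
      fun y η => by gcongr; exact hM j⟩
  have hosc : ∀ j θ, HasOscInt (fun y η => (η j : ℂ) * tens θ (pxi j h) g x ξ y η)
      (-Complex.I * osc θ (pxi j h) (px j g) x ξ) := fun j θ => by
    refine hasOscInt_coord_mul (K := K) j (fun B => ?_) ?_
    · obtain ⟨c, hc⟩ := hamp B |θ|
      exact ⟨c, hc j θ le_rfl⟩
    · rw [px_tens (hg.hasPd_x le_top j)]
      exact hasOscInt_osc hρ hA2 (hh.pxi hA0 j) (hg.px le_top j) θ x ξ
  set F : ℝ → E n → E n → ℂ := fun θ => tens θ h g x ξ with hF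
  set G : ℝ → E n → E n → ℂ := fun θ y η => ∑ j, (η j : ℂ) * tens θ (pxi j h) g x ξ y η with hG
  have hd : ∀ y η t, HasDerivAt (fun t => F t y η) (G t y η) t := fun y η t => by
    have h1 := hasFDerivAt_of_continuous_pd (f := h x) (fun j => hh.hasPd_xi hA0 j x) (fun j => by
      obtain ⟨c, hc⟩ := (hh.pxi hA0 j).base
      exact hc.continuous_xi x) (ξ + t • η)
    have h2 : HasDerivAt (fun s : ℝ => ξ + s • η) η t := by
      simpa using! ((hasDerivAt_id t).smul_const η).const_add ξ
    have h3 := (h1.comp_hasDerivAt t h2).mul_const (g (x + y) ξ)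
    refine HasDerivAt.congr_deriv h3 ?_
    simp only [hG, sum_apply, ContinuousLinearMap.smulRight_apply,
      Finset.sum_mul]
    refine Finset.sum_congr rfl fun j _ => ?_
    have e : (EuclideanSpace.proj (𝕜 := ℝ) j : E n →L[ℝ] ℝ) η = η j := rfl
    simp only [tens, pxi, Complex.real_smul, e]
    ring
  have hb : ∀ R : ℝ, ∃ c : ℝ, ∀ t, |t| ≤ R →
      Amp (n + 1) l.length (fun _ η => c * (1 + ‖η‖) ^ (K + 1)) (G t) := fun R => by
    obtain ⟨c, hc⟩ := hamp l.length R
    refine ⟨n * (2 ^ (n + 1 + l.length) * c), fun t ht => ?_⟩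
    refine (Amp.sum Finset.univ (W := fun _ η => 2 ^ (n + 1 + l.length) * c *
      (1 + ‖η‖) ^ (K + 1)) fun j => (hc j t ht).coord_mul j).mono fun y η => ?_
    simp only [Finset.card_univ, Fintype.card_fin]
    exact le_of_eq (by ring)
  have hJ : Continuous fun t : ℝ => ∑ j, -Complex.I * osc t (pxi j h) (px j g) x ξ :=
    continuous_finsetSum _ fun j _ => continuous_const.mul
      (Continuous.osc continuous_id continuous_const continuous_const hρ hA2 (hh.pxi hA0 j)
        (hg.px le_top j))
  have hGc : Continuous fun p : ℝ × E n × E n => G p.1 p.2.1 p.2.2 := by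
    refine continuous_finsetSum _ fun j _ => Continuous.mul (by fun_prop) ?_
    exact Continuous.tens continuous_fst continuous_const continuous_const (by fun_prop) (by fun_prop)
      (hh.pxi hA0 j).base hg.base
  exact hasDerivAt_of_hasOscInt hl (F := F) (G := G) (I := fun t => osc t h g x ξ)
    (fun t => hasOscInt_osc hρ hA1 hh hg t x ξ) (fun t => HasOscInt.sum _ fun j => hosc j t)
    hJ hd hGc hb θ

end NonsmoothPDO

namespace NonsmoothPDO

variable {n : ℕ}

/-! ### Averages of oscillatory integrals -/

theorem hasDerivAt_intervalIntegral {Φ Ψ : ℝ → ℝ → ℂ} (hΦ : Continuous (Function.uncurry Φ))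
    (hΨ : Continuous (Function.uncurry Ψ)) (hd : ∀ θ t, HasDerivAt (Φ θ) (Ψ θ t) t) (t : ℝ) :
    HasDerivAt (fun t => ∫ θ in (0 : ℝ)..1, Φ θ t) (∫ θ in (0 : ℝ)..1, Ψ θ t) t := by
  obtain ⟨C, hC⟩ := (isCompact_Icc.prod (isCompact_closedBall t 1)).exists_bound_of_continuousOn
    (f := Function.uncurry Ψ) (s := Set.Icc (0 : ℝ) 1 ×ˢ Metric.closedBall t 1) hΨ.continuousOn
  have h1 : ∀ t, Continuous fun θ => Φ θ t := fun t =>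
    hΦ.comp (by fun_prop : Continuous fun θ : ℝ => (θ, t))
  have h2 : ∀ t, Continuous fun θ => Ψ θ t := fun t =>
    hΨ.comp (by fun_prop : Continuous fun θ : ℝ => (θ, t))
  have h := intervalIntegral.hasDerivAt_integral_of_dominated_loc_of_deriv_le (𝕜 := ℝ) (a := 0)
    (b := 1) (μ := volume) (bound := fun _ => C) (F := fun t θ => Φ θ t) (F' := fun t θ => Ψ θ t)
    (Metric.ball_mem_nhds t zero_lt_one)
    (Eventually.of_forall fun t => (h1 t).aestronglyMeasurable) ((h1 t).intervalIntegrable _ _)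
    (h2 t).aestronglyMeasurable (Eventually.of_forall fun θ hθ s hs => ?_)
    intervalIntegrable_const (Eventually.of_forall fun θ _ s _ => hd θ s)
  · exact h.2
  · rw [Set.uIoc_of_le zero_le_one] at hθ
    exact hC (θ, s) ⟨Set.Ioc_subset_Icc_self hθ, Metric.ball_subset_closedBall hs⟩

/-- The average of `Os-∬ e^{-iy·η} h(x, ξ + θη) g(x + y, ξ) dy đη` over `θ ∈ [0, 1]`. -/
noncomputable def avgOsc (w : ℝ → ℝ) (h g : E n → E n → ℂ) : E n → E n → ℂ :=
  fun x ξ => ∫ θ in (0 : ℝ)..1, (w θ : ℂ) * osc θ h g x ξ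

variable {ρ δ τ : ℝ} {A r A' r' : ℕ∞} {m m' : ℝ} {h g : E n → E n → ℂ} {w : ℝ → ℝ}

theorem continuous_avgOsc (hw : Continuous w) (hρ : 0 ≤ ρ) (hA : ((n + 1 : ℕ) : ℕ∞) ≤ A)
    (hh : Sym ρ δ PS A r m h) (hg : Sym ρ δ PS A' ⊤ m' g) :
    Continuous (Function.uncurry (avgOsc w h g)) := by
  refine intervalIntegral.continuous_parametric_intervalIntegral_of_continuous'
    (f := fun (p : E n × E n) θ => (w θ : ℂ) * osc θ h g p.1 p.2) ?_ 0 1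
  exact Continuous.mul (by fun_prop)
    (Continuous.osc (by fun_prop) (by fun_prop) (by fun_prop) hρ hA hh hg)

theorem exists_weight_bound (hw : Continuous w) :
    ∃ W : ℝ, 0 ≤ W ∧ ∀ θ ∈ Set.Icc (0 : ℝ) 1, |w θ| ≤ W := by
  obtain ⟨C, hC⟩ := (isCompact_Icc (a := (0 : ℝ)) (b := 1)).exists_bound_of_continuousOn
    hw.continuousOn
  exact ⟨C, (norm_nonneg _).trans (hC 0 (by simp)), hC⟩

theorem norm_weighted_integral_le {W C : ℝ} (hW : ∀ θ ∈ Set.Icc (0 : ℝ) 1, |w θ| ≤ W) {f : ℝ → ℂ}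
    (hf : ∀ θ ∈ Set.Icc (0 : ℝ) 1, ‖f θ‖ ≤ C) :
    ‖∫ θ in (0 : ℝ)..1, (w θ : ℂ) * f θ‖ ≤ W * C := by
  have := intervalIntegral.norm_integral_le_of_norm_le_const (a := (0 : ℝ)) (b := 1)
    (f := fun θ => (w θ : ℂ) * f θ) (C := W * C) fun θ hθ => by
      rw [Set.uIoc_of_le zero_le_one] at hθ
      have hθ' := Set.Ioc_subset_Icc_self hθ
      rw [norm_mul, Complex.norm_real]
      exact mul_le_mul (hW θ hθ') (hf θ hθ') (norm_nonneg _) ((abs_nonneg _).trans (hW θ hθ'))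
  simpa using this

theorem avgOsc_PH (hw : Continuous w) (hδ : 0 ≤ δ) (hδρ : δ < ρ) (hρ : ρ ≤ 1) (hτ0 : 0 ≤ τ)
    (hτ : τ ≤ 1) (hA : ((n + 1 : ℕ) : ℕ∞) ≤ A)
    (hh : Sym ρ δ (PH δ τ) A r m h) (hg : Sym ρ δ PS A' ⊤ m' g) :
    PH δ τ (m + m') (avgOsc w h g) := by
  have hρ0 : 0 ≤ ρ := by linarith
  have hh' := hh.weaken fun _ _ => PH.toPS
  obtain ⟨W, hW0, hW⟩ := exists_weight_bound hw
  obtain ⟨C, hC, h1⟩ := osc_PS hδ hδρ hρ hA hh' hg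
  obtain ⟨C', hC', h2⟩ := osc_PH hδ hδρ hρ hτ0 hτ hA hh hg
  refine ⟨⟨W * C + W * C', by positivity⟩, ⟨continuous_avgOsc hw hρ0 hA hh' hg, fun x ξ => ?_⟩,
    fun x x' ξ => ?_⟩
  · refine (norm_weighted_integral_le hW fun θ hθ => (h1 θ hθ x ξ).2).trans ?_
    have := jap_rpow_pos ξ (m + m')
    calc W * (C * jap ξ ^ (m + m')) = (W * C) * jap ξ ^ (m + m') := by ring
      _ ≤ (W * C + W * C') * jap ξ ^ (m + m') := by
        gcongr
        linarith [mul_nonneg hW0 hC']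
  · have hint : ∀ x, IntervalIntegrable (fun θ => (w θ : ℂ) * osc θ h g x ξ) volume 0 1 := fun x =>
      Continuous.intervalIntegrable (Continuous.mul (by fun_prop)
        (Continuous.osc continuous_id continuous_const continuous_const hρ0 hA hh' hg)) _ _
    rw [avgOsc, avgOsc, ← intervalIntegral.integral_sub (hint x) (hint x')]
    simp_rw [← mul_sub]
    refine (norm_weighted_integral_le hW fun θ hθ => h2 θ hθ x x' ξ).trans ?_
    have h3 : 0 ≤ jap ξ ^ (m + m' + δ * τ) * ‖x - x'‖ ^ τ :=
      mul_nonneg (jap_rpow_pos _ _).le (Real.rpow_nonneg (norm_nonneg _) _)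
    rw [← mul_assoc]
    refine mul_le_mul_of_nonneg_right ?_ h3
    change W * C' ≤ W * C + W * C'
    linarith [mul_nonneg hW0 hC]

theorem avgOsc_PV (hw : Continuous w) (hδ : 0 ≤ δ) (hδρ : δ < ρ) (hρ : ρ ≤ 1)
    (hA : ((n + 1 : ℕ) : ℕ∞) ≤ A)
    (hh : Sym ρ δ PS A r m h) (hg : Sym ρ δ PV A' ⊤ m' g) : PV (m + m') (avgOsc w h g) := by
  have hρ0 : 0 ≤ ρ := by linarith
  obtain ⟨W, hW0, hW⟩ := exists_weight_bound hw
  obtain ⟨c, hc, h1⟩ := osc_PV hδ hδρ hρ hA hh hg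
  refine ⟨⟨_, hc.const_mul W⟩, continuous_avgOsc hw hρ0 hA hh (hg.weaken fun _ _ => PV.toPS),
    fun x ξ => ?_⟩
  refine (norm_weighted_integral_le hW fun θ hθ => h1 θ hθ x ξ).trans (le_of_eq ?_)
  ring

theorem avgOsc_hasPd_xi (hw : Continuous w) (hρ : 0 ≤ ρ) (hA : ((n + 1 + 1 : ℕ) : ℕ∞) ≤ A)
    (hA' : 1 ≤ A') (hh : Sym ρ δ PS A r m h) (hg : Sym ρ δ PS A' ⊤ m' g) (j : Fin n) (x : E n) :
    HasPd j (avgOsc w h g x) ∧ pd j (avgOsc w h g x) =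
      fun ξ => avgOsc w (pxi j h) g x ξ + avgOsc w h (pxi j g) x ξ := by
  have hA1 : ((n + 1 : ℕ) : ℕ∞) ≤ A := le_trans (by exact_mod_cast Nat.le_succ _) hA
  have hA2 := pred_le_pred hA
  have hh' := hh.pxi (one_le_of_succ_le hA) j
  have hg' := hg.pxi hA' j
  refine HasPd.of_has fun ξ => ?_
  have hc : ∀ {A A' : ℕ∞} {m m' : ℝ} {h g : E n → E n → ℂ}, ((n + 1 : ℕ) : ℕ∞) ≤ A →
      Sym ρ δ PS A r m h → Sym ρ δ PS A' ⊤ m' g →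
      Continuous fun p : ℝ × ℝ => osc p.1 h g x (ξ + p.2 • bv j) := fun hA hh hg =>
    Continuous.osc (by fun_prop) continuous_const (by fun_prop) hρ hA hh hg
  have hwc : Continuous fun p : ℝ × ℝ => (w p.1 : ℂ) := by fun_prop
  have key := hasDerivAt_intervalIntegral (Φ := fun θ t => (w θ : ℂ) * osc θ h g x (ξ + t • bv j))
    (Ψ := fun θ t => (w θ : ℂ) * (osc θ (pxi j h) g x (ξ + t • bv j) +
      osc θ h (pxi j g) x (ξ + t • bv j)))
    (hwc.mul (hc hA1 hh hg)) (hwc.mul ((hc hA2 hh' hg).add (hc hA1 hh hg'))) (fun θ t => by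
      have h1 := osc_hasPd_xi hρ hA hA' hh hg θ j x
      have h2 := h1.1.hasDerivAt ξ t
      rw [h1.2] at h2
      exact h2.const_mul (w θ : ℂ)) 0
  rw [zero_smul, add_zero] at key
  refine HasDerivAt.congr_deriv key ?_
  simp_rw [mul_add]
  have hint : ∀ {A A' : ℕ∞} {m m' : ℝ} {h g : E n → E n → ℂ}, ((n + 1 : ℕ) : ℕ∞) ≤ A →
      Sym ρ δ PS A r m h → Sym ρ δ PS A' ⊤ m' g →
      IntervalIntegrable (fun θ => (w θ : ℂ) * osc θ h g x ξ) volume 0 1 := fun hA hh hg =>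
    Continuous.intervalIntegrable (Continuous.mul (by fun_prop)
      (Continuous.osc continuous_id continuous_const continuous_const hρ hA hh hg)) _ _
  exact intervalIntegral.integral_add (hint hA2 hh' hg) (hint hA1 hh hg')

theorem avgOsc_hasPd_x (hw : Continuous w) (hρ : 0 ≤ ρ) (hA : ((n + 1 : ℕ) : ℕ∞) ≤ A)
    (hr : 1 ≤ r) (hh : Sym ρ δ PS A r m h) (hg : Sym ρ δ PS A' ⊤ m' g) (i : Fin n) (ξ : E n) :
    HasPd i (fun x => avgOsc w h g x ξ) ∧ pd i (fun x => avgOsc w h g x ξ) =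
      fun x => avgOsc w (px i h) g x ξ + avgOsc w h (px i g) x ξ := by
  have hh' := hh.px hr i
  have hg' : Sym ρ δ PS A' ⊤ (m' + δ) (px i g) := hg.px le_top i
  refine HasPd.of_has fun x => ?_
  have hc : ∀ {r A' : ℕ∞} {m m' : ℝ} {h g : E n → E n → ℂ},
      Sym ρ δ PS A r m h → Sym ρ δ PS A' ⊤ m' g →
      Continuous fun p : ℝ × ℝ => osc p.1 h g (x + p.2 • bv i) ξ := fun hh hg =>
    Continuous.osc (by fun_prop) (by fun_prop) continuous_const hρ hA hh hg
  have hwc : Continuous fun p : ℝ × ℝ => (w p.1 : ℂ) := by fun_prop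
  have key := hasDerivAt_intervalIntegral (Φ := fun θ t => (w θ : ℂ) * osc θ h g (x + t • bv i) ξ)
    (Ψ := fun θ t => (w θ : ℂ) * (osc θ (px i h) g (x + t • bv i) ξ +
      osc θ h (px i g) (x + t • bv i) ξ))
    (hwc.mul (hc hh hg)) (hwc.mul ((hc hh' hg).add (hc hh hg'))) (fun θ t => by
      have h1 := osc_hasPd_x hρ hA hr hh hg θ i ξ
      have h2 := h1.1.hasDerivAt x t
      rw [h1.2] at h2
      exact h2.const_mul (w θ : ℂ)) 0
  rw [zero_smul, add_zero] at key
  refine HasDerivAt.congr_deriv key ?_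
  simp_rw [mul_add]
  have hint : ∀ {r A' : ℕ∞} {m m' : ℝ} {h g : E n → E n → ℂ},
      Sym ρ δ PS A r m h → Sym ρ δ PS A' ⊤ m' g →
      IntervalIntegrable (fun θ => (w θ : ℂ) * osc θ h g x ξ) volume 0 1 := fun hh hg =>
    Continuous.intervalIntegrable (Continuous.mul (by fun_prop)
      (Continuous.osc continuous_id continuous_const continuous_const hρ hA hh hg)) _ _
  exact intervalIntegral.integral_add (hint hh' hg) (hint hh hg')

theorem succ_le_of_add_le {A A₀ : ℕ∞} (hA : 1 ≤ A) (h : A + ((n + 1 : ℕ) : ℕ∞) ≤ A₀) :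
    A - 1 + ((n + 1 : ℕ) : ℕ∞) ≤ A₀ - 1 :=
  ENat.le_sub_of_add_le_right (by simp) (by rwa [add_right_comm, tsub_add_cancel_of_le hA])

/-- The product rule yields two averages with the same weight and one factor differentiated, so the
family of averages is stable under differentiation and only the estimate `hbase` is needed. `A₀`
keeps n + 1 derivatives of `h` in reserve at every stage. -/
theorem symD_avgOsc {Ph Pg P : ℝ → (E n → E n → ℂ) → Prop} (hw : Continuous w) (hρ : 0 ≤ ρ)
    (hPh : ∀ m a, Ph m a → PS m a) (hPg : ∀ m a, Pg m a → PS m a)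
    (hadd : ∀ m a b, P m a → P m b → P m (fun x ξ => a x ξ + b x ξ))
    (hbase : ∀ (A r A' : ℕ∞) (m m' : ℝ) (h g : E n → E n → ℂ), ((n + 1 : ℕ) : ℕ∞) ≤ A →
      Sym ρ δ Ph A r m h → Sym ρ δ Pg A' ⊤ m' g → P (m + m') (avgOsc w h g))
    (s : ℕ) {A A₀ r A' : ℕ∞} {m m' : ℝ} {h g : E n → E n → ℂ}
    (hh : Sym ρ δ Ph A₀ r m h) (hg : Sym ρ δ Pg A' ⊤ m' g)
    (hA₀ : A + ((n + 1 : ℕ) : ℕ∞) ≤ A₀) (hA' : A ≤ A') :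
    SymD ρ δ P s A r (m + m') (avgOsc w h g) := by
  have hb : ∀ {A A₀ r A' : ℕ∞} {m m' : ℝ} {h g : E n → E n → ℂ}, Sym ρ δ Ph A₀ r m h →
      Sym ρ δ Pg A' ⊤ m' g → A + ((n + 1 : ℕ) : ℕ∞) ≤ A₀ → P (m + m') (avgOsc w h g) :=
    fun hh hg hA => hbase _ _ _ _ _ _ _ (le_trans le_add_self hA) hh hg
  induction s generalizing A A₀ r A' m m' h g with
  | zero => exact hb hh hg hA₀
  | succ s ih =>
    have hn : ((n + 1 : ℕ) : ℕ∞) ≤ A₀ := le_trans le_add_self hA₀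
    refine ⟨hb hh hg hA₀, fun hA j => ?_, fun hr i => ?_⟩
    · have h2 : ((n + 1 + 1 : ℕ) : ℕ∞) ≤ A₀ := by
        refine le_trans ?_ hA₀
        push_cast
        rw [add_comm]
        gcongr
      have h1 := fun x => avgOsc_hasPd_xi hw hρ h2 (hA.trans hA') (hh.weaken hPh) (hg.weaken hPg) j x
      refine ⟨fun x => (h1 x).1, ?_⟩
      have e : pxi j (avgOsc w h g) = fun x ξ => avgOsc w (pxi j h) g x ξ +
          avgOsc w h (pxi j g) x ξ := funext fun x => (h1 x).2
      rw [e]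
      have e1 := ih (hh.pxi (one_le_of_succ_le hn) j) hg (succ_le_of_add_le hA hA₀)
        (tsub_le_self.trans hA')
      have e2 := ih (A := A - 1) hh (hg.pxi (hA.trans hA') j)
        (le_trans (by gcongr; exact tsub_le_self) hA₀) (tsub_le_tsub_right hA' 1)
      rw [show m - ρ + m' = m + m' - ρ by ring] at e1
      rw [show m + (m' - ρ) = m + m' - ρ by ring] at e2
      exact e1.add hadd e2
    · have h1 := fun ξ => avgOsc_hasPd_x hw hρ hn hr (hh.weaken hPh) (hg.weaken hPg) i ξ
      refine ⟨fun ξ => (h1 ξ).1, ?_⟩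
      have e : px i (avgOsc w h g) = fun x ξ => avgOsc w (px i h) g x ξ +
          avgOsc w h (px i g) x ξ := funext fun x => funext fun ξ => congrFun (h1 ξ).2 x
      rw [e]
      have e1 := ih (hh.px hr i) hg hA₀ hA'
      have hg2 : Sym ρ δ Pg A' ⊤ (m' + δ) (px i g) := hg.px le_top i
      have e2 := (ih hh hg2 hA₀ hA').of_le le_rfl (tsub_le_self (a := r) (b := 1))
      rw [show m + δ + m' = m + m' + δ by ring] at e1
      rw [show m + (m' + δ) = m + m' + δ by ring] at e2
      exact e1.add hadd e2

theorem sym_avgOsc_PH (hw : Continuous w) (hδ : 0 ≤ δ) (hδρ : δ < ρ) (hρ : ρ ≤ 1) (hτ0 : 0 ≤ τ)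
    (hτ : τ ≤ 1) {A₀ : ℕ∞} (hh : Sym ρ δ (PH δ τ) A₀ r m h) (hg : Sym ρ δ PS A' ⊤ m' g)
    (hA₀ : A + ((n + 1 : ℕ) : ℕ∞) ≤ A₀) (hA' : A ≤ A') :
    Sym ρ δ (PH δ τ) A r (m + m') (avgOsc w h g) := fun s =>
  symD_avgOsc hw (by linarith) (fun _ _ => PH.toPS) (fun _ _ h => h) PH.add
    (fun _ _ _ _ _ _ _ hA hh hg => avgOsc_PH hw hδ hδρ hρ hτ0 hτ hA hh hg) s hh hg hA₀ hA'

theorem sym_avgOsc_PV (hw : Continuous w) (hδ : 0 ≤ δ) (hδρ : δ < ρ) (hρ : ρ ≤ 1)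
    {A₀ : ℕ∞} (hh : Sym ρ δ PS A₀ r m h) (hg : Sym ρ δ PV A' ⊤ m' g)
    (hA₀ : A + ((n + 1 : ℕ) : ℕ∞) ≤ A₀) (hA' : A ≤ A') :
    Sym ρ δ PV A r (m + m') (avgOsc w h g) := fun s =>
  symD_avgOsc hw (by linarith) (fun _ _ h => h) (fun _ _ => PV.toPS) PV.add
    (fun _ _ _ _ _ _ _ hA hh hg => avgOsc_PV hw hδ hδρ hρ hA hh hg) s hh hg hA₀ hA'

end NonsmoothPDO

namespace NonsmoothPDO

variable {n : ℕ}

/-! ### Calculus of multi-indices -/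

@[simp] theorem len_add_single (α : Fin n → ℕ) (j : Fin n) : len (α + Pi.single j 1) = len α + 1 := by
  simp [len, Finset.sum_add_distrib]

@[simp] theorem len_zero : len (0 : Fin n → ℕ) = 0 := by simp [len]

theorem eq_zero_of_len {α : Fin n → ℕ} (h : len α = 0) : α = 0 := by
  funext i
  exact (Finset.sum_eq_zero_iff.1 h) i (Finset.mem_univ i)

theorem exists_eq_add_single {α : Fin n → ℕ} {k : ℕ} (h : len α = k + 1) :
    ∃ (α' : Fin n → ℕ) (j : Fin n), len α' = k ∧ α = α' + Pi.single j 1 := by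
  obtain ⟨j, hj⟩ : ∃ j, α j ≠ 0 := by
    by_contra! h0
    have : len α = 0 := by simp [len, h0]
    omega
  have e : α = (α - Pi.single j 1) + Pi.single j 1 := by
    refine (tsub_add_cancel_of_le ?_).symm
    intro i
    by_cases hij : i = j
    · subst hij; simp; omega
    · simp [hij]
  refine ⟨α - Pi.single j 1, j, ?_, e⟩
  have := len_add_single (α - Pi.single j 1) j
  rw [← e] at this
  omega

@[simp] theorem mpd_zero (f : E n → ℂ) : mpd 0 f = f := by
  have : ∀ l : List (Fin n), l.foldr (fun i g => (pd i)^[(0 : Fin n → ℕ) i] g) f = f := by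
    intro l
    induction l with
    | nil => rfl
    | cons i l ih => rw [List.foldr_cons, ih]; rfl
  exact this _

theorem contDiff_mpd {α : Fin n → ℕ} {k : ℕ} {f : E n → ℂ} (hf : ContDiff ℝ (k + len α : ℕ) f) :
    ContDiff ℝ k (mpd α f) :=
  foldr_op pd (fun k g => ContDiff ℝ k g) (fun _ _ i h => contDiff_pd h i) α _ k f
    (by rwa [sum_map_finRange])

theorem pd_iterate_comm {p : ℕ} {f : E n → ℂ} (hf : ContDiff ℝ (p + 1 : ℕ) f) (i j : Fin n) :
    pd j ((pd i)^[p] f) = (pd i)^[p] (pd j f) := by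
  induction p generalizing f with
  | zero => rfl
  | succ p ih =>
    rw [Function.iterate_succ_apply, Function.iterate_succ_apply, ih (contDiff_pd hf i),
      pd_comm (hf.of_le (by norm_cast; omega))]

/-- The order of differentiation in `mpd` is fixed, so ∂_j has to be moved past other coordinates to
its own slot; `len α + 1` continuous derivatives permit every commutation. -/
theorem pd_mpd {α : Fin n → ℕ} {f : E n → ℂ} (hf : ContDiff ℝ (len α + 1 : ℕ) f) (j : Fin n) :
    pd j (mpd α f) = mpd (α + Pi.single j 1) f := by
  have hlist : ∀ l : List (Fin n), j ∉ l →
      l.foldr (fun i g => (pd i)^[(α + Pi.single j 1 : Fin n → ℕ) i] g) f =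
        l.foldr (fun i g => (pd i)^[α i] g) f := by
    intro l
    induction l with
    | nil => exact fun _ => rfl
    | cons i l ih =>
      intro hj
      rw [List.mem_cons, not_or] at hj
      rw [List.foldr_cons, List.foldr_cons, ih hj.2]
      simp [Ne.symm hj.1]
  have key : ∀ l : List (Fin n), l.Nodup → j ∈ l → ContDiff ℝ ((l.map α).sum + 1 : ℕ) f →
      pd j (l.foldr (fun i g => (pd i)^[α i] g) f) =
        l.foldr (fun i g => (pd i)^[(α + Pi.single j 1 : Fin n → ℕ) i] g) f := by
    intro l
    induction l with
    | nil => simp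
    | cons i l ih =>
      intro hl hj hf
      rw [List.nodup_cons] at hl
      rw [List.map_cons, List.sum_cons] at hf
      rw [List.foldr_cons, List.foldr_cons]
      by_cases hij : j = i
      · subst hij
        rw [hlist l hl.1]
        simp only [Pi.add_apply, Pi.single_eq_same]
        rw [Function.iterate_succ_apply']
      · have hj' : j ∈ l := by simpa [hij] using hj
        have h1 : ContDiff ℝ (α i + 1 : ℕ) (l.foldr (fun i g => (pd i)^[α i] g) f) :=
          foldr_op pd (fun k g => ContDiff ℝ k g) (fun _ _ i h => contDiff_pd h i) α l _ f
            (by convert hf using 2; omega)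
        rw [pd_iterate_comm h1, ih hl.2 hj' (hf.of_le (by norm_cast; omega))]
        simp [Ne.symm hij]
  refine key _ (List.nodup_finRange n) (List.mem_finRange j) ?_
  rwa [sum_map_finRange]

theorem pd_const_mul (c : ℂ) (f : E n → ℂ) (i : Fin n) :
    pd i (fun x => c * f x) = fun x => c * pd i f x := by
  funext x
  exact deriv_const_mul_field c

theorem mpd_const_mul (c : ℂ) (f : E n → ℂ) (α : Fin n → ℕ) :
    mpd α (fun x => c * f x) = fun x => c * mpd α f x := by
  have hit : ∀ (i : Fin n) (p : ℕ) (f : E n → ℂ),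
      (pd i)^[p] (fun x => c * f x) = fun x => c * (pd i)^[p] f x := by
    intro i p
    induction p with
    | zero => exact fun f => rfl
    | succ p ih =>
      intro f
      rw [Function.iterate_succ_apply, pd_const_mul, ih]
      rfl
  have : ∀ l : List (Fin n), l.foldr (fun i g => (pd i)^[α i] g) (fun x => c * f x) =
      fun x => c * l.foldr (fun i g => (pd i)^[α i] g) f x := by
    intro l
    induction l with
    | nil => rfl
    | cons i l ih => rw [List.foldr_cons, ih, hit]; rfl
  exact this _

/-! ### Symmetry of mixed derivatives -/

/-- Schwarz's theorem when only one mixed derivative z = ∂_t∂_sφ is known to exist. The fundamental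
theorem and Fubini give ∫₀ᵗ (a(t',s) - a(t',0)) dt' = ∫₀ᵗ∫₀ˢ z; differentiating in t and then in s
gives ∂_s a = z. -/
theorem hasDerivAt_mixed {φ a b z : ℝ → ℝ → ℂ} (ha : ∀ t s, HasDerivAt (fun t => φ t s) (a t s) t)
    (hb : ∀ t s, HasDerivAt (φ t) (b t s) s) (hz : ∀ t s, HasDerivAt (fun t => b t s) (z t s) t)
    (hac : Continuous (Function.uncurry a)) (hbc : Continuous (Function.uncurry b))
    (hzc : Continuous (Function.uncurry z)) (t s : ℝ) : HasDerivAt (a t) (z t s) s := by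
  have ha1 : ∀ s, Continuous fun t => a t s := fun s => hac.comp (by fun_prop : Continuous fun t : ℝ => (t, s))
  have hb1 : ∀ t, Continuous fun s => b t s := fun t => hbc.comp (by fun_prop : Continuous fun s : ℝ => (t, s))
  have hz1 : ∀ s, Continuous fun t => z t s := fun s => hzc.comp (by fun_prop : Continuous fun t : ℝ => (t, s))
  have hz2 : ∀ t, Continuous fun s => z t s := fun t => hzc.comp (by fun_prop : Continuous fun s : ℝ => (t, s))
  have hzs : ∀ s, Continuous fun t => ∫ s' in (0 : ℝ)..s, z t s' := fun s =>
    intervalIntegral.continuous_parametric_intervalIntegral_of_continuous' hzc 0 s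
  have e1 : ∀ s t, ∫ t' in (0 : ℝ)..t, (a t' s - a t' 0) =
      ∫ t' in (0 : ℝ)..t, ∫ s' in (0 : ℝ)..s, z t' s' := by
    intro s t
    rw [intervalIntegral.integral_sub ((ha1 s).intervalIntegrable _ _)
      ((ha1 0).intervalIntegrable _ _),
      intervalIntegral.integral_eq_sub_of_hasDerivAt (fun t' _ => ha t' s)
        ((ha1 s).intervalIntegrable _ _),
      intervalIntegral.integral_eq_sub_of_hasDerivAt (fun t' _ => ha t' 0)
        ((ha1 0).intervalIntegrable _ _)]
    have h1 : ∫ t' in (0 : ℝ)..t, ∫ s' in (0 : ℝ)..s, z t' s' =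
        ∫ s' in (0 : ℝ)..s, ∫ t' in (0 : ℝ)..t, z t' s' := by
      refine intervalIntegral_intervalIntegral_swap ?_
      exact (hzc.continuousOn.integrableOn_compact (isCompact_uIcc.prod isCompact_uIcc)).mono_set
        (Set.prod_mono Set.uIoc_subset_uIcc Set.uIoc_subset_uIcc)
    rw [h1]
    have h2 : ∀ s', ∫ t' in (0 : ℝ)..t, z t' s' = b t s' - b 0 s' := fun s' =>
      intervalIntegral.integral_eq_sub_of_hasDerivAt (fun t' _ => hz t' s')
        ((hz1 s').intervalIntegrable _ _)
    simp_rw [h2]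
    rw [intervalIntegral.integral_sub ((hb1 t).intervalIntegrable _ _)
      ((hb1 0).intervalIntegrable _ _),
      intervalIntegral.integral_eq_sub_of_hasDerivAt (fun s' _ => hb t s')
        ((hb1 t).intervalIntegrable _ _),
      intervalIntegral.integral_eq_sub_of_hasDerivAt (fun s' _ => hb 0 s')
        ((hb1 0).intervalIntegrable _ _)]
    ring
  have e2 : ∀ s, a t s = a t 0 + ∫ s' in (0 : ℝ)..s, z t s' := by
    intro s
    have hd : Continuous fun t => a t s - a t 0 := (ha1 s).sub (ha1 0)
    have h1 := intervalIntegral.integral_hasDerivAt_right (hd.intervalIntegrable 0 t)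
      (hd.stronglyMeasurableAtFilter _ _) hd.continuousAt
    have h2 := intervalIntegral.integral_hasDerivAt_right ((hzs s).intervalIntegrable 0 t)
      ((hzs s).stronglyMeasurableAtFilter _ _) (hzs s).continuousAt
    rw [funext (e1 s)] at h1
    have := h1.unique h2
    rw [← this]
    ring
  have e3 : a t = fun s => a t 0 + ∫ s' in (0 : ℝ)..s, z t s' := funext e2
  rw [e3]
  exact (intervalIntegral.integral_hasDerivAt_right ((hz2 t).intervalIntegrable _ _)
    ((hz2 t).stronglyMeasurableAtFilter _ _) (hz2 t).continuousAt).const_add _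

theorem hasPd_mixed {u v w z : E n → E n → ℂ} {i j : Fin n}
    (hv : ∀ ξ, HasPd i (fun x => u x ξ)) (ev : px i u = v) (hw : ∀ x, HasPd j (u x))
    (ew : pxi j u = w) (hz : ∀ ξ, HasPd i (fun x => w x ξ)) (ez : px i w = z)
    (hvc : Continuous (Function.uncurry v)) (hwc : Continuous (Function.uncurry w))
    (hzc : Continuous (Function.uncurry z)) : (∀ x, HasPd j (v x)) ∧ pxi j v = z := by
  have h : ∀ x, HasPd j (v x) ∧ pd j (v x) = z x := fun x => HasPd.of_has fun ξ => by
    have hc : ∀ {f : E n → E n → ℂ}, Continuous (Function.uncurry f) →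
        Continuous fun p : ℝ × ℝ => f (x + p.1 • bv i) (ξ + p.2 • bv j) := fun hf =>
      hf.comp (f := fun p : ℝ × ℝ => (x + p.1 • bv i, ξ + p.2 • bv j)) (by fun_prop)
    have key := hasDerivAt_mixed (φ := fun t s => u (x + t • bv i) (ξ + s • bv j))
      (a := fun t s => v (x + t • bv i) (ξ + s • bv j))
      (b := fun t s => w (x + t • bv i) (ξ + s • bv j))
      (z := fun t s => z (x + t • bv i) (ξ + s • bv j))
      (fun t s => by rw [← ev]; exact (hv _).hasDerivAt x t)
      (fun t s => by rw [← ew]; exact (hw _).hasDerivAt ξ s)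
      (fun t s => by rw [← ez]; exact (hz _).hasDerivAt x t) (hc hvc) (hc hwc) (hc hzc) 0 0
    simp only [zero_smul, add_zero] at key
    exact key
  exact ⟨fun x => (h x).1, funext fun x => (h x).2⟩

end NonsmoothPDO

namespace NonsmoothPDO

variable {n : ℕ}

/-! ### Mixed derivatives of symbols -/

/-- All derivatives of order `≤ A` in `ξ` and `≤ r` in `x` exist, and the mixed ones are
continuous. -/
structure MixedReg (A r : ℕ∞) (a : E n → E n → ℂ) : Prop where
  contDiff_x : ∀ α : Fin n → ℕ, (len α : ℕ∞) ≤ A → ∀ ξ (k : ℕ), (k : ℕ∞) ≤ r →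
    ContDiff ℝ k (fun x => dxi α a x ξ)
  contDiff_xi : ∀ β : Fin n → ℕ, (len β : ℕ∞) ≤ r → ∀ x (k : ℕ), (k : ℕ∞) ≤ A →
    ContDiff ℝ k (dx β a x)
  continuous : ∀ α β : Fin n → ℕ, (len α : ℕ∞) ≤ A → (len β : ℕ∞) ≤ r →
    Continuous (Function.uncurry (dx β (dxi α a)))

@[simp] theorem dxi_zero (a : E n → E n → ℂ) : dxi 0 a = a := by
  funext x ξ; simp [dxi]

@[simp] theorem dx_zero (a : E n → E n → ℂ) : dx 0 a = a := by
  funext x ξ; simp [dx]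

namespace MixedReg

variable {A r : ℕ∞} {a : E n → E n → ℂ}

theorem px_dx (h : MixedReg A r a) {α β : Fin n → ℕ} (hα : (len α : ℕ∞) ≤ A)
    (hβ : ((len β + 1 : ℕ) : ℕ∞) ≤ r) (i : Fin n) :
    (∀ ξ, HasPd i (fun x => dx β (dxi α a) x ξ)) ∧
      px i (dx β (dxi α a)) = dx (β + Pi.single i 1) (dxi α a) := by
  have h1 := fun ξ => h.contDiff_x α hα ξ _ hβ
  refine ⟨fun ξ => ?_, ?_⟩
  · have h2 : ContDiff ℝ (1 : ℕ) (mpd β fun x => dxi α a x ξ) :=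
      contDiff_mpd (by rw [add_comm]; exact h1 ξ)
    exact HasPd.of_differentiable (h2.differentiable (by simp)) i
  · funext x ξ
    exact congrFun (pd_mpd (h1 ξ) i) x

theorem pxi_dxi (h : MixedReg A r a) {α β : Fin n → ℕ} (hα : ((len α + 1 : ℕ) : ℕ∞) ≤ A)
    (hβ : (len β : ℕ∞) ≤ r) (j : Fin n) :
    (∀ x, HasPd j (dxi α (dx β a) x)) ∧
      pxi j (dxi α (dx β a)) = dxi (α + Pi.single j 1) (dx β a) := by
  have h1 := fun x => h.contDiff_xi β hβ x _ hα
  refine ⟨fun x => ?_, ?_⟩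
  · have h2 : ContDiff ℝ (1 : ℕ) (mpd α (dx β a x)) :=
      contDiff_mpd (by rw [add_comm]; exact h1 x)
    exact HasPd.of_differentiable (h2.differentiable (by simp)) j
  · funext x ξ
    exact congrFun (pd_mpd (h1 x) j) ξ

theorem le_of_succ_le {k : ℕ} (h : ((k + 1 : ℕ) : ℕ∞) ≤ A) : (k : ℕ∞) ≤ A :=
  le_trans (by exact_mod_cast Nat.le_succ k) h

/-- Induction on |α| removes one ξ-derivative; an inner induction on |β| carries it across the
x-derivatives one at a time by `hasPd_mixed`. -/
theorem comm (h : MixedReg A r a) {α β : Fin n → ℕ} (hα : (len α : ℕ∞) ≤ A)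
    (hβ : (len β : ℕ∞) ≤ r) : dx β (dxi α a) = dxi α (dx β a) := by
  obtain ⟨k, hk⟩ : ∃ k, len α = k := ⟨_, rfl⟩
  induction k generalizing α β with
  | zero => rw [eq_zero_of_len hk, dxi_zero, dxi_zero]
  | succ k ih =>
    obtain ⟨α', j, hk', rfl⟩ := exists_eq_add_single hk
    rw [len_add_single] at hα
    have hα' := le_of_succ_le hα
    have key : ∀ l (β : Fin n → ℕ), len β = l → (len β : ℕ∞) ≤ r →
        (∀ x, HasPd j (dx β (dxi α' a) x)) ∧
          pxi j (dx β (dxi α' a)) = dx β (dxi (α' + Pi.single j 1) a) := by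
      intro l
      induction l with
      | zero =>
        intro β hl hβ
        have := h.pxi_dxi hα hβ j
        rw [eq_zero_of_len hl] at this ⊢
        simpa using this
      | succ l ihl =>
        intro β hl hβ
        obtain ⟨β', i, hl', rfl⟩ := exists_eq_add_single hl
        have hβ' : (len β' : ℕ∞) ≤ r := le_of_succ_le (by rwa [len_add_single] at hβ)
        have h0 := ihl β' hl' hβ'
        have hα2 : (len (α' + Pi.single j 1) : ℕ∞) ≤ A := by rwa [len_add_single]
        have h1 := h.px_dx hα' (by rwa [len_add_single] at hβ) i
        have h2 := h.px_dx hα2 (by rwa [len_add_single] at hβ) i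
        exact hasPd_mixed h1.1 h1.2 h0.1 h0.2 h2.1 h2.2 (h.continuous _ _ hα' hβ)
          (h.continuous _ _ hα2 hβ') (h.continuous _ _ hα2 hβ)
    rw [← (key _ β rfl hβ).2, ← (h.pxi_dxi hα hβ j).2, ih hα' hβ hk']

theorem sub_le_of_one_le {k : ℕ} {A : ℕ∞} (hA : (k : ℕ∞) ≤ A) (h : 1 ≤ A - k) :
    ((k + 1 : ℕ) : ℕ∞) ≤ A := by
  have h1 : ((1 : ℕ) : ℕ∞) + k ≤ A - k + k := by gcongr; exact_mod_cast h
  rw [tsub_add_cancel_of_le hA] at h1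
  rw [Nat.add_comm]
  exact_mod_cast h1

/-- Estimates of the mixed derivatives give membership in a symbol class. -/
theorem sym {ρ δ m : ℝ} {P : ℝ → (E n → E n → ℂ) → Prop} (h : MixedReg A r a) {b : ℕ}
    (hP : ∀ α β : Fin n → ℕ, (len α : ℕ∞) ≤ A → (len β : ℕ∞) ≤ r → b ≤ len β →
      P (m - ρ * len α + δ * len β) (dx β (dxi α a)))
    {α β : Fin n → ℕ} (hα : (len α : ℕ∞) ≤ A) (hβ : (len β : ℕ∞) ≤ r) (hb : b ≤ len β) :
    Sym ρ δ P (A - len α) (r - len β) (m - ρ * len α + δ * len β) (dx β (dxi α a)) := by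
  intro s
  induction s generalizing α β with
  | zero => exact hP α β hα hβ hb
  | succ s ih =>
    refine ⟨hP α β hα hβ hb, fun hA j => ?_, fun hr i => ?_⟩
    · have hα' := sub_le_of_one_le hα hA
      have h1 := h.pxi_dxi hα' hβ j
      have hα2 : (len (α + Pi.single j 1) : ℕ∞) ≤ A := by rwa [len_add_single]
      rw [← h.comm hα hβ, ← h.comm hα2 hβ] at h1
      refine ⟨h1.1, ?_⟩
      have h2 := ih hα2 hβ hb
      rw [h1.2]
      rw [len_add_single] at h2
      convert h2 using 1
      · push_cast; rw [tsub_tsub]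
      · push_cast; ring
    · have hβ' := sub_le_of_one_le hβ hr
      have h1 := h.px_dx hα hβ' i
      have hβ2 : (len (β + Pi.single i 1) : ℕ∞) ≤ r := by rwa [len_add_single]
      refine ⟨h1.1, ?_⟩
      have h2 := ih hα hβ2 (hb.trans (by rw [len_add_single]; omega))
      rw [h1.2]
      rw [len_add_single] at h2
      convert h2 using 1
      · push_cast; rw [tsub_tsub]
      · push_cast; ring

end MixedReg

/-! ### Smooth symbols -/

variable {m ρ δ : ℝ} {M : ℕ∞} {a : E n → E n → ℂ}

theorem IsSmoothSymbol.mixedReg (h : IsSmoothSymbol m ρ δ M a) : MixedReg M ⊤ a := by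
  have hx : ∀ α : Fin n → ℕ, (len α : ℕ∞) ≤ M → ∀ ξ (k : ℕ),
      ContDiff ℝ k (fun x => dxi α a x ξ) := fun α hα ξ k => (contDiff_infty.1 (h.contDiff_x α hα ξ)) k
  have hxi : ∀ (β : Fin n → ℕ) x (k : ℕ), (k : ℕ∞) ≤ M → ContDiff ℝ k (dx β a x) :=
    fun β x k hk => (contDiff_iff_forall_nat_le.1 (h.contDiff_xi β x)) k hk
  -- The class gives continuity of the mixed derivatives in the opposite order; with the variables
  -- exchanged, `MixedReg.comm` supplies the required one.
  have hflip : MixedReg ⊤ M (flip a) := ⟨fun β _ x k hk => hxi β x k hk,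
    fun α hα ξ k _ => hx α hα ξ k, fun β α _ hα => (h.continuous_deriv α β hα).comp continuous_swap⟩
  refine ⟨fun α hα ξ k _ => hx α hα ξ k, fun β _ x k hk => hxi β x k hk, fun α β hα _ => ?_⟩
  have h1 : dx β (dxi α a) = dxi α (dx β a) := by
    have := hflip.comm (α := β) (β := α) le_top hα
    have e := congrArg Function.swap this
    exact e.symm
  rw [h1]
  exact h.continuous_deriv α β hα

theorem IsSmoothSymbol.sym (h : IsSmoothSymbol m ρ δ M a) : Sym ρ δ PS M ⊤ m a := by
  have hr := h.mixedReg
  have h1 := hr.sym (ρ := ρ) (δ := δ) (m := m) (P := PS) (b := 0) (α := 0) (β := 0)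
    (fun α β hα hβ _ => by
      rw [hr.comm hα hβ]
      obtain ⟨C, hC⟩ := h.bound α β hα
      refine ⟨⟨max C 0, le_max_right _ _⟩, h.continuous_deriv α β hα, fun x ξ =>
        (hC x ξ).trans (mul_le_mul_of_nonneg_right (le_max_left _ _) (jap_rpow_pos _ _).le)⟩)
    (by simp) (by simp) (by simp)
  simpa using h1

theorem dxi_const_mul (c : ℂ) (α : Fin n → ℕ) (a : E n → E n → ℂ) :
    dxi α (fun x ξ => c * a x ξ) = fun x ξ => c * dxi α a x ξ := by
  funext x
  exact mpd_const_mul c (a x) α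

theorem norm_neg_I_pow (k : ℕ) : ‖(-Complex.I) ^ k‖ = 1 := by simp

theorem norm_dxi_Dx (α β : Fin n → ℕ) (a : E n → E n → ℂ) (x ξ : E n) :
    ‖dxi α (Dx β a) x ξ‖ = ‖dxi α (dx β a) x ξ‖ := by
  have : dxi α (Dx β a) = fun x ξ => (-Complex.I) ^ len β * dxi α (dx β a) x ξ := dxi_const_mul _ _ _
  rw [this, norm_mul, norm_neg_I_pow, one_mul]

theorem Sym.const_mul {P : ℝ → (E n → E n → ℂ) → Prop} {A r : ℕ∞} (c : ℂ)
    (hP : ∀ m a, P m a → P m (fun x ξ => c * a x ξ)) (h : Sym ρ δ P A r m a) :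
    Sym ρ δ P A r m (fun x ξ => c * a x ξ) := fun s => (h s).const_mul c hP

theorem PS.const_mul (k : ℂ) (m : ℝ) (a : E n → E n → ℂ) (h : PS m a) :
    PS m (fun x ξ => k * a x ξ) := by
  obtain ⟨c, h⟩ := h
  exact ⟨‖k‖₊ * c, by simpa using! h.const_mul k⟩

/-- Decay is available only after at least one x-derivative, hence `b = 1` and a start at β = γ ≠ 0;
further differentiation preserves the condition. -/
theorem IsSlowlyVaryingSymbol.sym_Dx (h : IsSlowlyVaryingSymbol m ρ δ M a) {γ : Fin n → ℕ}
    (hγ : len γ ≠ 0) : Sym ρ δ PV M ⊤ (m + δ * len γ) (Dx γ a) := by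
  have hr := h.toIsSmoothSymbol.mixedReg
  have h1 := hr.sym (ρ := ρ) (δ := δ) (m := m) (P := PV) (b := 1) (α := 0) (β := γ)
    (fun α β hα hβ hb => by
      rw [hr.comm hα hβ]
      obtain ⟨C, hC, hCb⟩ := h.decay α β hα (by omega)
      exact ⟨⟨C, hC⟩, h.continuous_deriv α β hα, fun x ξ => by
        rw [← norm_dxi_Dx]; exact hCb x ξ⟩)
    (by simp) (by simp) (by omega)
  exact Sym.const_mul _ (PV.const_mul _) (by simpa using h1)

/-! ### From recursive classes to non-smooth symbols -/

variable {P : ℝ → (E n → E n → ℂ) → Prop} {A r : ℕ∞}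

theorem Sym.contDiff_x (hP : ∀ m a, P m a → PS m a) (h : Sym ρ δ P A r m a) {k : ℕ}
    (hk : (k : ℕ∞) ≤ r) (ξ : E n) : ContDiff ℝ k (fun x => a x ξ) := by
  induction k generalizing r m a with
  | zero =>
    obtain ⟨c, hc⟩ := hP _ _ h.base
    exact contDiff_zero.2 (hc.continuous_x ξ)
  | succ k ih =>
    have h1 := one_le_of_succ_le hk
    exact contDiff_succ_of_pd (fun i => h.hasPd_x h1 i ξ) fun i => ih (h.px h1 i) (pred_le_pred hk)

theorem Sym.contDiff_xi (hP : ∀ m a, P m a → PS m a) (h : Sym ρ δ P A r m a) (x : E n) :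
    ContDiff ℝ A (a x) := by
  refine contDiff_iff_forall_nat_le.2 fun k hk => ?_
  induction k generalizing A m a with
  | zero =>
    obtain ⟨c, hc⟩ := hP _ _ h.base
    exact contDiff_zero.2 (hc.continuous_xi x)
  | succ k ih =>
    have h1 := one_le_of_succ_le hk
    exact contDiff_succ_of_pd (fun i => h.hasPd_xi h1 i x) fun i => ih (h.pxi h1 i) (pred_le_pred hk)

theorem Sym.mixedReg (hP : ∀ m a, P m a → PS m a) (h : Sym ρ δ P A r m a) : MixedReg A r a :=
  ⟨fun _ hα ξ _ hk => (h.dxi hα).contDiff_x hP hk ξ,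
    fun _ hβ x _ hk => (contDiff_iff_forall_nat_le.1 ((h.dx hβ).contDiff_xi hP x)) _ hk,
    fun _ _ hα hβ => by
      obtain ⟨c, hc⟩ := hP _ _ ((h.dxi hα).dx hβ).base
      exact hc.1⟩

theorem finite_len_le (r : ℕ) : {β : Fin n → ℕ | len β ≤ r}.Finite := by
  refine (Set.finite_Iic (fun _ : Fin n => r)).subset fun β hβ i => ?_
  exact (Finset.single_le_sum (f := β) (fun _ _ => Nat.zero_le _) (Finset.mem_univ i)).trans hβ

theorem holderNorm_le {r : ℕ} {τ : ℝ≥0} {f : E n → ℂ} {B : ℝ≥0}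
    (h1 : ∀ β : Fin n → ℕ, len β ≤ r → ∀ x, ‖mpd β f x‖ ≤ B)
    (h2 : ∀ β : Fin n → ℕ, len β ≤ r → ∀ x x', ‖mpd β f x - mpd β f x'‖ ≤ B * ‖x - x'‖ ^ (τ : ℝ)) :
    holderNorm r τ f ≤ ENNReal.ofReal (2 * B) := by
  refine iSup₂_le fun β hβ => ?_
  have e : ENNReal.ofReal (2 * B) = B + B := by
    rw [two_mul, ENNReal.ofReal_add B.coe_nonneg B.coe_nonneg, ENNReal.ofReal_coe_nnreal]
  rw [e]
  refine add_le_add (iSup_le fun x => ?_) ?_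
  · rw [enorm_eq_nnnorm]
    exact_mod_cast h1 β hβ x
  · have h3 : HolderWith B τ (mpd β f) := fun x x' => by
      have h4 := h2 β hβ x x'
      rw [← dist_eq_norm, ← dist_eq_norm] at h4
      rw [edist_dist, edist_dist, ← ENNReal.ofReal_coe_nnreal (p := B),
        ENNReal.ofReal_rpow_of_nonneg dist_nonneg τ.coe_nonneg,
        ← ENNReal.ofReal_mul B.coe_nonneg]
      exact ENNReal.ofReal_le_ofReal h4
    exact h3.eHolderNorm_le

theorem Sym.isHolderSymbol {r : ℕ} {τ : ℝ≥0} (hδ : 0 ≤ δ) (h : Sym ρ δ (PH δ τ) A r m a) :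
    IsHolderSymbol r τ m ρ δ A a := by
  have hP : ∀ m (a : E n → E n → ℂ), PH δ τ m a → PS m a := fun _ _ => PH.toPS
  have hr := h.mixedReg hP
  refine ⟨fun α hα ξ => hr.contDiff_x α hα ξ r le_rfl,
    fun β hβ x => (h.dx (by exact_mod_cast hβ)).contDiff_xi hP x,
    fun α β hα hβ => hr.continuous α β hα (by exact_mod_cast hβ), fun α hα => ?_, fun α hα => ?_⟩
  · obtain ⟨c, hc, -⟩ := (h.dxi hα).base
    exact ⟨c, hc.2⟩
  · have h1 : ∀ β : Fin n → ℕ, ∃ c : ℝ≥0, len β ≤ r →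
        PHc δ τ c (m - ρ * len α + δ * len β) (NonsmoothPDO.dx β (NonsmoothPDO.dxi α a)) := fun β => by
      by_cases hβ : len β ≤ r
      · obtain ⟨c, hc⟩ := ((h.dxi hα).dx (β := β) (by exact_mod_cast hβ)).base
        exact ⟨c, fun _ => hc⟩
      · exact ⟨0, fun h => absurd h hβ⟩
    choose c hc using h1
    obtain ⟨C, hC⟩ := ((finite_len_le (n := n) r).image c).bddAbove
    have hC' : ∀ β : Fin n → ℕ, len β ≤ r → (c β : ℝ) ≤ C := fun β hβ => by
      exact_mod_cast hC ⟨β, hβ, rfl⟩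
    refine ⟨2 * C, fun ξ => ?_⟩
    have hj := jap_rpow_pos ξ (m - ρ * len α + δ * (r + τ))
    -- Used with `t = 0` for the supremum and with `t = δ * τ` for the Hölder quotient.
    have hle : ∀ (β : Fin n → ℕ), len β ≤ r → ∀ t : ℝ, t ≤ δ * τ →
        c β * jap ξ ^ (m - ρ * len α + δ * len β + t) ≤
          C * jap ξ ^ (m - ρ * len α + δ * (r + τ)) := fun β hβ t ht => by
      refine mul_le_mul (hC' β hβ) (jap_rpow_mono ξ ?_) (jap_rpow_pos _ _).le C.coe_nonneg
      have : δ * len β ≤ δ * r := mul_le_mul_of_nonneg_left (by exact_mod_cast hβ) hδ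
      linarith
    have h3 := holderNorm_le (r := r) (τ := τ) (f := fun x => NonsmoothPDO.dxi α a x ξ)
      (B := ⟨C * jap ξ ^ (m - ρ * len α + δ * (r + τ)), by positivity⟩)
      (fun β hβ x => ((hc β hβ).1.2 x ξ).trans (by
        simpa using! hle β hβ 0 (mul_nonneg hδ τ.coe_nonneg)))
      (fun β hβ x x' => ((hc β hβ).2 x x' ξ).trans (by
        rw [← mul_assoc]
        exact mul_le_mul_of_nonneg_right (hle β hβ _ le_rfl)
          (Real.rpow_nonneg (norm_nonneg _) _)))
    refine h3.trans (le_of_eq ?_)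
    rw [mul_assoc]
    rfl

theorem Sym.isDottedHolderSymbol {r : ℕ} {τ : ℝ≥0} (hδ : 0 ≤ δ) (h : Sym ρ δ (PH δ τ) A r m a)
    (h' : Sym ρ δ PV A r m a) : IsDottedHolderSymbol r τ m ρ δ A a := by
  refine ⟨h.isHolderSymbol hδ, fun α β hα hβ => ?_⟩
  have hβ' : (len β : ℕ∞) ≤ r := by exact_mod_cast hβ
  obtain ⟨c, hc⟩ := ((h'.dxi hα).dx hβ').base
  rw [(h.mixedReg fun _ _ => PH.toPS).comm hα hβ'] at hc
  exact ⟨c.1, c.2, fun x ξ => by rw [norm_dxi_Dx]; exact hc.2 x ξ⟩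

end NonsmoothPDO

namespace NonsmoothPDO

variable {n : ℕ}

/-! ### Interpolation of derivatives -/

/-- Landau's argument: s ∂_i f(x) is an increment of f up to s times the oscillation of ∂_i f on a
segment of length s. -/
theorem norm_pd_le {f : E n → ℂ} {i : Fin n} (hf : HasPd i f) {M₀ H s : ℝ} (hs : 0 < s)
    (h0 : ∀ x, ‖f x‖ ≤ M₀)
    (hH : ∀ x, ∀ t ∈ Set.Icc (0 : ℝ) s, ‖pd i f (x + t • bv i) - pd i f x‖ ≤ H) (x : E n) :
    ‖pd i f x‖ ≤ 2 * M₀ / s + H := by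
  have h1 := norm_image_sub_le_of_norm_deriv_le_segment' (a := 0) (b := s) (C := H)
    (f := fun t => f (x + t • bv i) - (t : ℂ) * pd i f x)
    (f' := fun t => pd i f (x + t • bv i) - pd i f x)
    (fun t _ => by
      have h2 : HasDerivAt (fun t : ℝ => (t : ℂ) * pd i f x) (pd i f x) t := by
        simpa using! (Complex.ofRealCLM.hasDerivAt (x := t)).mul_const (pd i f x)
      exact ((hf.hasDerivAt x t).sub h2).hasDerivWithinAt)
    (fun t ht => hH x t (Set.Ico_subset_Icc_self ht)) s (Set.right_mem_Icc.2 hs.le)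
  simp only [zero_smul, add_zero, Complex.ofReal_zero, zero_mul, sub_zero] at h1
  have h3 : ‖(s : ℂ) * pd i f x‖ ≤ 2 * M₀ + H * s := by
    have e : (s : ℂ) * pd i f x = f (x + s • bv i) - f x -
        (f (x + s • bv i) - (s : ℂ) * pd i f x - f x) := by ring
    rw [e]
    have := norm_sub_le (f (x + s • bv i) - f x) (f (x + s • bv i) - (s : ℂ) * pd i f x - f x)
    have := norm_sub_le (f (x + s • bv i)) (f x)
    linarith [h0 (x + s • bv i), h0 x]
  rw [norm_mul, Complex.norm_real, Real.norm_of_nonneg hs.le] at h3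
  have h4 : 2 * M₀ / s + H = (2 * M₀ + H * s) / s := by field_simp
  rw [h4, le_div_iff₀ hs]
  linarith

theorem norm_bv (i : Fin n) : ‖(bv i : E n)‖ = 1 := by simp [bv]

theorem norm_pd_le_of_second {f : E n → ℂ} {i : Fin n} (hf : HasPd i f) (hf' : HasPd i (pd i f))
    {M₀ M₂ s : ℝ} (hs : 0 < s) (h0 : ∀ x, ‖f x‖ ≤ M₀) (h2 : ∀ x, ‖pd i (pd i f) x‖ ≤ M₂) (x : E n) :
    ‖pd i f x‖ ≤ 2 * M₀ / s + M₂ * s := by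
  refine norm_pd_le hf hs h0 (fun x t ht => ?_) x
  have h1 := norm_image_sub_le_of_norm_deriv_le_segment' (a := 0) (b := t) (C := M₂)
    (f := fun t => pd i f (x + t • bv i)) (f' := fun t => pd i (pd i f) (x + t • bv i))
    (fun t _ => (hf'.hasDerivAt x t).hasDerivWithinAt) (fun t _ => h2 _) t
    (Set.right_mem_Icc.2 ht.1)
  simp only [zero_smul, add_zero, sub_zero] at h1
  exact h1.trans (mul_le_mul_of_nonneg_left ht.2 ((norm_nonneg _).trans (h2 x)))

theorem norm_pd_le_of_holder {f : E n → ℂ} {i : Fin n} (hf : HasPd i f) {M₀ N s τ : ℝ} (hs : 0 < s)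
    (hτ : 0 ≤ τ) (h0 : ∀ x, ‖f x‖ ≤ M₀)
    (hN : ∀ x x', ‖pd i f x - pd i f x'‖ ≤ N * ‖x - x'‖ ^ τ) (hN0 : 0 ≤ N) (x : E n) :
    ‖pd i f x‖ ≤ 2 * M₀ / s + N * s ^ τ := by
  refine norm_pd_le hf hs h0 (fun x t ht => (hN _ _).trans ?_) x
  rw [add_sub_cancel_left, norm_smul, norm_bv, mul_one, Real.norm_of_nonneg ht.1]
  exact mul_le_mul_of_nonneg_left (Real.rpow_le_rpow ht.1 ht.2 hτ) hN0

/-- The interpolation inequalities bound a finite sequence by its first entry. -/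
theorem exists_interpolation_bound (r : ℕ) : ∃ B : ℝ, 1 ≤ B ∧ ∀ (d : ℕ → ℝ) (C : ℝ), 0 ≤ C →
    (∀ k, 0 ≤ d k) → d 0 ≤ C →
    (∀ k, k + 2 ≤ r → ∀ σ : ℝ, 0 < σ → d (k + 1) ≤ 2 * d k / σ + d (k + 2) * σ) →
    (∀ k, k + 1 = r → d (k + 1) ≤ 2 * d k + C) → ∀ k ≤ r, d k ≤ B * C := by
  -- Induction downwards from the top order; `j` is the distance to it.
  have key : ∀ j : ℕ, ∃ B : ℝ, 1 ≤ B ∧ ∀ (d : ℕ → ℝ) (C : ℝ), 0 ≤ C → (∀ k, 0 ≤ d k) →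
      (∀ k, k + 2 ≤ r → ∀ σ : ℝ, 0 < σ → d (k + 1) ≤ 2 * d k / σ + d (k + 2) * σ) →
      (∀ k, k + 1 = r → d (k + 1) ≤ 2 * d k + C) →
      ∀ k, k + 1 + j = r → d (k + 1) ≤ B * (d k + C) := by
    intro j
    induction j with
    | zero =>
      exact ⟨2, by norm_num, fun d C hC hd _ h k hk => (h k hk).trans (by linarith)⟩
    | succ j ih =>
      obtain ⟨B, hB, h⟩ := ih
      refine ⟨8 * B, by linarith, fun d C hC hd h1 h2 k hk => ?_⟩
      have h3 := h d C hC hd h1 h2 (k + 1) (by omega)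
      -- With σ = 1/(2B), half of `d (k + 1)` reappears on the right and is absorbed on the left.
      have h4 := h1 k (by omega) (1 / (2 * B)) (by positivity)
      have h5 : d (k + 1 + 1) * (1 / (2 * B)) ≤ (d (k + 1) + C) / 2 := by
        calc _ ≤ B * (d (k + 1) + C) * (1 / (2 * B)) := by gcongr
          _ = _ := by field_simp
      have h6 : 2 * d k / (1 / (2 * B)) = 4 * B * d k := by field_simp; ring
      rw [h6] at h4
      have h7 : d (k + 1) ≤ 8 * B * d k + C := by
        change d (k + 1) ≤ 4 * B * d k + d (k + 1 + 1) * (1 / (2 * B)) at h4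
        linarith
      nlinarith [hd k]
  choose B hB h using key
  obtain ⟨B₀, hB₀⟩ : ∃ B₀ : ℝ, ∀ j < r, B j ≤ B₀ := by
    obtain ⟨B₀, h⟩ := ((Set.finite_lt_nat r).image B).bddAbove
    exact ⟨B₀, fun j hj => h ⟨j, hj, rfl⟩⟩
  set D : ℝ := max 1 B₀ with hD
  have hD1 : 1 ≤ D := le_max_left _ _
  refine ⟨(2 * D) ^ r, one_le_pow₀ (by linarith), fun d C hC hd h0 h1 h2 k hk => ?_⟩
  have h3 : ∀ k ≤ r, d k ≤ (2 * D) ^ k * C := by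
    intro k
    induction k with
    | zero => intro _; simpa using h0
    | succ k ih =>
      intro hk
      have h4 := h (r - (k + 1)) d C hC hd h1 h2 k (by omega)
      have h5 := ih (by omega)
      have h6 : B (r - (k + 1)) ≤ D := (hB₀ _ (by omega)).trans (le_max_right _ _)
      have h7 : 1 ≤ (2 * D) ^ k := one_le_pow₀ (by linarith)
      calc d (k + 1) ≤ B (r - (k + 1)) * (d k + C) := h4
        _ ≤ D * ((2 * D) ^ k * C + (2 * D) ^ k * C) := by
          have := hd k
          gcongr
          exact le_mul_of_one_le_left hC h7
        _ = _ := by ring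
  refine (h3 k hk).trans ?_
  gcongr
  · linarith

/-- Landau-Kolmogorov type bounds at scale `1 / Λ`. -/
theorem exists_derivative_bound (n r : ℕ) {τ : ℝ} (hτ : 0 ≤ τ) : ∃ B : ℝ, 1 ≤ B ∧
    ∀ (f : E n → ℂ) (C Λ : ℝ), 0 ≤ C → 0 < Λ → ContDiff ℝ r f → (∀ x, ‖f x‖ ≤ C) →
    (∃ N : ℝ, ∀ β : Fin n → ℕ, len β ≤ r → ∀ x, ‖mpd β f x‖ ≤ N) →
    (∀ β : Fin n → ℕ, len β = r → ∀ x x',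
      ‖mpd β f x - mpd β f x'‖ ≤ C * Λ ^ r * Λ ^ τ * ‖x - x'‖ ^ τ) →
    ∀ β : Fin n → ℕ, len β ≤ r → ∀ x, ‖mpd β f x‖ ≤ B * C * Λ ^ len β := by
  obtain ⟨B, hB, h⟩ := exists_interpolation_bound r
  refine ⟨B, hB, fun f C Λ hC hΛ hf h0 ⟨N, hN⟩ hH => ?_⟩
  -- Order-k derivatives are measured in units of Λ^k, which removes Λ from the interpolation
  -- inequalities. The qualitative bound `N` keeps these suprema genuine for `k ≤ r`, where the
  -- absorption argument uses them.
  set S : ℕ → Set ℝ := fun k =>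
    Set.range fun p : {β : Fin n → ℕ // len β = k} × E n => ‖mpd p.1.1 f p.2‖ / Λ ^ k with hS
  set d : ℕ → ℝ := fun k => sSup (S k) with hd
  have hd0 : ∀ k, 0 ≤ d k := fun k => Real.sSup_nonneg (by rintro _ ⟨p, rfl⟩; positivity)
  have hle : ∀ {k x}, 0 ≤ x → (∀ β : Fin n → ℕ, len β = k → ∀ y, ‖mpd β f y‖ ≤ x * Λ ^ k) → d k ≤ x :=
    fun {k x} hx hb => Real.sSup_le (by
      rintro _ ⟨p, rfl⟩
      exact (div_le_iff₀ (by positivity)).2 (hb p.1.1 p.1.2 p.2)) hx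
  have hbd : ∀ {k}, k ≤ r → ∀ β : Fin n → ℕ, len β = k → ∀ y, ‖mpd β f y‖ ≤ d k * Λ ^ k := by
    intro k hk β hβ y
    refine (div_le_iff₀ (by positivity)).1 (le_csSup ⟨N / Λ ^ k, ?_⟩ ⟨(⟨β, hβ⟩, y), rfl⟩)
    rintro _ ⟨p, rfl⟩
    have := hN p.1.1 (by rw [p.1.2]; exact hk) p.2
    simp only
    gcongr
  have hpd : ∀ {β : Fin n → ℕ} (i : Fin n), len β + 1 ≤ r → HasPd i (mpd β f) ∧
      pd i (mpd β f) = mpd (β + Pi.single i 1) f := fun {β} i hβ => by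
    have h1 : ContDiff ℝ (len β + 1 : ℕ) f := hf.of_le (by exact_mod_cast hβ)
    have h2 : ContDiff ℝ (1 : ℕ) (mpd β f) := contDiff_mpd (by rw [add_comm]; exact h1)
    exact ⟨HasPd.of_differentiable (h2.differentiable (by simp)) i, pd_mpd h1 i⟩
  have hfin := h d C hC hd0 (hle hC fun β hβ y => by
      rw [eq_zero_of_len hβ]; simpa using h0 y) (fun k hk σ hσ => ?_) fun k hk => ?_
  · intro β hβ x
    refine (hbd hβ β rfl x).trans ?_
    gcongr
    exact hfin _ hβ
  · have hd1 := hd0 k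
    have hd2 := hd0 (k + 2)
    refine hle (by positivity) fun β hβ y => ?_
    obtain ⟨β', i, hβ', rfl⟩ := exists_eq_add_single hβ
    have h1 := hpd (β := β') i (by omega)
    have h2 := hpd (β := β' + Pi.single i 1) i (by rw [len_add_single]; omega)
    rw [← h1.2] at h2 ⊢
    have h3 := norm_pd_le_of_second h1.1 h2.1 (M₀ := d k * Λ ^ k) (M₂ := d (k + 2) * Λ ^ (k + 2))
      (s := σ / Λ) (by positivity) (hbd (by omega) β' hβ') (fun x => by
        rw [h2.2]
        exact hbd (by omega) _ (by rw [len_add_single, len_add_single, hβ']) x) y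
    refine h3.trans (le_of_eq ?_)
    field_simp
    ring
  · have hd1 := hd0 k
    refine hle (by positivity) fun β hβ y => ?_
    obtain ⟨β', i, hβ', rfl⟩ := exists_eq_add_single hβ
    have h1 := hpd (β := β') i (by omega)
    have h3 := norm_pd_le_of_holder h1.1 (M₀ := d k * Λ ^ k) (N := C * Λ ^ r * Λ ^ τ) (s := 1 / Λ)
      (by positivity) hτ (hbd (by omega) β' hβ') (fun x x' => by
        rw [h1.2]
        exact hH _ (by omega) x x') (by positivity) y
    rw [← h1.2]
    refine h3.trans (le_of_eq ?_)
    rw [Real.div_rpow zero_le_one hΛ.le, Real.one_rpow, ← hk]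
    have : Λ ^ τ ≠ 0 := (Real.rpow_pos_of_pos hΛ τ).ne'
    field_simp
    ring

/-! ### Non-smooth symbols -/

theorem holderNorm_bound {r : ℕ} {τ : ℝ≥0} {f : E n → ℂ} {N : ℝ} (hN : 0 ≤ N)
    (h : holderNorm r τ f ≤ ENNReal.ofReal N) {β : Fin n → ℕ} (hβ : len β ≤ r) :
    (∀ x, ‖mpd β f x‖ ≤ N) ∧ ∀ x x', ‖mpd β f x - mpd β f x'‖ ≤ N * ‖x - x'‖ ^ (τ : ℝ) := by
  have h1 : (⨆ x, ‖mpd β f x‖ₑ) + eHolderNorm τ (mpd β f) ≤ ENNReal.ofReal N :=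
    (le_iSup₂_of_le (f := fun β (_ : len β ≤ r) => (⨆ x, ‖mpd β f x‖ₑ) + eHolderNorm τ (mpd β f))
      β hβ le_rfl).trans h
  have h2 := (le_self_add.trans h1 : (⨆ x, ‖mpd β f x‖ₑ) ≤ _)
  have h3 := (le_add_self.trans h1 : eHolderNorm τ (mpd β f) ≤ _)
  refine ⟨fun x => ?_, fun x x' => ?_⟩
  · have h4 := (le_iSup (fun x => ‖mpd β f x‖ₑ) x).trans h2
    rw [← ofReal_norm] at h4
    exact (ENNReal.ofReal_le_ofReal_iff hN).1 h4
  · have h5 : MemHolder τ (mpd β f) := by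
      rw [← eHolderNorm_ne_top]
      exact (h3.trans_lt ENNReal.ofReal_lt_top).ne
    have h6 := h5.holderWith.dist_le x x'
    rw [dist_eq_norm, dist_eq_norm] at h6
    refine h6.trans (mul_le_mul_of_nonneg_right ?_ (Real.rpow_nonneg (norm_nonneg _) _))
    rw [← h5.coe_nnHolderNorm_eq_eHolderNorm, ← ENNReal.ofReal_coe_nnreal] at h3
    exact (ENNReal.ofReal_le_ofReal_iff hN).1 h3

variable {r : ℕ} {τ : ℝ≥0} {m ρ δ : ℝ} {M : ℕ∞} {a : E n → E n → ℂ}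

theorem IsHolderSymbol.mixedReg (h : IsHolderSymbol r τ m ρ δ M a) : MixedReg M r a :=
  ⟨fun α hα ξ _ hk => (h.contDiff_x α hα ξ).of_le (by exact_mod_cast hk),
    fun β hβ x _ hk => (contDiff_iff_forall_nat_le.1
      (h.contDiff_xi β (by exact_mod_cast hβ) x)) _ hk,
    fun α β hα hβ => h.continuous_deriv α β hα (by exact_mod_cast hβ)⟩

/-- The definition controls ∂_ξ^α a without x-derivatives and the full Hölder norm at the top
exponent, but no x-derivatives in between at their own order. These come from interpolation with Λ =
⟨ξ⟩^δ. -/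
theorem IsHolderSymbol.exists_bound (h : IsHolderSymbol r τ m ρ δ M a) {α : Fin n → ℕ}
    (hα : (len α : ℕ∞) ≤ M) : ∃ C : ℝ≥0, ∀ β : Fin n → ℕ, len β ≤ r → ∀ ξ,
      (∀ x, ‖dx β (dxi α a) x ξ‖ ≤ C * jap ξ ^ (m - ρ * len α + δ * len β)) ∧
      (len β = r → ∀ x x', ‖dx β (dxi α a) x ξ - dx β (dxi α a) x' ξ‖ ≤
        C * (jap ξ ^ (m - ρ * len α + δ * len β + δ * τ) * ‖x - x'‖ ^ (τ : ℝ))) := by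
  obtain ⟨C₁, h₁⟩ := h.bound α hα
  obtain ⟨C₂, h₂⟩ := h.holder_bound α hα
  obtain ⟨B, hB, hder⟩ := exists_derivative_bound n r τ.coe_nonneg
  set C : ℝ := max 0 (max C₁ C₂) with hC
  have hC0 : 0 ≤ C := le_max_left _ _
  have hC1 : C₁ ≤ C := (le_max_left _ _).trans (le_max_right _ _)
  have hC2 : C₂ ≤ C := (le_max_right _ _).trans (le_max_right _ _)
  refine ⟨⟨B * C, by positivity⟩, fun β hβ ξ => ?_⟩
  set s := m - ρ * len α with hs
  have hj := jap_rpow_pos ξ s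
  have hl := jap_rpow_pos ξ δ
  have hpow : ∀ k : ℕ, (jap ξ ^ δ) ^ k = jap ξ ^ (δ * k) := fun k => by
    rw [Real.rpow_mul (jap_pos ξ).le, Real.rpow_natCast]
  have hpowτ : (jap ξ ^ δ) ^ (τ : ℝ) = jap ξ ^ (δ * τ) := (Real.rpow_mul (jap_pos ξ).le _ _).symm
  have hN : holderNorm r τ (fun x => dxi α a x ξ) ≤ ENNReal.ofReal (C * jap ξ ^ (s + δ * (r + τ))) :=
    (h₂ ξ).trans (ENNReal.ofReal_le_ofReal
      (mul_le_mul_of_nonneg_right hC2 (jap_rpow_pos _ _).le))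
  have hNn : 0 ≤ C * jap ξ ^ (s + δ * (r + τ)) := mul_nonneg hC0 (jap_rpow_pos _ _).le
  have hb := fun {β} => holderNorm_bound hNn hN (β := β)
  have hbr : ∀ β : Fin n → ℕ, len β = r → ∀ x x',
      ‖dx β (dxi α a) x ξ - dx β (dxi α a) x' ξ‖ ≤
        C * jap ξ ^ s * (jap ξ ^ δ) ^ r * (jap ξ ^ δ) ^ (τ : ℝ) * ‖x - x'‖ ^ (τ : ℝ) := by
    intro β hβ x x'
    refine ((hb hβ.le).2 x x').trans (le_of_eq ?_)
    rw [hpow, hpowτ, mul_add, Real.rpow_add (jap_pos ξ), Real.rpow_add (jap_pos ξ)]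
    ring
  have h3 := hder (fun x => dxi α a x ξ) (C * jap ξ ^ s) (jap ξ ^ δ) (by positivity) hl
    (h.contDiff_x α hα ξ) (fun x => (h₁ x ξ).trans (mul_le_mul_of_nonneg_right hC1 hj.le))
    ⟨_, fun β hβ => (hb hβ).1⟩ hbr β hβ
  refine ⟨fun x => (h3 x).trans (le_of_eq ?_), fun hβr x x' => (hbr β hβr x x').trans ?_⟩
  · rw [hpow, Real.rpow_add (jap_pos ξ)]
    change _ = B * C * _
    ring
  · rw [hpow, hpowτ, Real.rpow_add (jap_pos ξ), Real.rpow_add (jap_pos ξ), hβr]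
    change _ ≤ B * C * _
    have h4 : 0 ≤ C * (jap ξ ^ s * jap ξ ^ (δ * r) * jap ξ ^ (δ * τ) * ‖x - x'‖ ^ (τ : ℝ)) := by
      have := jap_rpow_pos ξ (δ * r)
      have := jap_rpow_pos ξ (δ * τ)
      have := Real.rpow_nonneg (norm_nonneg (x - x')) (τ : ℝ)
      positivity
    nlinarith

theorem IsHolderSymbol.sym (hτ : τ ≤ 1) (h : IsHolderSymbol r τ m ρ δ M a) :
    Sym ρ δ (PH δ τ) M r m a := by
  have hr := h.mixedReg
  have hPS : ∀ α β : Fin n → ℕ, (len α : ℕ∞) ≤ M → len β ≤ r →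
      PS (m - ρ * len α + δ * len β) (dx β (dxi α a)) := fun α β hα hβ => by
    obtain ⟨C, hC⟩ := h.exists_bound hα
    exact ⟨C, hr.continuous α β hα (by exact_mod_cast hβ), fun x ξ => (hC β hβ ξ).1 x⟩
  have h1 := hr.sym (ρ := ρ) (δ := δ) (m := m) (P := PH δ τ) (b := 0) (α := 0) (β := 0)
    (fun α β hα hβ _ => by
      have hβ' : len β ≤ r := by exact_mod_cast hβ
      -- Below the top order the Hölder bound follows from the next derivative; at the top order it
      -- comes from the Hölder seminorm of the class.
      rcases hβ'.lt_or_eq with hlt | heq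
      · refine (hPS α β hα hβ').toPH τ.coe_nonneg (by exact_mod_cast hτ) fun i => ?_
        have h2 := hr.px_dx hα (β := β) (by exact_mod_cast hlt) i
        refine ⟨h2.1, ?_⟩
        rw [h2.2]
        have h3 := hPS α (β + Pi.single i 1) hα (by rw [len_add_single]; exact hlt)
        rw [len_add_single] at h3
        convert h3 using 1
        push_cast; ring
      · obtain ⟨C, hC⟩ := h.exists_bound hα
        exact ⟨C, ⟨hr.continuous α β hα hβ, fun x ξ => (hC β hβ' ξ).1 x⟩,
          fun x x' ξ => (hC β hβ' ξ).2 heq x x'⟩)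
    (by simp) (by simp) (by simp)
  simpa using h1

end NonsmoothPDO

namespace NonsmoothPDO

variable {n : ℕ}

/-! ### Taylor expansion -/

theorem mfact_add_single (γ : Fin n → ℕ) (j : Fin n) :
    mfact (γ + Pi.single j 1) = (γ j + 1) * mfact γ := by
  have h := fun α : Fin n → ℕ => Finset.mul_prod_erase Finset.univ (fun i => (α i).factorial)
    (Finset.mem_univ j)
  rw [mfact, mfact, ← h, ← h, ← mul_assoc]
  congr 1
  · simp [Nat.factorial_succ]
  · refine Finset.prod_congr rfl fun i hi => ?_
    simp [Finset.ne_of_mem_erase hi]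

theorem mfact_ne_zero (γ : Fin n → ℕ) : (mfact γ : ℂ) ≠ 0 := by
  exact_mod_cast Finset.prod_ne_zero_iff.2 fun i _ => (Nat.factorial_pos (γ i)).ne'

/-- A multi-index γ of length k + 1 is reached from γ - e_j with 1/(γ - e_j)! = γ_j/γ!, and Σ_j γ_j
= k + 1. -/
theorem sum_multiIdx_succ (k : ℕ) (f : (Fin n → ℕ) → ℂ) :
    ∑ γ ∈ multiIdx n k, (1 / (mfact γ : ℂ)) * ∑ j, f (γ + Pi.single j 1) =
      (k + 1) * ∑ γ ∈ multiIdx n (k + 1), (1 / (mfact γ : ℂ)) * f γ := by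
  have h1 : ∀ j : Fin n, ∑ γ ∈ multiIdx n k, (1 / (mfact γ : ℂ)) * f (γ + Pi.single j 1) =
      ∑ γ ∈ multiIdx n (k + 1), (γ j : ℂ) * ((1 / (mfact γ : ℂ)) * f γ) := by
    intro j
    refine Finset.sum_of_injOn (fun γ => γ + Pi.single j 1) (fun _ _ _ _ h => add_right_cancel h)
      (fun γ hγ => ?_) (fun γ hγ hγ' => ?_) fun γ _ => ?_
    · have : len γ = k := mem_multiIdx.1 hγ
      exact mem_multiIdx.2 (by rw [len_add_single, this])
    · by_cases h0 : γ j = 0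
      · simp [h0]
      · refine absurd ⟨γ - Pi.single j 1, ?_, ?_⟩ hγ'
        · have e : γ - Pi.single j 1 + Pi.single j 1 = γ := tsub_add_cancel_of_le fun i => by
            by_cases hij : i = j
            · subst hij; simp; omega
            · simp [hij]
          have h2 := len_add_single (γ - Pi.single j 1) j
          rw [e, mem_multiIdx.1 hγ] at h2
          exact mem_multiIdx.2 (by omega)
        · exact tsub_add_cancel_of_le fun i => by
            by_cases hij : i = j
            · subst hij; simp; omega
            · simp [hij]
    · have h2 := mfact_ne_zero γ
      have h3 : ((γ j : ℂ) + 1) ≠ 0 := Nat.cast_add_one_ne_zero (γ j)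
      rw [mfact_add_single]
      simp only [Pi.add_apply, Pi.single_eq_same]
      push_cast
      field_simp
  simp_rw [Finset.mul_sum]
  rw [Finset.sum_comm]
  simp_rw [h1]
  rw [Finset.sum_comm]
  refine Finset.sum_congr rfl fun γ hγ => ?_
  rw [← Finset.sum_mul]
  have h2 : ∑ j, (γ j : ℂ) = k + 1 := by
    have h3 : len γ = k + 1 := mem_multiIdx.1 hγ
    rw [len] at h3
    exact_mod_cast h3
  rw [h2]

/-- Taylor's formula with integral remainder for a chain of normalised derivatives. -/
theorem taylor_chain {Φ : ℕ → ℝ → ℂ} {k : ℕ} (hk : 1 ≤ k) (hc : ∀ j ≤ k, Continuous (Φ j))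
    (hd : ∀ j < k, ∀ θ, HasDerivAt (Φ j) ((j + 1) * Φ (j + 1) θ) θ) :
    Φ 0 1 = ∑ j ∈ Finset.range k, Φ j 0 +
      k * ∫ θ in (0 : ℝ)..1, (((1 - θ) ^ (k - 1) : ℝ) : ℂ) * Φ k θ := by
  induction k, hk using Nat.le_induction with
  | base =>
    have h1 := intervalIntegral.integral_eq_sub_of_hasDerivAt (a := 0) (b := 1)
      (fun θ _ => hd 0 zero_lt_one θ)
      ((continuous_const.mul (hc 1 le_rfl)).intervalIntegrable _ _)
    simp only [Nat.cast_zero, zero_add, one_mul] at h1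
    simp [h1]
  | succ k hk ih =>
    rw [ih (fun j hj => hc j (by omega)) (fun j hj => hd j (by omega)), Finset.sum_range_succ,
      add_assoc]
    congr 1
    -- One integration by parts turns the k-th remainder into the next Taylor term plus the
    -- following remainder.
    have hder : ∀ θ : ℝ, HasDerivAt (fun θ : ℝ => -((((1 - θ) ^ k : ℝ) : ℂ) * Φ k θ))
        (k * ((((1 - θ) ^ (k - 1) : ℝ) : ℂ) * Φ k θ) -
          (k + 1) * ((((1 - θ) ^ k : ℝ) : ℂ) * Φ (k + 1) θ)) θ := fun θ => by
      have h1 : HasDerivAt (fun θ : ℝ => (((1 - θ) ^ k : ℝ) : ℂ))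
          ((k * (1 - θ) ^ (k - 1) * (-1) : ℝ) : ℂ) θ :=
        (((hasDerivAt_id θ).const_sub 1).pow k).ofReal_comp
      refine (h1.mul (hd k (by omega) θ)).neg.congr_deriv ?_
      push_cast
      ring
    have hc1 : Continuous fun θ : ℝ => (k : ℂ) * ((((1 - θ) ^ (k - 1) : ℝ) : ℂ) * Φ k θ) :=
      continuous_const.mul (Continuous.mul (by fun_prop) (hc k (by omega)))
    have hc2 : Continuous fun θ : ℝ => ((k : ℂ) + 1) * ((((1 - θ) ^ k : ℝ) : ℂ) * Φ (k + 1) θ) :=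
      continuous_const.mul (Continuous.mul (by fun_prop) (hc (k + 1) le_rfl))
    have h2 := intervalIntegral.integral_eq_sub_of_hasDerivAt (a := 0) (b := 1)
      (fun θ _ => hder θ) ((hc1.sub hc2).intervalIntegrable _ _)
    rw [intervalIntegral.integral_sub (hc1.intervalIntegrable _ _) (hc2.intervalIntegrable _ _),
      intervalIntegral.integral_const_mul, intervalIntegral.integral_const_mul] at h2
    have h3 : (k : ℕ) ≠ 0 := by omega
    simp only [sub_self, sub_zero, one_pow, zero_pow h3, Complex.ofReal_zero, Complex.ofReal_one,
      zero_mul, one_mul, neg_zero, zero_sub, neg_neg] at h2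
    rw [Nat.add_sub_cancel]
    push_cast at h2 ⊢
    linear_combination h2

variable {ρ δ : ℝ} {A r A' : ℕ∞} {m m' : ℝ} {a₁ a₂ h g : E n → E n → ℂ}

theorem compSymbol_eq_osc (a₁ a₂ : E n → E n → ℂ) : compSymbol a₁ a₂ = osc 1 a₁ a₂ := by
  funext x ξ
  simp only [compSymbol, osc]
  congr 1
  funext y η
  simp [compAmp, tens]

theorem compAmp_eq_tens (a₁ a₂ : E n → E n → ℂ) (x ξ : E n) :
    compAmp a₁ a₂ x ξ = tens 1 a₁ a₂ x ξ := by
  funext y η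
  simp [compAmp, tens]

theorem remTerm_eq_osc (a₁ a₂ : E n → E n → ℂ) (γ : Fin n → ℕ) (θ : ℝ) :
    remTerm a₁ a₂ γ θ = osc θ (dxi γ a₁) (Dx γ a₂) := rfl

@[simp] theorem Dx_zero (a : E n → E n → ℂ) : Dx 0 a = a := by
  funext x ξ
  simp [Dx]

theorem osc_const_mul_right (hρ : 0 ≤ ρ) (hA : ((n + 1 : ℕ) : ℕ∞) ≤ A)
    (hh : Sym ρ δ PS A r m h) (hg : Sym ρ δ PS A' ⊤ m' g) (c : ℂ) (θ : ℝ) (x ξ : E n) :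
    osc θ h (fun x ξ => c * g x ξ) x ξ = c * osc θ h g x ξ := by
  refine HasOscInt.oscInt_eq ?_
  have h1 := (hasOscInt_osc hρ hA hh hg θ x ξ).const_mul c
  convert h1 using 3
  simp only [tens]
  ring

/-- At θ = 0 the amplitude no longer depends on η, so the integral is its value at y = 0. -/
theorem osc_zero (hρ : 0 ≤ ρ) (hA : ((n + 1 : ℕ) : ℕ∞) ≤ A)
    (hh : Sym ρ δ PS A r m h) (hg : Sym ρ δ PS A' ⊤ m' g) (x ξ : E n) :
    osc 0 h g x ξ = h x ξ * g x ξ := by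
  have h1 := hasOscInt_osc hρ hA hh hg 0 x ξ
  have h2 : tens 0 h g x ξ = fun y _ => h x ξ * g (x + y) ξ := by
    funext y η
    simp [tens]
  rw [h2] at h1
  obtain ⟨c, hc⟩ := hg.base
  have hgc : Continuous fun y => h x ξ * g (x + y) ξ :=
    continuous_const.mul ((hc.continuous_x ξ).comp
      (by fun_prop : Continuous fun y : E n => x + y))
  have h3 := h1.eq_of_y (c := ‖h x ξ‖ * (c * jap ξ ^ m')) hgc fun y => by
      rw [norm_mul]
      exact mul_le_mul_of_nonneg_left (hc.2 _ ξ) (norm_nonneg _)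
  rw [h3, add_zero]

theorem Sym.Dx (h : Sym ρ δ PS A ⊤ m a₂) (γ : Fin n → ℕ) :
    Sym ρ δ PS A ⊤ (m + δ * len γ) (Dx γ a₂) :=
  Sym.const_mul _ (PS.const_mul _) (by simpa using h.dx (β := γ) le_top)

/-- In `osc_hasDerivAt_theta` the operator -i∂_{y_j} is D_{x_j}, so both factors have γ raised by
e_j. -/
theorem remTerm_hasDerivAt (hρ : 0 ≤ ρ) (h₁ : Sym ρ δ PS A r m a₁) (h₂ : Sym ρ δ PS A' ⊤ m' a₂)
    {γ : Fin n → ℕ} (hA : ((len γ + (n + 1 + 1) : ℕ) : ℕ∞) ≤ A) (x ξ : E n) (θ : ℝ) :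
    HasDerivAt (fun θ => remTerm a₁ a₂ γ θ x ξ)
      (∑ j, remTerm a₁ a₂ (γ + Pi.single j 1) θ x ξ) θ := by
  have hγ : (len γ : ℕ∞) ≤ A := le_trans (by exact_mod_cast Nat.le_add_right _ _) hA
  have hA1 : ((n + 1 + 1 : ℕ) : ℕ∞) ≤ A - len γ :=
    ENat.le_sub_of_add_le_left (by simp) (by exact_mod_cast hA)
  have hd := h₁.dxi hγ
  have hD := h₂.Dx γ
  have hA0 := one_le_of_succ_le hA1
  refine (osc_hasDerivAt_theta hρ hA1 hd hD x ξ θ).congr_deriv (Finset.sum_congr rfl fun j _ => ?_)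
  rw [← osc_const_mul_right hρ (pred_le_pred hA1) (hd.pxi hA0 j) (hD.px le_top j), remTerm_eq_osc]
  have hr₁ := h₁.mixedReg fun _ _ h => h
  have hr₂ := h₂.mixedReg fun _ _ h => h
  have e1 := (hr₁.pxi_dxi (α := γ) (β := 0)
    (le_trans (by norm_cast; omega) hA) (by simp) j).2
  rw [dx_zero] at e1
  have e2 := hr₂.px_dx (α := 0) (β := γ) (by simp) le_top j
  rw [dxi_zero] at e2
  have e3 : px j (NonsmoothPDO.Dx γ a₂) =
      fun x ξ => (-Complex.I) ^ len γ * dx (γ + Pi.single j 1) a₂ x ξ := by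
    rw [← e2.2]
    funext x ξ
    exact congrFun (pd_const_mul _ _ j) x
  have e4 : (fun x ξ => -Complex.I * px j (NonsmoothPDO.Dx γ a₂) x ξ) =
      NonsmoothPDO.Dx (γ + Pi.single j 1) a₂ := by
    rw [e3]
    funext x ξ
    simp only [NonsmoothPDO.Dx, len_add_single, pow_succ]
    ring
  rw [e1, e4]

/-- Taylor's formula is applied to the scalar function θ ↦ r_{0,θ}(x, ξ), so a₁ is never expanded
under the oscillatory integral. -/
theorem compSymbol_eq (hρ : 0 ≤ ρ) (h₁ : Sym ρ δ PS A r m a₁) (h₂ : Sym ρ δ PS A' ⊤ m' a₂) {k : ℕ}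
    (hk : 1 ≤ k) (hA : ((k + (n + 1) : ℕ) : ℕ∞) ≤ A) (x ξ : E n) :
    compSymbol a₁ a₂ x ξ = sharp k a₁ a₂ x ξ + remainder k a₁ a₂ x ξ := by
  have hle : ∀ {γ : Fin n → ℕ}, len γ ≤ k → (len γ : ℕ∞) ≤ A ∧ ((n + 1 : ℕ) : ℕ∞) ≤ A - len γ :=
    fun {γ} hγ => ⟨le_trans (by exact_mod_cast hγ.trans (Nat.le_add_right _ _)) hA,
      ENat.le_sub_of_add_le_left (by simp) (le_trans (by norm_cast; omega) hA)⟩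
  have hcont : ∀ {γ : Fin n → ℕ}, len γ ≤ k → Continuous fun θ => remTerm a₁ a₂ γ θ x ξ := fun hγ =>
    Continuous.osc continuous_id continuous_const continuous_const hρ (hle hγ).2
      (h₁.dxi (hle hγ).1) (h₂.Dx _)
  set Φ : ℕ → ℝ → ℂ := fun j θ => ∑ γ ∈ multiIdx n j, (1 / (mfact γ : ℂ)) * remTerm a₁ a₂ γ θ x ξ
    with hΦ
  have hT := taylor_chain (Φ := Φ) hk
    (fun j hj => continuous_finsetSum _ fun γ hγ => continuous_const.mul
      (hcont (by rwa [mem_multiIdx.1 hγ])))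
    (fun j hj θ => by
      have e := sum_multiIdx_succ j fun γ => remTerm a₁ a₂ γ θ x ξ
      rw [hΦ, ← e]
      refine HasDerivAt.fun_sum fun γ hγ => ?_
      have hγ' : len γ = j := mem_multiIdx.1 hγ
      exact (remTerm_hasDerivAt hρ h₁ h₂ (le_trans (by norm_cast; omega) hA) x ξ θ).const_mul _)
  have e0 : Φ 0 1 = compSymbol a₁ a₂ x ξ := by
    have : multiIdx n 0 = {0} := by
      ext γ
      rw [mem_multiIdx, Finset.mem_singleton]
      exact ⟨eq_zero_of_len, fun h => by rw [h, len_zero]⟩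
    simp only [hΦ]
    rw [this, Finset.sum_singleton, remTerm_eq_osc, dxi_zero, Dx_zero, compSymbol_eq_osc]
    simp [mfact]
  have e1 : ∀ j < k, Φ j 0 = ∑ γ ∈ multiIdx n j,
      (1 / (mfact γ : ℂ)) * dxi γ a₁ x ξ * Dx γ a₂ x ξ := fun j hj =>
    Finset.sum_congr rfl fun γ hγ => by
      have hγ' : len γ ≤ k := by rw [mem_multiIdx.1 hγ]; exact hj.le
      rw [remTerm_eq_osc, osc_zero hρ (hle hγ').2 (h₁.dxi (hle hγ').1) (h₂.Dx γ), mul_assoc]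
  rw [← e0, hT, sharp, remainder]
  refine congrArg₂ _ (Finset.sum_congr rfl fun j hj => e1 j (Finset.mem_range.1 hj)) ?_
  congr 1
  have hs := intervalIntegral.integral_finsetSum (μ := volume) (a := 0) (b := 1)
    (s := multiIdx n k)
    (f := fun γ (θ : ℝ) => (((1 - θ) ^ (k - 1) / (mfact γ : ℝ) : ℝ) : ℂ) *
      remTerm a₁ a₂ γ θ x ξ)
    (fun γ hγ => Continuous.intervalIntegrable
      (Continuous.mul (by fun_prop) (hcont (by rw [mem_multiIdx.1 hγ]))) _ _)
  rw [← hs]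
  refine intervalIntegral.integral_congr fun θ _ => ?_
  simp only [hΦ, Finset.mul_sum]
  refine Finset.sum_congr rfl fun γ _ => ?_
  push_cast
  ring

/-! ### Symbol classes of the expansion and of the remainder -/

section Classes

variable {P : ℝ → (E n → E n → ℂ) → Prop} {a b : E n → E n → ℂ}

theorem SymD.zero (hP : ∀ m, P m fun _ _ => 0) (s : ℕ) (A r : ℕ∞) (m : ℝ) :
    SymD ρ δ P s A r m fun _ _ => 0 := by
  induction s generalizing A r m with
  | zero => exact hP m
  | succ s ih =>
    refine ⟨hP m, fun _ j => ⟨fun _ => (HasPd.const j 0).1, ?_⟩,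
      fun _ i => ⟨fun _ => (HasPd.const i 0).1, ?_⟩⟩
    · have : pxi j (fun (_ _ : E n) => (0 : ℂ)) = fun _ _ => 0 := by
        funext x ξ
        exact congrFun (HasPd.const j 0).2 ξ
      rw [this]
      exact ih _ _ _
    · have : px i (fun (_ _ : E n) => (0 : ℂ)) = fun _ _ => 0 := by
        funext x ξ
        exact congrFun (HasPd.const i 0).2 x
      rw [this]
      exact ih _ _ _

theorem Sym.add (hP : ∀ m a b, P m a → P m b → P m (fun x ξ => a x ξ + b x ξ))
    (h : Sym ρ δ P A r m a) (h' : Sym ρ δ P A r m b) :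
    Sym ρ δ P A r m (fun x ξ => a x ξ + b x ξ) := fun s => (h s).add hP (h' s)

theorem Sym.mono_order (hP : ∀ m m' a, m ≤ m' → P m a → P m' a) (h : Sym ρ δ P A r m a)
    (hm : m ≤ m') : Sym ρ δ P A r m' a := fun s => (h s).mono_order hP hm

theorem Sym.sum {ι : Type*} (hP0 : ∀ m, P m fun _ _ => 0)
    (hP : ∀ m a b, P m a → P m b → P m (fun x ξ => a x ξ + b x ξ)) (s : Finset ι)
    {f : ι → E n → E n → ℂ} (hf : ∀ i ∈ s, Sym ρ δ P A r m (f i)) :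
    Sym ρ δ P A r m (fun x ξ => ∑ i ∈ s, f i x ξ) := by
  classical
  induction s using Finset.induction_on with
  | empty => exact fun s => by simpa using SymD.zero hP0 s A r m
  | insert i s hi ih =>
    simp only [Finset.sum_insert hi]
    exact (hf i (Finset.mem_insert_self i s)).add hP
      (ih fun j hj => hf j (Finset.mem_insert_of_mem hj))

theorem PH.zero {τ : ℝ} (m : ℝ) : PH δ τ m fun (_ _ : E n) => 0 :=
  ⟨0, ⟨continuous_const, by simp⟩, by simp⟩

theorem PV.zero (m : ℝ) : PV m fun (_ _ : E n) => 0 :=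
  ⟨⟨fun _ => 0, ⟨0, by simp⟩, tendsto_const_nhds⟩, continuous_const, by simp⟩

end Classes

theorem sym_sharp {τ : ℝ} (hτ0 : 0 ≤ τ) (hτ : τ ≤ 1) (hδρ : δ ≤ ρ)
    (h₁ : Sym ρ δ (PH δ τ) A r m a₁) (h₂ : Sym ρ δ PS A' ⊤ m' a₂) {k : ℕ} (hk : (k : ℕ∞) ≤ A) :
    Sym ρ δ (PH δ τ) (min (A - k + 1) A') r (m + m') (sharp k a₁ a₂) := by
  refine Sym.sum PH.zero PH.add _ fun j hj => Sym.sum PH.zero PH.add _ fun γ hγ => ?_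
  have hγ' : len γ = j := mem_multiIdx.1 hγ
  have hjk : len γ + 1 ≤ k := by rw [hγ']; exact Finset.mem_range.1 hj
  have hγA : (len γ : ℕ∞) ≤ A := le_trans (by exact_mod_cast (Nat.le_succ _).trans hjk) hk
  -- Only `len γ ≤ k - 1` occurs in the expansion, which saves one ξ-derivative over `A - k`.
  have hle : A - k + 1 ≤ A - len γ := by
    refine ENat.le_sub_of_add_le_right (by simp) ?_
    calc A - k + 1 + len γ = A - k + ((len γ + 1 : ℕ) : ℕ∞) := by push_cast; ring
      _ ≤ A - k + k := by gcongr
      _ = A := tsub_add_cancel_of_le hk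
  have e1 := (h₁.dxi hγA).of_le (A' := min (A - k + 1) A') ((min_le_left _ _).trans hle) le_rfl
  have e2 := ((h₂.Dx γ).toPH hτ0 hτ).of_le (A' := min (A - k + 1) A') (min_le_right _ _) (le_top (a := r))
  have e3 : Sym ρ δ (PH δ τ) (min (A - k + 1) A') r (m - ρ * len γ + (m' + δ * len γ))
      (fun x ξ => dxi γ a₁ x ξ * Dx γ a₂ x ξ) := fun s => (e1 s).mul PH.add PH.mul (e2 s)
  have e4 := (e3.mono_order PH.mono_order (m' := m + m') (by
    nlinarith [(Nat.cast_nonneg (len γ) : (0 : ℝ) ≤ len γ)])).const_mul (1 / (mfact γ : ℂ))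
    (PH.const_mul _)
  simpa only [← mul_assoc] using e4

theorem remainder_eq_sum (k : ℕ) (a₁ a₂ : E n → E n → ℂ) : remainder k a₁ a₂ = fun x ξ =>
    (k : ℂ) * ∑ γ ∈ multiIdx n k, avgOsc (fun θ => (1 - θ) ^ (k - 1) / (mfact γ : ℝ))
      (dxi γ a₁) (Dx γ a₂) x ξ := rfl

theorem le_sub_of_add_le {k : ℕ} (hA : ((k + (n + 1) : ℕ) : ℕ∞) ≤ A) :
    (k : ℕ∞) ≤ A ∧ ((n + 1 : ℕ) : ℕ∞) ≤ A - k :=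
  ⟨le_trans (by norm_cast; omega) hA, ENat.le_sub_of_add_le_left (by simp) (by exact_mod_cast hA)⟩

/-- `k` ξ-derivatives are used up by ∂_ξ^γ a₁ and n + 1 by convergence; the orders of the two
factors are m - ρk and m' + δk. -/
theorem sym_remainder_PH {τ : ℝ} (hτ0 : 0 ≤ τ) (hτ : τ ≤ 1) (hδ : 0 ≤ δ) (hδρ : δ < ρ) (hρ : ρ ≤ 1)
    (h₁ : Sym ρ δ (PH δ τ) A r m a₁) (h₂ : Sym ρ δ PS A' ⊤ m' a₂) {k : ℕ}
    (hA : ((k + (n + 1) : ℕ) : ℕ∞) ≤ A) :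
    Sym ρ δ (PH δ τ) (min (A - k - ((n + 1 : ℕ) : ℕ∞)) A') r (m + m' - (ρ - δ) * k)
      (remainder k a₁ a₂) := by
  obtain ⟨hkA, hnA⟩ := le_sub_of_add_le hA
  rw [remainder_eq_sum]
  refine Sym.const_mul _ (PH.const_mul _) (Sym.sum PH.zero PH.add _ fun γ hγ => ?_)
  have hγ' : len γ = k := mem_multiIdx.1 hγ
  have h3 := sym_avgOsc_PH (A := min (A - k - ((n + 1 : ℕ) : ℕ∞)) A')
    (w := fun θ => (1 - θ) ^ (k - 1) / (mfact γ : ℝ)) (by fun_prop) hδ hδρ hρ hτ0 hτ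
    (h₁.dxi (α := γ) (by rwa [hγ'])) (h₂.Dx γ)
    (by
      rw [hγ']
      exact (by gcongr; exact min_le_left _ _ : _ ≤ A - k - ((n + 1 : ℕ) : ℕ∞) + _).trans
        (tsub_add_cancel_of_le hnA).le) (min_le_right _ _)
  convert h3 using 1
  rw [hγ']
  ring

theorem sym_remainder_PV (hδ : 0 ≤ δ) (hδρ : δ < ρ) (hρ : ρ ≤ 1)
    (h₁ : Sym ρ δ PS A r m a₁) {k : ℕ}
    (h₂ : ∀ γ : Fin n → ℕ, len γ = k → Sym ρ δ PV A' ⊤ (m' + δ * len γ) (Dx γ a₂))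
    (hA : ((k + (n + 1) : ℕ) : ℕ∞) ≤ A) :
    Sym ρ δ PV (min (A - k - ((n + 1 : ℕ) : ℕ∞)) A') r (m + m' - (ρ - δ) * k)
      (remainder k a₁ a₂) := by
  obtain ⟨hkA, hnA⟩ := le_sub_of_add_le hA
  rw [remainder_eq_sum]
  refine Sym.const_mul _ (PV.const_mul _) (Sym.sum PV.zero PV.add _ fun γ hγ => ?_)
  have hγ' : len γ = k := mem_multiIdx.1 hγ
  have h3 := sym_avgOsc_PV (A := min (A - k - ((n + 1 : ℕ) : ℕ∞)) A')
    (w := fun θ => (1 - θ) ^ (k - 1) / (mfact γ : ℝ)) (by fun_prop) hδ hδρ hρ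
    (h₁.dxi (α := γ) (by rwa [hγ'])) (h₂ γ hγ')
    (by
      rw [hγ']
      exact (by gcongr; exact min_le_left _ _ : _ ≤ A - k - ((n + 1 : ℕ) : ℕ∞) + _).trans
        (tsub_add_cancel_of_le hnA).le) (min_le_right _ _)
  convert h3 using 1
  rw [hγ']
  ring

end NonsmoothPDO

/-! ### The composition theorem -/

theorem mainTheorem5 (n : ℕ) (hn : 0 < n) (r₁ : ℕ) (hr₁ : 0 < r₁)
    (τ₁ : ℝ≥0) (hτ₀ : 0 < τ₁) (hτ₁ : τ₁ < 1) (m₁ m₂ ρ δ : ℝ)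
    (hδ : 0 ≤ δ) (hδρ : δ < ρ) (hρ : ρ ≤ 1)
    (M₁ M₂ : ℕ∞) (hM₁ : ((n + 1 : ℕ) : ℕ∞) < M₁)
    (a₁ a₂ : E n → E n → ℂ)
    (ha₁ : IsHolderSymbol r₁ τ₁ m₁ ρ δ M₁ a₁) (ha₂ : IsSmoothSymbol m₂ ρ δ M₂ a₂) :
    -- the oscillatory integral defining the composed symbol exists
    (∀ x ξ, HasOscInt (compAmp a₁ a₂ x ξ) (compSymbol a₁ a₂ x ξ)) ∧
    (∀ k : ℕ, 1 ≤ k → (k : ℕ∞) ≤ M₁ - ((n + 1 : ℕ) : ℕ∞) →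
      -- the integrals defining the remainder exist
      (∀ γ : Fin n → ℕ, len γ = k → ∀ x ξ,
        (∀ θ ∈ Set.Icc (0 : ℝ) 1,
          HasOscInt (remAmp a₁ a₂ γ θ x ξ) (remTerm a₁ a₂ γ θ x ξ)) ∧
        IntervalIntegrable (fun θ => remTerm a₁ a₂ γ θ x ξ) volume 0 1) ∧
      (∀ x ξ, compSymbol a₁ a₂ x ξ = sharp k a₁ a₂ x ξ + remainder k a₁ a₂ x ξ) ∧
      IsHolderSymbol r₁ τ₁ (m₁ + m₂) ρ δ (min (M₁ - k + 1) M₂) (sharp k a₁ a₂) ∧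
      IsHolderSymbol r₁ τ₁ (m₁ + m₂ - (ρ - δ) * k) ρ δ
        (min (M₁ - k - ((n + 1 : ℕ) : ℕ∞)) M₂) (remainder k a₁ a₂) ∧
      (IsSlowlyVaryingSymbol m₂ ρ δ M₂ a₂ →
        IsDottedHolderSymbol r₁ τ₁ (m₁ + m₂ - (ρ - δ) * k) ρ δ
          (min (M₁ - k - ((n + 1 : ℕ) : ℕ∞)) M₂) (remainder k a₁ a₂))) ∧
    IsHolderSymbol r₁ τ₁ (m₁ + m₂) ρ δ
      (min (M₁ - 1 - ((n + 1 : ℕ) : ℕ∞)) M₂) (compSymbol a₁ a₂) := by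
  have hρ0 : 0 ≤ ρ := by linarith
  have hτ : (τ₁ : ℝ) ≤ 1 := by exact_mod_cast hτ₁.le
  have h₁ := ha₁.sym hτ₁.le
  have h₁' := h₁.weaken fun _ _ => PH.toPS
  have h₂ := ha₂.sym
  have hadd : ∀ {k : ℕ}, (k : ℕ∞) ≤ M₁ - ((n + 1 : ℕ) : ℕ∞) → ((k + (n + 1) : ℕ) : ℕ∞) ≤ M₁ :=
    fun {k} hk => by
      have := add_le_of_le_tsub_right_of_le hM₁.le hk
      exact_mod_cast this
  refine ⟨fun x ξ => ?_, fun k hk hkM => ?_, ?_⟩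
  · rw [compSymbol_eq_osc, compAmp_eq_tens]
    exact hasOscInt_osc hρ0 hM₁.le h₁' h₂ 1 x ξ
  · have hA := hadd hkM
    obtain ⟨hkA, hnA⟩ := le_sub_of_add_le hA
    refine ⟨fun γ hγ x ξ => ⟨fun θ _ => ?_, ?_⟩, compSymbol_eq hρ0 h₁' h₂ hk hA,
      (sym_sharp τ₁.coe_nonneg hτ hδρ.le h₁ h₂ hkA).isHolderSymbol hδ,
      (sym_remainder_PH τ₁.coe_nonneg hτ hδ hδρ hρ h₁ h₂ hA).isHolderSymbol hδ, fun ha₂' => ?_⟩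
    · exact hasOscInt_osc hρ0 (by rwa [hγ]) (h₁'.dxi (α := γ) (by rwa [hγ])) (h₂.Dx γ) θ x ξ
    · exact Continuous.intervalIntegrable (NonsmoothPDO.Continuous.osc continuous_id
        continuous_const continuous_const hρ0 (by rwa [hγ])
        (h₁'.dxi (α := γ) (by rwa [hγ])) (h₂.Dx γ)) _ _
    -- As `k ≥ 1`, the remainder contains only derivatives of a₂ with `len γ ≠ 0`, which are the
    -- decaying ones.
    · exact (sym_remainder_PH τ₁.coe_nonneg hτ hδ hδρ hρ h₁ h₂ hA).isDottedHolderSymbol hδ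
        (sym_remainder_PV hδ hδρ hρ h₁' (fun γ hγ => ha₂'.sym_Dx (by omega)) hA)
  -- `k = 1` is admissible because M₁ > n + 1, and both summands a₁ ♯₁ a₂ and R₁ have order at most
  -- m₁ + m₂.
  · have h1 : ((1 : ℕ) : ℕ∞) ≤ M₁ - ((n + 1 : ℕ) : ℕ∞) :=
      ENat.le_sub_of_add_le_left (by simp) (by
        rw [Nat.cast_one]
        exact Order.add_one_le_of_lt hM₁)
    have hA := hadd h1
    obtain ⟨hkA, -⟩ := le_sub_of_add_le hA
    have hs := sym_sharp τ₁.coe_nonneg hτ hδρ.le h₁ h₂ hkA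
    have hr := sym_remainder_PH τ₁.coe_nonneg hτ hδ hδρ hρ h₁ h₂ hA
    have e : compSymbol a₁ a₂ = fun x ξ => sharp 1 a₁ a₂ x ξ + remainder 1 a₁ a₂ x ξ :=
      funext fun x => funext fun ξ => compSymbol_eq hρ0 h₁' h₂ le_rfl hA x ξ
    rw [e]
    have hle : min (M₁ - 1 - ((n + 1 : ℕ) : ℕ∞)) M₂ ≤ min (M₁ - (1 : ℕ) + 1) M₂ := by
      gcongr
      rw [Nat.cast_one]
      exact tsub_le_self.trans le_self_add
    have hr' := hr.mono_order (m' := m₁ + m₂) PH.mono_order (by push_cast; linarith)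
    rw [Nat.cast_one] at hr'
    exact ((hs.of_le hle le_rfl).add PH.add hr').isHolderSymbol hδ
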